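/- Let $(p_n)_{n\ge 0}$ be positive reals with $p_0=1$, non-increasing and tending to $0$, such that $p_{n+1}\le\lambda p_n$ for all $n$, where $0<\lambda<\lambda_0:=(\sqrt6-1)/5$. Consider the infinite step billiard in the table $P=\bigcup_{n\ge0}[n,n+1]\times[0,p_n]$. *Surface and flow.* For $k\in\mathbb Z$ put $h_k=p_k$ if $k\ge0$ and $h_{k}=p_{-k-1}$ if $k<0$. The invariant surface $S(\vartheta)$, $\vartheta\in(0,\pi/2)$, is $\bigcup_{k\in\mathbb Z}[k,k+1]\times[-h_k,h_k]$ with $(X,-h_k)\sim(X,h_k)$ for $X\in[k,k+1]$ and $(n,Y)\sim(-n,Y)$ for $n\ge1$, $p_n\le|Y|\le p_{n-1}$, with the quotient topology. The flow $\phi_t$ is the unit speed motion in direction $(\cos\vartheta,\sin\vartheta)$ on it; trajectories hitting a side or a vertex are continued from above (vertical intervals are closed below and open above), so that every trajectory is defined for all times $t\in\mathbb R$ (at a conical point $V_k=(\pm k,\pm p_k)$, $k\ge1$, three trajectories pass). Orbits are full orbits. A semi-orbit is unbounded if $|X|$ is unbounded on it; it escapes if $|X|\to\infty$ along it, and it is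 oscillating if it is unbounded and does not escape. Let $L=\{0\}\times[-1,1)$, a closed curve in $S(\vartheta)$. Let $E^{(n)}_\vartheta\subset L$ be the set of points whose forward orbit reaches $\{n\}\times[-p_n,p_n)$ without first colliding with a vertical wall, and $E_\vartheta=\bigcap_n E^{(n)}_\vartheta$. An escape orbit is the orbit of a point of $E_\vartheta$. *Typical directions.* Call $\vartheta\in(0,\pi/2)$ typical if: all forward and all backward semi-orbits are unbounded; $E_\vartheta^{(n)}$ is a single right-open interval of the closed curve $L$ for infinitely many $n$; there is exactly one escape orbit; and this orbit, denoted $\eta_\vartheta$, meets no point of $S(\vartheta)$ lying over a vertex of the table (the vertices being $(0,0)$, $(n,p_n)$ and $(n+1,p_n)$, $n\ge0$). **Proposition.** Lebesgue-almost every $\vartheta\in(0,\pi/2)$ is typical. For every typical $\vartheta$: (i) $\eta_\vartheta$ is oscillating in the past. (ii) $\eta_\vartheta$ is contained in the $\omega$-limit set of every orbit other than $\eta_\vartheta$. (iii) There is exactly one orbit that escapes in the past, and $\eta_\vartheta$ is contained in the $\alpha$-limit set of every other orbit. (iv) With these exceptions, every semi-orbit stays close to $\eta_\vartheta$ for arbitrarily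 long times. Precisely, let $w\in\eta_\vartheta$, $T>0$, and let $W$ be an open neighbourhood of the diagonal of $S(\vartheta)\times S(\vartheta)$ (for instance, all pairs at distance less than $\varepsilon$ for a metric inducing the topology). If $z\notin\eta_\vartheta$, there is $t_0\ge T$ such that $(\phi_{t_0+s}z,\phi_sw)\in W$ for all $s\in[-T,T]$. If the orbit of $z$ does not escape in the past, there is $t_0\le -T$ such that $(\phi_{t_0+s}z,\phi_sw)\in W$ for all $s\in[-T,T]$. (v) Every continuous function $f:S(\vartheta)\to\mathbb R$ that is invariant under the flow is constant. (vi) The flow is minimal (every orbit is dense in $S(\vartheta)$) if and only if $\eta_\vartheta$ is dense in $S(\vartheta)$. (vii) The closure of $\eta_\vartheta\cap L$ is either all of $L$ or a Cantor set (nonempty, compact, perfect and totally disconnected). -/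

import Mathlib

open Set Filter Topology MeasureTheory

noncomputable section

/-- An infinite step billiard: the heights `p n` of the steps of the table
`⋃ n, [n, n+1] × [0, p n]`. -/
structure StepBilliard where
  p : ℕ → ℝ
  p_zero : p 0 = 1
  p_pos : ∀ n, 0 < p n
  p_anti : Antitone p
  p_lim : Tendsto p atTop (𝓝 0)

namespace StepBilliard

variable (B : StepBilliard)

/-- The unfolded table (four reflected copies of the table) is the union over `k : ℤ` of the
rectangles `[k, k+1] × [-h k, h k]`, where `h k = p k` for `k ≥ 0` and `h (-n-1) = p n`. -/
def h : ℤ → ℝ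
  | Int.ofNat n => B.p n
  | Int.negSucc n => B.p n

lemma h_pos (k : ℤ) : 0 < B.h k := by
  cases k <;> exact B.p_pos _

lemma two_h_pos (k : ℤ) : 0 < 2 * B.h k := by
  have := B.h_pos k
  linarith

lemma h_reflect (k : ℤ) : B.h (-k - 1) = B.h k := by
  cases k with
  | ofNat n =>
    have e : -(Int.ofNat n) - 1 = Int.negSucc n := by
      rw [Int.negSucc_eq, Int.ofNat_eq_natCast]; ring
    rw [e]; rfl
  | negSucc n =>
    have e : -(Int.negSucc n) - 1 = Int.ofNat n := by
      rw [Int.negSucc_eq, Int.ofNat_eq_natCast]; ring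
    rw [e]; rfl

/-! ### The invariant surface -/

/-- The unfolded table, a closed subset of the plane. -/
def unfolded : Set (ℝ × ℝ) :=
  {q | ∃ k : ℤ, q.1 ∈ Icc (k : ℝ) (k + 1) ∧ q.2 ∈ Icc (-(B.h k)) (B.h k)}

/-- The side identifications: opposite horizontal sides of every rectangle are glued by a vertical
translation, and the vertical sides at abscissa `n+1` (at heights between `p (n+1)` and `p n` in
absolute value) are glued to those at abscissa `-(n+1)` by a horizontal translation. -/
inductive Glue : B.unfolded → B.unfolded → Prop
  | horizontal (k : ℤ) (a b : B.unfolded) (hx : a.1.1 ∈ Icc (k : ℝ) (k + 1))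
      (hab : b.1.1 = a.1.1) (ha : a.1.2 = -(B.h k)) (hb : b.1.2 = B.h k) : Glue a b
  | vertical (n : ℕ) (a b : B.unfolded) (ha : a.1.1 = -((n : ℝ) + 1)) (hb : b.1.1 = (n : ℝ) + 1)
      (hab : b.1.2 = a.1.2) (hy : |a.1.2| ∈ Icc (B.p (n + 1)) (B.p n)) : Glue a b

/-- The invariant surface: the unfolded table modulo the side identifications, with the quotient
topology. The vertices `(±n, ±p n)`, `n ≥ 1`, become one conical point of angle `6π`. -/
abbrev Surface : Type := Quot B.Glue

/-! ### The flow

Points of the phase space are points of the unfolded table, with one representative for each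
incoming trajectory: trajectories hitting a side or a vertex are continued from above, i.e. all
vertical intervals are closed below and open above. Only the conical points have more than one
(namely three) representatives. -/

/-- Phase points `(X, Y)`. -/
def Phase : Type := {q : ℝ × ℝ // q.2 ∈ Ico (-(B.h ⌊q.1⌋)) (B.h ⌊q.1⌋)}

variable {B} in
/-- The abscissa `X` of a phase point. -/
def Phase.X (z : B.Phase) : ℝ := z.1.1

variable {B} in
/-- The ordinate `Y` of a phase point. -/
def Phase.Y (z : B.Phase) : ℝ := z.1.2

lemma Phase.mem_unfolded (z : B.Phase) : z.1 ∈ B.unfolded :=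
  ⟨⌊z.1.1⌋, ⟨Int.floor_le _, (Int.lt_floor_add_one _).le⟩, z.2.1, z.2.2.le⟩

/-- The point of the surface represented by a phase point. -/
def proj (z : B.Phase) : B.Surface := Quot.mk _ ⟨z.1, Phase.mem_unfolded B z⟩

/-- Vertical cross-sections of the rectangles: `(k, y)` with `-h k ≤ y < h k`. -/
def Edge : Type := {e : ℤ × ℝ // e.2 ∈ Ico (-(B.h e.1)) (B.h e.1)}

/-- Reduction of an ordinate modulo `2 * h k` to `[-h k, h k)`; this realizes the gluing of the
horizontal sides of the `k`-th rectangle. -/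
def wrap (k : ℤ) (y : ℝ) : ℝ := toIcoMod (B.two_h_pos k) (-(B.h k)) y

lemma wrap_mem (k : ℤ) (y : ℝ) : B.wrap k y ∈ Ico (-(B.h k)) (B.h k) := by
  have := toIcoMod_mem_Ico (B.two_h_pos k) (-(B.h k)) y
  have e : -(B.h k) + 2 * B.h k = B.h k := by ring
  rwa [e] at this

lemma wrap_eq_self {k : ℤ} {y : ℝ} (hy : y ∈ Ico (-(B.h k)) (B.h k)) : B.wrap k y = y := by
  have e : -(B.h k) + 2 * B.h k = B.h k := by ring
  exact (toIcoMod_eq_self _).2 (by rwa [e])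

lemma wrap_wrap_add (k : ℤ) (y c : ℝ) : B.wrap k (B.wrap k y + c) = B.wrap k (y + c) := by
  have : B.wrap k y + c = y + c - toIcoDiv (B.two_h_pos k) (-(B.h k)) y • (2 * B.h k) := by
    unfold wrap toIcoMod
    ring
  rw [this]
  exact toIcoMod_sub_zsmul _ _ _ _

/-- Crossing the `k`-th rectangle from left to right with slope `a`. -/
def shift (a : ℝ) : Equiv.Perm B.Edge where
  toFun e := ⟨(e.1.1, B.wrap e.1.1 (e.1.2 + a)), B.wrap_mem _ _⟩
  invFun e := ⟨(e.1.1, B.wrap e.1.1 (e.1.2 - a)), B.wrap_mem _ _⟩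
  left_inv e := by
    apply Subtype.ext
    refine Prod.ext rfl ?_
    simp only [sub_eq_add_neg, wrap_wrap_add, add_neg_cancel_right]
    exact B.wrap_eq_self e.2
  right_inv e := by
    apply Subtype.ext
    refine Prod.ext rfl ?_
    simp only [sub_eq_add_neg, wrap_wrap_add, neg_add_cancel_right]
    exact B.wrap_eq_self e.2

open Classical in
/-- Leaving the `k`-th rectangle through its right side `X = k+1` at height `y`: if the next
rectangle is open at that height, one enters it; otherwise one is at a vertical side, which is
glued to the one at `X = -(k+1)`. -/
def exitFun (e : B.Edge) : B.Edge :=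
  if hy : e.1.2 ∈ Ico (-(B.h (e.1.1 + 1))) (B.h (e.1.1 + 1)) then
    ⟨(e.1.1 + 1, e.1.2), hy⟩
  else ⟨(-e.1.1 - 1, e.1.2), by simpa only [h_reflect] using e.2⟩

open Classical in
/-- The inverse of `exitFun`. -/
def exitInv (e : B.Edge) : B.Edge :=
  if hy : e.1.2 ∈ Ico (-(B.h (e.1.1 - 1))) (B.h (e.1.1 - 1)) then
    ⟨(e.1.1 - 1, e.1.2), hy⟩
  else ⟨(-e.1.1 - 1, e.1.2), by simpa only [h_reflect] using e.2⟩

lemma exitInv_exitFun (e : B.Edge) : B.exitInv (B.exitFun e) = e := by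
  obtain ⟨⟨k, y⟩, he⟩ := e
  dsimp only at he
  by_cases hy : y ∈ Ico (-(B.h (k + 1))) (B.h (k + 1))
  · have h1 : B.exitFun ⟨(k, y), he⟩ = ⟨(k + 1, y), hy⟩ := dif_pos hy
    have h2 : y ∈ Ico (-(B.h (k + 1 - 1))) (B.h (k + 1 - 1)) := by
      rwa [add_sub_cancel_right]
    rw [h1]
    exact (dif_pos h2).trans (Subtype.ext (Prod.ext (add_sub_cancel_right k 1) rfl))
  · have h0 : y ∈ Ico (-(B.h (-k - 1))) (B.h (-k - 1)) := by rwa [h_reflect]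
    have h1 : B.exitFun ⟨(k, y), he⟩ = ⟨(-k - 1, y), h0⟩ := dif_neg hy
    have h2 : ¬ y ∈ Ico (-(B.h (-k - 1 - 1))) (B.h (-k - 1 - 1)) := by
      have e1 : -k - 1 - 1 = -(k + 1) - 1 := by ring
      rwa [e1, h_reflect]
    rw [h1]
    refine (dif_neg h2).trans (Subtype.ext (Prod.ext ?_ rfl))
    change -(-k - 1) - 1 = k
    ring

lemma exitFun_exitInv (e : B.Edge) : B.exitFun (B.exitInv e) = e := by
  obtain ⟨⟨k, y⟩, he⟩ := e
  dsimp only at he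
  by_cases hy : y ∈ Ico (-(B.h (k - 1))) (B.h (k - 1))
  · have h1 : B.exitInv ⟨(k, y), he⟩ = ⟨(k - 1, y), hy⟩ := dif_pos hy
    have h2 : y ∈ Ico (-(B.h (k - 1 + 1))) (B.h (k - 1 + 1)) := by
      rwa [sub_add_cancel]
    rw [h1]
    exact (dif_pos h2).trans (Subtype.ext (Prod.ext (sub_add_cancel k 1) rfl))
  · have h0 : y ∈ Ico (-(B.h (-k - 1))) (B.h (-k - 1)) := by rwa [h_reflect]
    have h1 : B.exitInv ⟨(k, y), he⟩ = ⟨(-k - 1, y), h0⟩ := dif_neg hy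
    have h2 : ¬ y ∈ Ico (-(B.h (-k - 1 + 1))) (B.h (-k - 1 + 1)) := by
      have e1 : -k - 1 + 1 = -(k - 1) - 1 := by ring
      rwa [e1, h_reflect]
    rw [h1]
    refine (dif_neg h2).trans (Subtype.ext (Prod.ext ?_ rfl))
    change -(-k - 1) - 1 = k
    ring

/-- `exitFun` as a bijection. -/
def exit : Equiv.Perm B.Edge := ⟨B.exitFun, B.exitInv, B.exitInv_exitFun, B.exitFun_exitInv⟩

/-- The passage from one vertical cross-section to the next along the direction of slope `a`. -/
def step (a : ℝ) : Equiv.Perm B.Edge := (B.shift a).trans B.exit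

/-- The point at which the line of slope `a` ending at `z` entered the rectangle of `z`. -/
def base (a : ℝ) (z : B.Phase) : B.Edge :=
  ⟨(⌊z.X⌋, B.wrap ⌊z.X⌋ (z.Y - a * Int.fract z.X)), B.wrap_mem _ _⟩

/-- The point reached from the cross-section point `e` along the direction of slope `a` after a
horizontal displacement `s` with `0 ≤ s < 1`. -/
def along (a : ℝ) (e : B.Edge) (s : ℝ) (hs : s ∈ Ico (0 : ℝ) 1) : B.Phase :=
  ⟨((e.1.1 : ℝ) + s, B.wrap e.1.1 (e.1.2 + a * s)), by
    have : ⌊(e.1.1 : ℝ) + s⌋ = e.1.1 := by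
      rw [Int.floor_intCast_add, Int.floor_eq_zero_iff.2 hs, add_zero]
    simpa only [this] using B.wrap_mem _ _⟩

/-- The billiard flow at unit speed in the direction `θ`: in time `t` the horizontal displacement
is `t * cos θ`, and the slope is `tan θ`. -/
def flow (θ t : ℝ) (z : B.Phase) : B.Phase :=
  B.along (Real.tan θ)
    ((B.step (Real.tan θ) ^ ⌊Int.fract z.X + t * Real.cos θ⌋) (B.base (Real.tan θ) z))
    (Int.fract (Int.fract z.X + t * Real.cos θ)) ⟨Int.fract_nonneg _, Int.fract_lt_one _⟩

/-- The orbit of a phase point (for all times, past and future). -/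
def orbit (θ : ℝ) (z : B.Phase) : Set B.Phase := range fun t => B.flow θ t z

/-- The `ω`-limit set of the orbit of `z`, in the surface. -/
def omegaLim (θ : ℝ) (z : B.Phase) : Set B.Surface :=
  omegaLimit atTop (fun t w => B.proj (B.flow θ t w)) {z}

/-- The `α`-limit set of the orbit of `z`, in the surface. -/
def alphaLim (θ : ℝ) (z : B.Phase) : Set B.Surface :=
  omegaLimit atBot (fun t w => B.proj (B.flow θ t w)) {z}

/-! ### Escape orbits and typical directions -/

/-- The curve `L`, i.e. `{0} × [-1, 1)`, as a set of phase points. -/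
def section0 : Set B.Phase := {z | z.X = 0}

/-- The points of `L` whose forward orbit reaches the aperture `{n} × [-p n, p n)` directly,
i.e. without meeting any vertical wall before. -/
def reach (θ : ℝ) (n : ℕ) : Set B.Phase :=
  {z | z ∈ B.section0 ∧ ∀ t ∈ Icc 0 ((n : ℝ) / Real.cos θ), (B.flow θ t z).X = t * Real.cos θ}

/-- A subset of `L` that is a single right-open interval of the closed curve `L ≃ ℝ / 2ℤ`. -/
def IsSingleInterval (S : Set B.Phase) : Prop :=
  ∃ a b : ℝ, a < b ∧ S = {z | z ∈ B.section0 ∧ ∃ m : ℤ, z.Y + 2 * m ∈ Ico a b}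

/-- The points of `L` whose forward orbit reaches all apertures directly. -/
def escapePoints (θ : ℝ) : Set B.Phase := ⋂ n : ℕ, B.reach θ n

/-- Escape orbits: the orbits of the points of `escapePoints`. -/
def IsEscapeOrbit (θ : ℝ) (O : Set B.Phase) : Prop :=
  ∃ z ∈ B.escapePoints θ, O = B.orbit θ z

/-- The orbit of `z` goes to infinity as `t → -∞`. -/
def EscapesInPast (θ : ℝ) (z : B.Phase) : Prop :=
  Tendsto (fun t => |(B.flow θ t z).X|) atBot atTop

/-- The forward semi-orbit of `z` is unbounded. -/
def UnboundedInFuture (θ : ℝ) (z : B.Phase) : Prop :=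
  ∀ M : ℝ, ∃ t ≥ 0, M < |(B.flow θ t z).X|

/-- The backward semi-orbit of `z` is unbounded. -/
def UnboundedInPast (θ : ℝ) (z : B.Phase) : Prop :=
  ∀ M : ℝ, ∃ t ≤ 0, M < |(B.flow θ t z).X|

/-- The backward semi-orbit of `z` is oscillating: unbounded and not escaping. -/
def OscillatesInPast (θ : ℝ) (z : B.Phase) : Prop :=
  B.UnboundedInPast θ z ∧ ¬ B.EscapesInPast θ z

/-- The vertices of the table `⋃ n, [n, n+1] × [0, p n]`. -/
def tableVertices : Set (ℝ × ℝ) :=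
  {(0, 0)} ∪ (range fun n : ℕ => ((n : ℝ), B.p n)) ∪ (range fun n : ℕ => ((n : ℝ) + 1, B.p n))

/-- The phase points lying over a vertex of the table. -/
def IsVertex (z : B.Phase) : Prop := (|z.X|, |z.Y|) ∈ B.tableVertices

/-- Typical directions: all semi-orbits are unbounded; infinitely many of the sets `reach θ n`
are single intervals; there is exactly one escape orbit, and it meets no vertex. -/
structure IsTypical (θ : ℝ) : Prop where
  unboundedInFuture : ∀ z, B.UnboundedInFuture θ z
  unboundedInPast : ∀ z, B.UnboundedInPast θ z
  singleInterval : ∃ᶠ n in atTop, B.IsSingleInterval (B.reach θ n)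
  existsUnique : ∃! O, B.IsEscapeOrbit θ O
  noVertex : ∀ O, B.IsEscapeOrbit θ O → ∀ z ∈ O, ¬ B.IsVertex z

/-- The flow is minimal: every orbit is dense in the surface. -/
def IsMinimalFlow (θ : ℝ) : Prop := ∀ z, Dense (B.proj '' B.orbit θ z)

end StepBilliard

/-- Cantor sets: nonempty, compact, perfect and totally disconnected. -/
def IsCantorSet {Z : Type*} [TopologicalSpace Z] (C : Set Z) : Prop :=
  C.Nonempty ∧ IsCompact C ∧ Perfect C ∧ IsTotallyDisconnected C

end

open Set Filter Topology MeasureTheory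

noncomputable section

namespace StepBilliard

variable {B : StepBilliard}

/-! ### Edges, their abscissae and ordinates -/

/-! The flow is the suspension of `step a`, with `a = tan θ`, on the vertical sections `Edge`: cross
a rectangle with slope `a`, then enter the next one or, at a wall, jump to the opposite one. This
map is a piecewise vertical translation, continuous from the right, and it adds `a` to the ordinate
modulo `lattice`. On the left half-table nothing obstructs the motion to the right, and a backward
step from the right half-table always goes one rectangle to the left.

Almost every direction is typical. Unboundedness: for all but countably many slopes no nonzero
multiple of `a` lies in `lattice` (`Generic`). The set of points with full orbit in a bounded region
is closed under limits from the right. A gap below one of its points would travel along the orbit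
until the orbit met a discontinuity in the future, and another one in the past, which yields a
forbidden relation. Hence the set consists of whole circles, and whole circles can be followed to
the right beyond every bound; so it is empty. A bounded semi-orbit would accumulate on such a point,
after a half turn (`mirror`) if the accumulation is from the left. Single intervals: aperture `m` is
`Clear` if no vertex to its left reaches it directly; it then pulls back to `L` without being cut.
After `N` steps the ordinate is piecewise affine in `a` with slope `N`. Each aperture passed
directly multiplies the number of branches by at most `2 (N + 1) / N` and the heights by at most
`lam`, so the slopes for which a given vertex passes `i` more apertures have measure of order `(2 *
lam) ^ i`. Summed over the vertices, this leaves asymptotically a proportion at most `lam / (1 - 2 *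
lam) < 1` of bad slopes in every interval, and the density theorem gives `ae_frequently_clear`.
Nested intervals then produce exactly one escape point, and the same count for a single starting
point keeps it away from the countably many vertices.

Properties of a typical direction. Let `e₀` be the escape point on `L`. The sets `reach θ n`
decrease to `e₀` and are often single intervals, so points moving directly to a far aperture are
close to `e₀` (`IsTypical.exists_direct_close`). An orbit traced back from far away to its first
meeting with `L` meets it in such a point (`exists_direct_of_far`). Hence an orbit visiting `L`
infinitely often comes back close to `e₀` infinitely often. The orbits which do not are, in the
future, that of `e₀` and, in the past, that of `e₀.mirror`; these two differ because a regular orbit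
is never symmetric (`Regular.zpow_ne_mirror`), which is (i). Since `e₀` is regular, the flow on the
surface is jointly continuous there, and closeness to `e₀` becomes shadowing: this gives (ii)-(iv),
and (v), (vi) because the orbit of `e₀` lies in the closure of every orbit. For (vii), local
translations along the orbit of `e₀` carry its self-accumulation, and any arc in the closure, from
one point of the trace to another. -/

/-- The index of the rectangle of an edge point. -/
def Edge.k (e : B.Edge) : ℤ := e.1.1

/-- The ordinate of an edge point. -/
def Edge.y (e : B.Edge) : ℝ := e.1.2

lemma Edge.mem (e : B.Edge) : e.y ∈ Ico (-(B.h e.k)) (B.h e.k) := e.2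

lemma Edge.ext' {e f : B.Edge} (hk : e.k = f.k) (hy : e.y = f.y) : e = f :=
  Subtype.ext (Prod.ext hk hy)

variable (B) in
/-- The edge point over the `k`-th rectangle whose ordinate is `y` modulo `2 * h k`. -/
def pt (k : ℤ) (y : ℝ) : B.Edge := ⟨(k, B.wrap k y), B.wrap_mem k y⟩

@[simp] lemma pt_k (k : ℤ) (y : ℝ) : (B.pt k y).k = k := rfl

lemma pt_y (k : ℤ) (y : ℝ) : (B.pt k y).y = B.wrap k y := rfl

lemma pt_y_of_mem {k : ℤ} {y : ℝ} (hy : y ∈ Ico (-(B.h k)) (B.h k)) : (B.pt k y).y = y :=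
  B.wrap_eq_self hy

@[simp] lemma pt_eta (e : B.Edge) : B.pt e.k e.y = e :=
  Edge.ext' rfl (B.wrap_eq_self e.mem)

lemma wrap_eq_sub (k : ℤ) (y : ℝ) : ∃ m : ℤ, B.wrap k y = y - m * (2 * B.h k) := by
  refine ⟨toIcoDiv (B.two_h_pos k) (-(B.h k)) y, ?_⟩
  unfold wrap toIcoMod
  rw [zsmul_eq_mul]

lemma wrap_sub_zsmul (k : ℤ) (y : ℝ) (m : ℤ) : B.wrap k (y - m * (2 * B.h k)) = B.wrap k y := by
  unfold wrap
  rw [← zsmul_eq_mul]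
  exact toIcoMod_sub_zsmul _ _ _ _

lemma pt_eq_pt_iff {k : ℤ} {y z : ℝ} :
    B.pt k y = B.pt k z ↔ ∃ m : ℤ, y = z + m * (2 * B.h k) := by
  constructor
  · intro h
    have h' : B.wrap k y = B.wrap k z := congrArg Edge.y h
    obtain ⟨m, hm⟩ := B.wrap_eq_sub k y
    obtain ⟨n, hn⟩ := B.wrap_eq_sub k z
    exact ⟨m - n, by push_cast; linarith⟩
  · rintro ⟨m, rfl⟩
    have := B.wrap_sub_zsmul k (z + m * (2 * B.h k)) m
    rw [add_sub_cancel_right] at this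
    exact Edge.ext' rfl this.symm

lemma pt_wrap_add (k : ℤ) (y c : ℝ) : B.pt k (B.wrap k y + c) = B.pt k (y + c) :=
  Edge.ext' rfl (B.wrap_wrap_add k y c)

lemma shift_pt (a : ℝ) (k : ℤ) (y : ℝ) : B.shift a (B.pt k y) = B.pt k (y + a) :=
  Edge.ext' rfl (B.wrap_wrap_add k y a)

lemma shift_symm_pt (a : ℝ) (k : ℤ) (y : ℝ) : (B.shift a).symm (B.pt k y) = B.pt k (y - a) := by
  rw [Equiv.symm_apply_eq, shift_pt, sub_add_cancel]

lemma exit_of_mem {e : B.Edge} (h : e.y ∈ Ico (-(B.h (e.k + 1))) (B.h (e.k + 1))) :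
    B.exit e = B.pt (e.k + 1) e.y :=
  (dif_pos h : B.exitFun e = _).trans (Edge.ext' rfl (B.wrap_eq_self h).symm)

lemma exit_of_not_mem {e : B.Edge} (h : e.y ∉ Ico (-(B.h (e.k + 1))) (B.h (e.k + 1))) :
    B.exit e = B.pt (-e.k - 1) e.y := by
  have he : e.y ∈ Ico (-(B.h (-e.k - 1))) (B.h (-e.k - 1)) := by
    rw [h_reflect]; exact e.mem
  exact (dif_neg h : B.exitFun e = _).trans (Edge.ext' rfl (B.wrap_eq_self he).symm)

lemma exit_symm_of_mem {e : B.Edge} (h : e.y ∈ Ico (-(B.h (e.k - 1))) (B.h (e.k - 1))) :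
    B.exit.symm e = B.pt (e.k - 1) e.y :=
  (dif_pos h : B.exitInv e = _).trans (Edge.ext' rfl (B.wrap_eq_self h).symm)

lemma exit_symm_of_not_mem {e : B.Edge} (h : e.y ∉ Ico (-(B.h (e.k - 1))) (B.h (e.k - 1))) :
    B.exit.symm e = B.pt (-e.k - 1) e.y := by
  have he : e.y ∈ Ico (-(B.h (-e.k - 1))) (B.h (-e.k - 1)) := by
    rw [h_reflect]; exact e.mem
  exact (dif_neg h : B.exitInv e = _).trans (Edge.ext' rfl (B.wrap_eq_self he).symm)

@[simp] lemma exit_y (e : B.Edge) : (B.exit e).y = e.y := by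
  by_cases h : e.y ∈ Ico (-(B.h (e.k + 1))) (B.h (e.k + 1))
  · rw [exit_of_mem h, pt_y_of_mem h]
  · have he : e.y ∈ Ico (-(B.h (-e.k - 1))) (B.h (-e.k - 1)) := by
      rw [h_reflect]; exact e.mem
    rw [exit_of_not_mem h, pt_y_of_mem he]

lemma h_natCast (n : ℕ) : B.h n = B.p n := rfl

lemma h_neg_natCast (n : ℕ) : B.h (-n - 1) = B.p n := by rw [h_reflect, h_natCast]

lemma h_succ_le {k : ℤ} (hk : 0 ≤ k) : B.h (k + 1) ≤ B.h k := by
  lift k to ℕ using hk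
  exact B.p_anti (Nat.le_succ k)

lemma h_le_succ {k : ℤ} (hk : k < 0) : B.h k ≤ B.h (k + 1) := by
  obtain ⟨n, rfl⟩ : ∃ n : ℕ, k = -n - 1 := ⟨(-k - 1).toNat, by omega⟩
  rw [h_neg_natCast]
  rcases n with _ | n
  · have : (-((0 : ℕ) : ℤ) - 1 + 1) = ((0 : ℕ) : ℤ) := by simp
    rw [this, h_natCast]
  · have : (-((n + 1 : ℕ) : ℤ) - 1 + 1) = -(n : ℤ) - 1 := by push_cast; ring
    rw [this, h_neg_natCast]
    exact B.p_anti (Nat.le_succ n)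

lemma h_le_one (k : ℤ) : B.h k ≤ 1 := by
  rw [← B.p_zero]
  cases k <;> exact B.p_anti (Nat.zero_le _)

lemma h_zero : B.h 0 = 1 := B.p_zero

lemma h_neg_one : B.h (-1) = 1 := B.p_zero

/-! ### Horizontal dynamics of the step map -/

lemma step_apply (a : ℝ) (e : B.Edge) : B.step a e = B.exit (B.pt e.k (e.y + a)) := by
  conv_lhs => rw [← pt_eta e]
  change B.exit (B.shift a _) = _
  rw [shift_pt]

lemma step_y (a : ℝ) (e : B.Edge) : (B.step a e).y = B.wrap e.k (e.y + a) := by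
  rw [step_apply, exit_y, pt_y]

/-- On the left half-table the heights do not decrease to the right, so a wall can only be met over
a rectangle with `0 ≤ k`. -/
lemma step_k_cases (a : ℝ) (e : B.Edge) :
    (B.step a e).k = e.k + 1 ∨ 0 ≤ e.k ∧ (B.step a e).k = -e.k - 1 := by
  rw [step_apply]
  by_cases h : B.wrap e.k (e.y + a) ∈ Ico (-(B.h (e.k + 1))) (B.h (e.k + 1))
  · left; rw [exit_of_mem (e := B.pt e.k (e.y + a)) h]; rfl
  · right
    refine ⟨?_, ?_⟩
    · by_contra hk
      have h1 := h_le_succ (B := B) (not_le.1 hk)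
      have h2 := B.wrap_mem e.k (e.y + a)
      exact h ⟨by linarith [h2.1], by linarith [h2.2]⟩
    · rw [exit_of_not_mem (e := B.pt e.k (e.y + a)) h]; rfl

lemma step_k_of_neg (a : ℝ) {e : B.Edge} (he : e.k < 0) : (B.step a e).k = e.k + 1 := by
  rcases step_k_cases a e with h | ⟨h, -⟩
  · exact h
  · omega

lemma step_k_iff (a : ℝ) (e : B.Edge) : (B.step a e).k = e.k + 1 ↔
    B.wrap e.k (e.y + a) ∈ Ico (-(B.h (e.k + 1))) (B.h (e.k + 1)) := by
  rw [step_apply]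
  constructor
  · intro h
    by_contra hn
    rw [exit_of_not_mem (e := B.pt e.k (e.y + a)) hn] at h
    change -e.k - 1 = e.k + 1 at h
    -- The two alternatives lead to the same index only for `k = -1`, where both rectangles have
    -- height 1 and there is no wall.
    have hk : e.k = -1 := by omega
    have h2 := B.wrap_mem e.k (e.y + a)
    have h3 : B.h (e.k + 1) = B.h e.k := by
      rw [hk, h_neg_one, show (-1 : ℤ) + 1 = 0 by norm_num, h_zero]
    rw [h3] at hn
    exact hn h2
  · intro h
    rw [exit_of_mem (e := B.pt e.k (e.y + a)) h]; rfl

lemma symm_k_cases (a : ℝ) (e : B.Edge) :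
    ((B.step a).symm e).k = e.k - 1 ∨ e.k < 0 ∧ ((B.step a).symm e).k = -e.k - 1 := by
  have := step_k_cases a ((B.step a).symm e)
  rw [Equiv.apply_symm_apply] at this
  omega

lemma symm_k_of_nonneg (a : ℝ) {e : B.Edge} (he : 0 ≤ e.k) :
    ((B.step a).symm e).k = e.k - 1 := by
  have := symm_k_cases a e
  omega

lemma symm_apply (a : ℝ) (e : B.Edge) :
    (B.step a).symm e = (B.shift a).symm (B.exit.symm e) := rfl

/-- Backward steps from the right half-table. -/
lemma symm_apply_of_pos (a : ℝ) {e : B.Edge} (he : 0 < e.k) :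
    (B.step a).symm e = B.pt (e.k - 1) (e.y - a) := by
  have h1 := h_succ_le (B := B) (k := e.k - 1) (by omega)
  rw [sub_add_cancel] at h1
  have h2 := e.mem
  rw [symm_apply, exit_symm_of_mem ⟨by linarith [h2.1], by linarith [h2.2]⟩, shift_symm_pt]

/-! ### Ordinates modulo the heights -/

variable (B) in
/-- The group generated by the heights. -/
def lattice : AddSubgroup ℝ := (Finsupp.linearCombination ℤ B.p).range.toAddSubgroup

lemma h_mem_lattice (k : ℤ) : B.h k ∈ B.lattice := by
  cases k with
  | ofNat n => exact ⟨Finsupp.single n 1, by simp [h]⟩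
  | negSucc n => exact ⟨Finsupp.single n 1, by simp [h]⟩

lemma wrap_sub_mem_lattice (k : ℤ) (y : ℝ) : B.wrap k y - y ∈ B.lattice := by
  obtain ⟨m, hm⟩ := B.wrap_eq_sub k y
  have : B.wrap k y - y = (-2 * m) • B.h k := by
    rw [hm, zsmul_eq_mul]; push_cast; ring
  rw [this]
  exact AddSubgroup.zsmul_mem _ (h_mem_lattice k) _

lemma step_y_sub_mem (a : ℝ) (e : B.Edge) : (B.step a e).y - e.y - a ∈ B.lattice := by
  rw [step_y]
  have := wrap_sub_mem_lattice (B := B) e.k (e.y + a)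
  rwa [← sub_sub] at this

/-- Wrapping changes the ordinate by a multiple of a height and `exit` does not change it. This is
the only arithmetic information on orbits that is needed. -/
lemma zpow_y_sub_mem (a : ℝ) (e : B.Edge) (n : ℤ) :
    ((B.step a ^ n) e).y - e.y - n * a ∈ B.lattice := by
  induction n using Int.induction_on with
  | zero => simp
  | succ n ih =>
    have := step_y_sub_mem a ((B.step a ^ (n : ℤ)) e)
    have h := AddSubgroup.add_mem _ ih this
    rw [add_comm (n : ℤ) 1, zpow_add, zpow_one, Equiv.Perm.mul_apply]
    convert h using 1; push_cast; ring
  | pred n ih =>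
    have := step_y_sub_mem a ((B.step a ^ (-(n : ℤ) - 1)) e)
    rw [← Equiv.Perm.mul_apply, ← zpow_one_add, show 1 + (-(n : ℤ) - 1) = -n by ring] at this
    have h := AddSubgroup.sub_mem _ ih this
    convert h using 1; push_cast; ring

variable (B) in
/-- Slopes which are not rational combinations of the heights. -/
def Generic (a : ℝ) : Prop := ∀ n : ℤ, n ≠ 0 → (n : ℝ) * a ∉ B.lattice

lemma Generic.ne_of_ne {a : ℝ} (ha : B.Generic a) (e : B.Edge) {m n : ℤ} (hmn : m ≠ n) :
    (B.step a ^ m) e ≠ (B.step a ^ n) e := by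
  intro h
  apply ha (m - n) (sub_ne_zero.2 hmn)
  have h1 := zpow_y_sub_mem a e m
  have h2 := zpow_y_sub_mem a e n
  rw [h] at h1
  have := AddSubgroup.sub_mem _ h2 h1
  convert this using 1; push_cast; ring

lemma Generic.not_mem {a : ℝ} (ha : B.Generic a) (e : B.Edge) {n : ℤ} (hn : n ≠ 0)
    (he : e.y ∈ B.lattice) : ((B.step a ^ n) e).y ∉ B.lattice := by
  intro h
  apply ha n hn
  have h1 := zpow_y_sub_mem a e n
  have := AddSubgroup.sub_mem _ (AddSubgroup.sub_mem _ h he) h1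
  convert this using 1; ring

lemma countable_not_generic : {a | ¬ B.Generic a}.Countable := by
  have hc : (B.lattice : Set ℝ).Countable :=
    countable_range (Finsupp.linearCombination ℤ B.p)
  have : {a | ¬ B.Generic a} ⊆ ⋃ n : ℤ, (fun x => x / n) '' (B.lattice : Set ℝ) := by
    intro a ha
    simp only [Generic, mem_ofPred_eq, not_forall, not_not] at ha
    obtain ⟨n, hn, h⟩ := ha
    refine mem_iUnion.2 ⟨n, n * a, h, ?_⟩
    have : (n : ℝ) ≠ 0 := by exact_mod_cast hn
    field_simp
  exact (countable_iUnion fun n => hc.image _).mono this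

/-! ### The flow as a suspension of the step map -/

/-- The phase point of an edge point. -/
def Edge.toPhase (e : B.Edge) : B.Phase :=
  ⟨(e.k, e.y), by simpa only [Int.floor_intCast] using e.mem⟩

@[simp] lemma toPhase_X (e : B.Edge) : e.toPhase.X = e.k := rfl

@[simp] lemma toPhase_Y (e : B.Edge) : e.toPhase.Y = e.y := rfl

lemma Phase.ext' {z w : B.Phase} (hX : z.X = w.X) (hY : z.Y = w.Y) : z = w :=
  Subtype.ext (Prod.ext hX hY)

lemma along_X (a : ℝ) (e : B.Edge) (s : ℝ) (hs : s ∈ Ico (0 : ℝ) 1) :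
    (B.along a e s hs).X = e.k + s := rfl

lemma along_Y (a : ℝ) (e : B.Edge) (s : ℝ) (hs : s ∈ Ico (0 : ℝ) 1) :
    (B.along a e s hs).Y = B.wrap e.k (e.y + a * s) := rfl

lemma along_congr {a : ℝ} {e f : B.Edge} {s t : ℝ} {hs : s ∈ Ico (0 : ℝ) 1}
    {ht : t ∈ Ico (0 : ℝ) 1} (h1 : e = f) (h2 : s = t) : B.along a e s hs = B.along a f t ht := by
  subst h1; subst h2; rfl

lemma fract_mem_Ico (x : ℝ) : Int.fract x ∈ Ico (0 : ℝ) 1 :=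
  ⟨Int.fract_nonneg x, Int.fract_lt_one x⟩

lemma flow_eq (θ t : ℝ) (z : B.Phase) : B.flow θ t z = B.along (Real.tan θ)
    ((B.step (Real.tan θ) ^ ⌊Int.fract z.X + t * Real.cos θ⌋) (B.base (Real.tan θ) z))
    (Int.fract (Int.fract z.X + t * Real.cos θ)) (fract_mem_Ico _) := rfl

lemma floor_along (a : ℝ) (e : B.Edge) (s : ℝ) (hs : s ∈ Ico (0 : ℝ) 1) :
    ⌊(B.along a e s hs).X⌋ = e.k := by
  rw [along_X, Int.floor_intCast_add, Int.floor_eq_zero_iff.2 hs, add_zero]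

lemma fract_along (a : ℝ) (e : B.Edge) (s : ℝ) (hs : s ∈ Ico (0 : ℝ) 1) :
    Int.fract (B.along a e s hs).X = s := by
  rw [along_X, Int.fract_intCast_add, Int.fract_eq_self.2 hs]

lemma base_eq_pt (a : ℝ) (z : B.Phase) :
    B.base a z = B.pt ⌊z.X⌋ (z.Y - a * Int.fract z.X) := rfl

lemma base_along (a : ℝ) (e : B.Edge) (s : ℝ) (hs : s ∈ Ico (0 : ℝ) 1) :
    B.base a (B.along a e s hs) = e := by
  rw [base_eq_pt, floor_along, fract_along, along_Y, sub_eq_add_neg, pt_wrap_add,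
    add_neg_cancel_right, pt_eta]

lemma along_base (a : ℝ) (z : B.Phase) :
    B.along a (B.base a z) (Int.fract z.X) (fract_mem_Ico _) = z := by
  apply Phase.ext'
  · rw [along_X]
    exact Int.floor_add_fract z.X
  · rw [along_Y]
    change B.wrap ⌊z.X⌋ (B.wrap ⌊z.X⌋ (z.Y - a * Int.fract z.X) + a * Int.fract z.X) = z.Y
    rw [wrap_wrap_add, sub_add_cancel]
    exact B.wrap_eq_self z.2

/-- Horizontal displacements add with carry: the integer part counts applications of `step`, the
fractional part is the position in the rectangle. -/
lemma flow_flow (θ s t : ℝ) (z : B.Phase) :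
    B.flow θ s (B.flow θ t z) = B.flow θ (t + s) z := by
  simp only [flow_eq]
  have key : Int.fract z.X + (t + s) * Real.cos θ = (⌊Int.fract z.X + t * Real.cos θ⌋ : ℝ) +
      (Int.fract (Int.fract z.X + t * Real.cos θ) + s * Real.cos θ) := by
    have := Int.floor_add_fract (Int.fract z.X + t * Real.cos θ)
    linarith
  apply along_congr
  · rw [base_along, fract_along, key, Int.floor_intCast_add, add_comm (⌊_⌋ : ℤ), zpow_add]
    rfl
  · rw [fract_along, key, Int.fract_intCast_add]

lemma flow_zero (θ : ℝ) (z : B.Phase) : B.flow θ 0 z = z := by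
  conv_rhs => rw [← along_base (Real.tan θ) z]
  rw [flow_eq]
  have h : Int.fract z.X + 0 * Real.cos θ = Int.fract z.X := by ring
  apply along_congr
  · rw [h, Int.floor_fract, zpow_zero]; rfl
  · rw [h, Int.fract_fract]

lemma base_toPhase (a : ℝ) (e : B.Edge) : B.base a e.toPhase = e := by
  rw [base_eq_pt, toPhase_X, toPhase_Y, Int.floor_intCast, Int.fract_intCast, mul_zero, sub_zero,
    pt_eta]

lemma base_flow (θ t : ℝ) (z : B.Phase) : B.base (Real.tan θ) (B.flow θ t z) =
    (B.step (Real.tan θ) ^ ⌊Int.fract z.X + t * Real.cos θ⌋) (B.base (Real.tan θ) z) :=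
  base_along _ _ _ _

lemma floor_X (a : ℝ) (z : B.Phase) : ⌊z.X⌋ = (B.base a z).k := rfl

lemma abs_X_sub_le (a : ℝ) (z : B.Phase) : |z.X - (B.base a z).k| ≤ 1 := by
  rw [← floor_X, abs_le]
  have h1 := Int.floor_le z.X
  have h2 := Int.lt_floor_add_one z.X
  constructor <;> linarith

lemma flow_toPhase (θ t : ℝ) (e : B.Edge) : B.flow θ t e.toPhase =
    B.along (Real.tan θ) ((B.step (Real.tan θ) ^ ⌊t * Real.cos θ⌋) e) (Int.fract (t * Real.cos θ))
      (fract_mem_Ico _) := by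
  rw [flow_eq]
  have h : Int.fract e.toPhase.X + t * Real.cos θ = t * Real.cos θ := by
    rw [toPhase_X, Int.fract_intCast, zero_add]
  apply along_congr
  · rw [base_toPhase, h]
  · rw [h]

lemma flow_int_toPhase {θ : ℝ} (hc : Real.cos θ ≠ 0) (n : ℤ) (e : B.Edge) :
    B.flow θ (n / Real.cos θ) e.toPhase = ((B.step (Real.tan θ) ^ n) e).toPhase := by
  rw [flow_toPhase]
  have h : (n : ℝ) / Real.cos θ * Real.cos θ = n := div_mul_cancel₀ _ hc
  apply Phase.ext'
  · rw [along_X, h, Int.fract_intCast, Int.floor_intCast, toPhase_X, add_zero]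
  · rw [along_Y, h, Int.fract_intCast, Int.floor_intCast, toPhase_Y, mul_zero, add_zero]
    exact B.wrap_eq_self (Edge.mem _)

lemma flow_base {θ : ℝ} (hc : Real.cos θ ≠ 0) (z : B.Phase) :
    B.flow θ (Int.fract z.X / Real.cos θ) (B.base (Real.tan θ) z).toPhase = z := by
  conv_rhs => rw [← along_base (Real.tan θ) z]
  rw [flow_toPhase]
  have h : Int.fract z.X / Real.cos θ * Real.cos θ = Int.fract z.X := div_mul_cancel₀ _ hc
  apply along_congr
  · rw [h, Int.floor_fract, zpow_zero]; rfl
  · rw [h, Int.fract_fract]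

lemma mem_orbit_self (θ : ℝ) (z : B.Phase) : z ∈ B.orbit θ z := ⟨0, flow_zero θ z⟩

lemma orbit_eq_of_mem {θ : ℝ} {z w : B.Phase} (h : w ∈ B.orbit θ z) :
    B.orbit θ w = B.orbit θ z := by
  obtain ⟨t, rfl⟩ := h
  ext x
  constructor
  · rintro ⟨s, rfl⟩
    exact ⟨t + s, (flow_flow θ s t z).symm⟩
  · rintro ⟨s, rfl⟩
    exact ⟨s - t, by simp only [flow_flow, add_sub_cancel]⟩

lemma toPhase_mem_orbit {θ : ℝ} (hc : Real.cos θ ≠ 0) (n : ℤ) (z : B.Phase) :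
    ((B.step (Real.tan θ) ^ n) (B.base (Real.tan θ) z)).toPhase ∈ B.orbit θ z := by
  have h : (B.base (Real.tan θ) z).toPhase ∈ B.orbit θ z := by
    refine ⟨-(Int.fract z.X / Real.cos θ), ?_⟩
    conv_lhs => rw [← flow_base hc z]
    simp only [flow_flow]
    rw [show Int.fract (B.flow θ (Int.fract z.X / Real.cos θ)
      (B.base (Real.tan θ) z).toPhase).X = Int.fract z.X by rw [flow_base hc], add_neg_cancel,
      flow_zero]
  rw [← orbit_eq_of_mem h]
  exact ⟨n / Real.cos θ, flow_int_toPhase hc n _⟩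

lemma mem_section0_iff {z : B.Phase} : z ∈ B.section0 ↔ z = (B.pt 0 z.Y).toPhase := by
  constructor
  · intro h
    have hX : z.X = 0 := h
    have hY : z.Y ∈ Ico (-(B.h 0)) (B.h 0) := by
      have := z.2
      rw [show z.1.1 = 0 from hX, Int.floor_zero] at this
      exact this
    exact Phase.ext' (by rw [hX]; simp) (pt_y_of_mem hY).symm
  · intro h
    rw [h]
    simp [section0]

/-- The edge points from which the next `n` steps all go to the right. -/
def Direct (a : ℝ) (n : ℕ) (e : B.Edge) : Prop :=
  ∀ i ≤ n, ((B.step a ^ (i : ℤ)) e).k = e.k + i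

/-- Inside a rectangle the abscissa always advances uniformly, so the condition at all real times
reduces to the successive crossings. -/
lemma mem_reach_iff {θ : ℝ} (hc : 0 < Real.cos θ) (n : ℕ) (e : B.Edge) :
    e.toPhase ∈ B.reach θ n ↔ e.k = 0 ∧ Direct (Real.tan θ) n e := by
  have h0 : e.toPhase ∈ B.section0 ↔ e.k = 0 := by
    change ((e.k : ℤ) : ℝ) = 0 ↔ _
    exact_mod_cast Iff.rfl
  change (e.toPhase ∈ B.section0 ∧ _) ↔ _
  rw [h0]
  refine and_congr_right fun hk => ?_
  constructor
  · intro h i hi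
    have := h (i / Real.cos θ) ⟨by positivity, by gcongr⟩
    have h2 := flow_int_toPhase hc.ne' (i : ℤ) e
    rw [Int.cast_natCast] at h2
    rw [h2, toPhase_X, div_mul_cancel₀ _ hc.ne'] at this
    rw [hk, zero_add]
    exact_mod_cast this
  · intro h t ht
    have ht0 : 0 ≤ t * Real.cos θ := mul_nonneg ht.1 hc.le
    have htn : t * Real.cos θ ≤ n := by rw [← le_div_iff₀ hc]; exact ht.2
    rw [flow_toPhase, along_X]
    obtain ⟨i, hi⟩ := Int.eq_ofNat_of_zero_le (Int.floor_nonneg.2 ht0)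
    have hin : i ≤ n := by
      have : (⌊t * Real.cos θ⌋ : ℝ) ≤ n := (Int.floor_le _).trans htn
      rw [hi] at this
      exact_mod_cast this
    have := h i hin
    rw [hi, this, hk, zero_add, ← hi]
    exact Int.floor_add_fract _

lemma Direct.mono {a : ℝ} {m n : ℕ} (hmn : m ≤ n) {e : B.Edge} (h : Direct a n e) :
    Direct a m e := fun i hi => h i (hi.trans hmn)

lemma mem_escapePoints_iff {θ : ℝ} (hc : 0 < Real.cos θ) (e : B.Edge) :
    e.toPhase ∈ B.escapePoints θ ↔
      e.k = 0 ∧ ∀ i : ℕ, ((B.step (Real.tan θ) ^ (i : ℤ)) e).k = i := by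
  simp only [escapePoints, mem_iInter, mem_reach_iff hc]
  constructor
  · intro h
    refine ⟨(h 0).1, fun i => ?_⟩
    rw [(h i).2 i le_rfl, (h 0).1, zero_add]
  · rintro ⟨h0, h⟩ n
    exact ⟨h0, fun i _ => by rw [h, h0, zero_add]⟩

/-! ### Measure of the slopes for which a point moves directly to the right -/

lemma card_Icc_ceil_floor_le {x y : ℝ} {K : ℕ} (h : y - x < K) :
    (Finset.Icc ⌈x⌉ ⌊y⌋).card ≤ K := by
  rw [Int.card_Icc]
  have h1 := Int.le_ceil x
  have h2 := Int.floor_le y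
  have : (⌊y⌋ : ℝ) - ⌈x⌉ < K := by linarith
  have : ⌊y⌋ - ⌈x⌉ < (K : ℤ) := by exact_mod_cast this
  omega

/-- Counts branches. Along a branch `c` the ordinate is `N a - c`; crossing the circle of length
`2H` turns `c` into `c + i (2H)`, where `i` is the winding number. A branch survives only if its
window meets the next aperture, which leaves few values of `i`. -/
lemma exists_cover_step {lam : ℝ} (hlam : lam < 3 / 10) {j : ℕ} (hp : B.p (j + 1) ≤ lam * B.p j)
    {A : Set ℝ} {e : ℝ → B.Edge} {N : ℕ} (hN : 1 ≤ N) {S : Finset ℝ} (hk : ∀ a ∈ A, (e a).k = j)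
    (hS : ∀ a ∈ A, ∃ c ∈ S, (e a).y = N * a - c) :
    ∃ S' : Finset ℝ, N * S'.card ≤ 2 * (N + 1) * S.card ∧
      ∀ a ∈ A, (B.step a (e a)).k = j + 1 → ∃ c ∈ S', (B.step a (e a)).y = (N + 1 : ℕ) * a - c := by
  classical
  set H := B.p j with hH
  have hHpos : 0 < H := B.p_pos j
  have hN' : (1 : ℝ) ≤ N := by exact_mod_cast hN
  -- The admissible `i` lie in an interval of length `2r = 1 + 1/N + lam`: at most two of them if `N
  -- ≥ 2`, at most three if `N = 1`. The bound `2 (N + 1) / N` covers both cases and telescopes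
  -- under iteration.
  obtain ⟨K, hK, hKr⟩ : ∃ K : ℕ, N * K ≤ 2 * (N + 1) ∧ 1 + 1 / (N : ℝ) + lam < K := by
    rcases hN.eq_or_lt with rfl | h2
    · exact ⟨3, by norm_num, by norm_num; linarith⟩
    · refine ⟨2, by omega, ?_⟩
      have : (2 : ℝ) ≤ N := by exact_mod_cast h2
      have : 1 / (N : ℝ) ≤ 1 / 2 := one_div_le_one_div_of_le (by norm_num) this
      push_cast; linarith
  set r : ℝ := (1 + 1 / (N : ℝ) + lam) / 2 with hr
  let I : ℝ → Finset ℤ := fun c => Finset.Icc ⌈c / (2 * H * N) - r⌉ ⌊c / (2 * H * N) + r⌋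
  refine ⟨S.biUnion fun c => (I c).image fun i : ℤ => c + i * (2 * H), ?_, ?_⟩
  · have : (S.biUnion fun c => (I c).image fun i : ℤ => c + i * (2 * H)).card ≤ S.card * K :=
      Finset.card_biUnion_le_card_mul _ _ _ fun c _ =>
        Finset.card_image_le.trans (card_Icc_ceil_floor_le (by linarith))
    calc N * _ ≤ N * (S.card * K) := Nat.mul_le_mul_left _ this
      _ = N * K * S.card := by ring
      _ ≤ _ := Nat.mul_le_mul_right _ hK
  · intro a ha hka
    obtain ⟨c, hc, hy⟩ := hS a ha
    have hkj := hk a ha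
    have hm : -H ≤ N * a - c ∧ N * a - c < H := by
      have := (e a).mem
      rw [hkj, h_natCast, hy] at this
      exact this
    have hm' := (B.step a (e a)).mem
    have hhj : B.h ((j : ℤ) + 1) = B.p (j + 1) := rfl
    rw [hka, hhj, step_y, hkj] at hm'
    obtain ⟨i, hi⟩ := B.wrap_eq_sub j ((e a).y + a)
    rw [h_natCast, hy, ← hH] at hi
    refine ⟨c + i * (2 * H), Finset.mem_biUnion.2 ⟨c, hc, Finset.mem_image_of_mem _ ?_⟩, ?_⟩
    · rw [hy, hi] at hm'
      have hNpos : (0 : ℝ) < N := by linarith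
      -- This eliminates `a`: the bounds on the ordinate before and after the crossing confine `i
      -- (2H) - c / N` to at most `(1 + 1/N) H + lam H` in absolute value.
      have e1 : ((N : ℝ) + 1) * a - c - c / N = (1 + 1 / N) * (N * a - c) := by
        field_simp; ring
      have e2 : (0 : ℝ) < 1 + 1 / N := by positivity
      have b1 := mul_le_mul_of_nonneg_left hm.1 e2.le
      have b2 := mul_le_mul_of_nonneg_left hm.2.le e2.le
      have hc' : c / (2 * H * N) * (2 * H) = c / N := by field_simp
      have hr' : r * (2 * H) = (1 + 1 / N) * H + lam * H := by rw [hr]; ring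
      refine Finset.mem_Icc.2 ⟨Int.ceil_le.2 ?_, Int.le_floor.2 ?_⟩
      · refine le_of_mul_le_mul_right (a := 2 * H) ?_ (by positivity)
        rw [sub_mul, hc', hr']
        linarith [hm'.1, hm'.2]
      · refine le_of_mul_le_mul_right (a := 2 * H) ?_ (by positivity)
        rw [add_mul, hc', hr']
        linarith [hm'.1, hm'.2]
    · rw [step_y, hkj, hy, hi]
      push_cast; ring

lemma zpow_succ_apply (a : ℝ) (i : ℕ) (e : B.Edge) :
    (B.step a ^ ((i + 1 : ℕ) : ℤ)) e = B.step a ((B.step a ^ (i : ℤ)) e) := by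
  rw [← Equiv.Perm.mul_apply, ← zpow_one_add]
  congr 2; push_cast; ring

lemma zpow_succ_apply' (a : ℝ) (i : ℕ) (e : B.Edge) :
    (B.step a ^ ((i + 1 : ℕ) : ℤ)) e = (B.step a ^ (i : ℤ)) (B.step a e) := by
  rw [← Equiv.Perm.mul_apply, ← zpow_add_one]
  congr 2

lemma exists_cover_iterate {lam : ℝ} (hlam : lam < 3 / 10) (hp : ∀ n, B.p (n + 1) ≤ lam * B.p n)
    {A : Set ℝ} {e : ℝ → B.Edge} {j N : ℕ} (hN : 1 ≤ N) {S : Finset ℝ} (hk : ∀ a ∈ A, (e a).k = j)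
    (hS : ∀ a ∈ A, ∃ c ∈ S, (e a).y = N * a - c) (i : ℕ) :
    ∃ S' : Finset ℝ, N * S'.card ≤ 2 ^ i * (N + i) * S.card ∧
      ∀ a ∈ A, Direct a i (e a) → ∃ c ∈ S', ((B.step a ^ (i : ℤ)) (e a)).y = (N + i : ℕ) * a - c := by
  induction i with
  | zero => exact ⟨S, by simp, fun a ha _ => by simpa using hS a ha⟩
  | succ i ih =>
    obtain ⟨S₁, hS₁, h₁⟩ := ih
    obtain ⟨S₂, hS₂, h₂⟩ := exists_cover_step (B := B) (lam := lam) hlam (j := j + i) (hp _)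
      (A := {a | a ∈ A ∧ Direct a i (e a)}) (e := fun a => (B.step a ^ (i : ℤ)) (e a)) (N := N + i)
      (by omega) (S := S₁)
      (fun a ha => by rw [ha.2 i le_rfl, hk a ha.1]; push_cast; rfl) (fun a ha => h₁ a ha.1 ha.2)
    refine ⟨S₂, ?_, fun a ha hd => ?_⟩
    · have hpos : 0 < N + i := by omega
      refine le_of_mul_le_mul_left ?_ hpos
      calc (N + i) * (N * S₂.card) = N * ((N + i) * S₂.card) := by ring
        _ ≤ N * (2 * (N + i + 1) * S₁.card) := Nat.mul_le_mul_left _ hS₂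
        _ = 2 * (N + i + 1) * (N * S₁.card) := by ring
        _ ≤ 2 * (N + i + 1) * (2 ^ i * (N + i) * S.card) := Nat.mul_le_mul_left _ hS₁
        _ = (N + i) * (2 ^ (i + 1) * (N + (i + 1)) * S.card) := by ring
    · rw [zpow_succ_apply]
      refine h₂ a ⟨ha, hd.mono (Nat.le_succ i)⟩ ?_
      have := hd (i + 1) le_rfl
      rw [zpow_succ_apply, hk a ha] at this
      rw [this]; push_cast; ring

lemma p_add_le {lam : ℝ} (h0 : 0 < lam) (hp : ∀ n, B.p (n + 1) ≤ lam * B.p n) (j i : ℕ) :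
    B.p (j + i) ≤ lam ^ i * B.p j := by
  induction i with
  | zero => simp
  | succ i ih =>
    calc B.p (j + i + 1) ≤ lam * B.p (j + i) := hp _
      _ ≤ lam * (lam ^ i * B.p j) := by gcongr
      _ = lam ^ (i + 1) * B.p j := by ring

/-- Each surviving branch has slope `N + i`, so it confines `a` to an interval of length `2 p (j +
i) / (N + i)`. The factor `N + i` cancels against the one in the branch count. -/
lemma volume_direct_le {lam : ℝ} (h0 : 0 < lam) (hlam : lam < 3 / 10)
    (hp : ∀ n, B.p (n + 1) ≤ lam * B.p n)
    {A : Set ℝ} {e : ℝ → B.Edge} {j N : ℕ} (hN : 1 ≤ N) {S : Finset ℝ} (hk : ∀ a ∈ A, (e a).k = j)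
    (hS : ∀ a ∈ A, ∃ c ∈ S, (e a).y = N * a - c) (i : ℕ) :
    volume {a | a ∈ A ∧ Direct a i (e a)} ≤
      ENNReal.ofReal (2 * B.p j * S.card / N * (2 * lam) ^ i) := by
  obtain ⟨S', hS', h⟩ := exists_cover_iterate hlam hp hN hk hS i
  have hNpos : (0 : ℝ) < N := by exact_mod_cast hN
  have hNi : (0 : ℝ) < (N + i : ℕ) := by exact_mod_cast (by omega : 0 < N + i)
  set H := B.p (j + i) with hH
  have hHpos : 0 < H := B.p_pos _
  have hsub : {a | a ∈ A ∧ Direct a i (e a)} ⊆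
      ⋃ c ∈ S', Ico ((c - H) / (N + i : ℕ)) ((c + H) / (N + i : ℕ)) := by
    rintro a ⟨ha, hd⟩
    obtain ⟨c, hc, hy⟩ := h a ha hd
    refine mem_iUnion₂.2 ⟨c, hc, ?_⟩
    have hm := ((B.step a ^ (i : ℤ)) (e a)).mem
    rw [hd i le_rfl, hk a ha, hy, ← Int.natCast_add, h_natCast, ← hH] at hm
    constructor
    · rw [div_le_iff₀ hNi]; linarith [hm.1]
    · rw [lt_div_iff₀ hNi]; linarith [hm.2]
  calc volume {a | a ∈ A ∧ Direct a i (e a)}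
      ≤ ∑ c ∈ S', volume (Ico ((c - H) / (N + i : ℕ)) ((c + H) / (N + i : ℕ))) :=
        (measure_mono hsub).trans (measure_biUnion_finset_le _ _)
    _ = ∑ c ∈ S', ENNReal.ofReal (2 * H / (N + i : ℕ)) := by
        refine Finset.sum_congr rfl fun c _ => ?_
        rw [Real.volume_Ico]; congr 1; ring
    _ = ENNReal.ofReal (S'.card * (2 * H / (N + i : ℕ))) := by
        rw [Finset.sum_const, nsmul_eq_mul, ENNReal.ofReal_mul (by positivity),
          ENNReal.ofReal_natCast]
    _ ≤ _ := by
        apply ENNReal.ofReal_le_ofReal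
        have h1 : (N : ℝ) * S'.card ≤ 2 ^ i * (N + i : ℕ) * S.card := by exact_mod_cast hS'
        have h2 : H ≤ lam ^ i * B.p j := p_add_le h0 hp j i
        calc S'.card * (2 * H / (N + i : ℕ))
            = (N * S'.card) * (2 * H / ((N + i : ℕ) * N)) := by field_simp
          _ ≤ (2 ^ i * (N + i : ℕ) * S.card) * (2 * H / ((N + i : ℕ) * N)) := by gcongr
          _ = 2 ^ i * S.card * 2 / N * H := by field_simp
          _ ≤ 2 ^ i * S.card * 2 / N * (lam ^ i * B.p j) := by gcongr
          _ = _ := by rw [mul_pow]; ring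

/-- After `m` steps the ordinate is `m a` plus a constant in a countable set, so countably many
single branches cover all slopes. The case `m = 0` must be excluded because the ordinate then does
not depend on `a`. -/
lemma volume_forall_direct_eq_zero {lam : ℝ} (h0 : 0 < lam) (hlam : lam < 3 / 10)
    (hp : ∀ n, B.p (n + 1) ≤ lam * B.p n) (e : B.Edge) {m : ℕ} (hm : 1 ≤ m) :
    volume {a | 0 ≤ ((B.step a ^ (m : ℤ)) e).k ∧
      ∀ i, Direct a i ((B.step a ^ (m : ℤ)) e)} = 0 := by
  have hsub : {a | 0 ≤ ((B.step a ^ (m : ℤ)) e).k ∧ ∀ i, Direct a i ((B.step a ^ (m : ℤ)) e)} ⊆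
      ⋃ j : ℕ, ⋃ d : B.lattice, {a | (((B.step a ^ (m : ℤ)) e).k = j ∧
        ((B.step a ^ (m : ℤ)) e).y = m * a - (-e.y - d)) ∧
        ∀ i, Direct a i ((B.step a ^ (m : ℤ)) e)} := by
    rintro a ⟨h, hd⟩
    obtain ⟨j, hj⟩ := Int.eq_ofNat_of_zero_le h
    refine mem_iUnion.2 ⟨j, mem_iUnion.2 ⟨⟨_, zpow_y_sub_mem a e m⟩, ⟨hj, ?_⟩, hd⟩⟩
    push_cast; ring
  have hc : Countable B.lattice := countable_range (Finsupp.linearCombination ℤ B.p)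
  refine measure_mono_null hsub (measure_iUnion_null fun j => measure_iUnion_null fun d => ?_)
  have hle : ∀ i : ℕ, volume {a | (((B.step a ^ (m : ℤ)) e).k = j ∧
        ((B.step a ^ (m : ℤ)) e).y = m * a - (-e.y - d)) ∧
        ∀ i, Direct a i ((B.step a ^ (m : ℤ)) e)} ≤
      ENNReal.ofReal (2 * B.p j * ({-e.y - (d : ℝ)} : Finset ℝ).card / m * (2 * lam) ^ i) := by
    intro i
    refine (measure_mono ?_).trans (volume_direct_le (B := B) (A := {a | ((B.step a ^ (m : ℤ)) e).k = j ∧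
        ((B.step a ^ (m : ℤ)) e).y = m * a - (-e.y - d)}) (e := fun a => (B.step a ^ (m : ℤ)) e)
        (S := {-e.y - (d : ℝ)}) h0 hlam hp hm ?_ ?_ i)
    · rintro a ⟨h1, h2⟩
      exact ⟨h1, h2 i⟩
    · exact fun a ha => ha.1
    · exact fun a ha => ⟨_, Finset.mem_singleton_self _, ha.2⟩
  have ht : Tendsto (fun i : ℕ => ENNReal.ofReal
      (2 * B.p j * ({-e.y - (d : ℝ)} : Finset ℝ).card / m * (2 * lam) ^ i)) atTop (𝓝 0) := by
    rw [← ENNReal.ofReal_zero]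
    refine ENNReal.tendsto_ofReal ?_
    have := (tendsto_pow_atTop_nhds_zero_of_lt_one (r := 2 * lam) (by linarith)
      (by linarith)).const_mul (2 * B.p j * ({-e.y - (d : ℝ)} : Finset ℝ).card / m)
    rwa [mul_zero] at this
  exact le_antisymm (ge_of_tendsto' ht hle) (zero_le)

/-! ### Vertices and clear apertures -/

variable (B) in
/-- The vertex at the left side of the `k`-th rectangle, as an edge point. -/
def vert (k : ℕ) : B.Edge := B.pt k (-B.p k)

lemma vert_y (k : ℕ) : (B.vert k).y = -B.p k := by
  have := B.p_pos k
  exact pt_y_of_mem ⟨by rw [h_natCast], by rw [h_natCast]; linarith⟩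

lemma Direct.step {a : ℝ} {i : ℕ} {e : B.Edge} (h : Direct a (i + 1) e) :
    (B.step a e).k = e.k + 1 ∧ Direct a i (B.step a e) := by
  have h1 : (B.step a e).k = e.k + 1 := by simpa using h 1 (by omega)
  refine ⟨h1, fun l hl => ?_⟩
  have := h (l + 1) (by omega)
  rw [zpow_succ_apply'] at this
  rw [this, h1]; push_cast; ring

/-- The first step is counted separately, using the length of the interval of slopes; it produces
branches with `N = 1`, to which `volume_direct_le` applies. -/
lemma volume_direct_vert_le {lam : ℝ} (h0 : 0 < lam) (hlam : lam < 3 / 10)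
    (hp : ∀ n, B.p (n + 1) ≤ lam * B.p n) {α β : ℝ} (hαβ : α ≤ β) (k i : ℕ) :
    volume {a | a ∈ Icc α β ∧ Direct a (i + 1) (B.vert k)} ≤
      ENNReal.ofReal (lam * (β - α + 4 * B.p k) * (2 * lam) ^ i) := by
  classical
  set H := B.p k with hH
  have hHpos : 0 < H := B.p_pos k
  set q := B.p (k + 1) with hq
  have hqpos : 0 < q := B.p_pos _
  have hqH : q ≤ lam * H := hp k
  set x := (α - H - q) / (2 * H) with hx
  set y := (β - H + q) / (2 * H) with hy
  -- One branch for each winding number around the `k`-th circle that is compatible with `a ∈ [α,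
  -- β]` and with landing in the next aperture.
  set S : Finset ℝ := (Finset.Icc ⌈x⌉ ⌊y⌋).image fun i : ℤ => H + i * (2 * H) with hS
  have hcard : (S.card : ℝ) ≤ (β - α) / (2 * H) + 2 := by
    have h1 : S.card ≤ ⌊y - x⌋₊ + 1 := Finset.card_image_le.trans
      (card_Icc_ceil_floor_le (by push_cast; exact Nat.lt_floor_add_one _))
    have hxy : y - x = (β - α) / (2 * H) + q / H := by rw [hx, hy]; field_simp; ring
    have hqH' : q / H ≤ 1 := by rw [div_le_one hHpos]; nlinarith
    have h2 : 0 ≤ y - x := by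
      rw [hxy]
      have := sub_nonneg.2 hαβ
      positivity
    have h3 := Nat.floor_le h2
    have h4 : (S.card : ℝ) ≤ ⌊y - x⌋₊ + 1 := by exact_mod_cast h1
    linarith
  have hmain := volume_direct_le (B := B) (A := {a | a ∈ Icc α β ∧ (B.step a (B.vert k)).k = k + 1})
    (e := fun a => B.step a (B.vert k)) (j := k + 1) (N := 1) (S := S) h0 hlam hp le_rfl
    (fun a ha => by rw [ha.2]; push_cast; rfl) ?_ i
  · refine (measure_mono ?_).trans (hmain.trans (ENNReal.ofReal_le_ofReal ?_))
    · rintro a ⟨ha, hd⟩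
      obtain ⟨h1, h2⟩ := hd.step
      exact ⟨⟨ha, h1⟩, h2⟩
    · have hl := sub_nonneg.2 hαβ
      calc 2 * q * S.card / (1 : ℕ) * (2 * lam) ^ i
          ≤ 2 * (lam * H) * ((β - α) / (2 * H) + 2) / (1 : ℕ) * (2 * lam) ^ i := by gcongr
        _ = _ := by
          rw [Nat.cast_one]; field_simp; ring
  · rintro a ⟨ha, hka⟩
    have hm := (B.step a (B.vert k)).mem
    have hhk : B.h ((k : ℤ) + 1) = q := rfl
    obtain ⟨l, hl⟩ := B.wrap_eq_sub k (-H + a)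
    have hyy : (B.step a (B.vert k)).y = -H + a - l * (2 * H) := by
      rw [step_y, vert_y]; exact hl
    rw [hka, hhk, hyy] at hm
    refine ⟨H + l * (2 * H), Finset.mem_image_of_mem _ (Finset.mem_Icc.2
      ⟨Int.ceil_le.2 ?_, Int.le_floor.2 ?_⟩), ?_⟩
    · rw [hx, div_le_iff₀ (by positivity)]; linarith [hm.2, ha.1]
    · rw [hy, le_div_iff₀ (by positivity)]; linarith [hm.1, ha.2]
    · rw [hyy]; push_cast; ring

variable (B) in
/-- No vertex to the left of the `m`-th aperture reaches it directly. -/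
def Clear (a : ℝ) (m : ℕ) : Prop := ∀ k < m, ¬ Direct a (m - k) (B.vert k)

/-- Sum over the vertices `k < m`. The terms proportional to `β - α` form a geometric series; in the
others `p k ≤ (2 * lam) ^ k` leaves `m` equal terms, negligible for large `m`. -/
lemma volume_not_clear_le {lam : ℝ} (h0 : 0 < lam) (hlam : lam < 3 / 10)
    (hp : ∀ n, B.p (n + 1) ≤ lam * B.p n) {α β : ℝ} (hαβ : α ≤ β) (m : ℕ) :
    volume {a | a ∈ Icc α β ∧ ¬ B.Clear a m} ≤
      ENNReal.ofReal (lam / (1 - 2 * lam) * (β - α) + 4 * lam * (m * (2 * lam) ^ (m - 1))) := by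
  have hl := sub_nonneg.2 hαβ
  have hsub : {a | a ∈ Icc α β ∧ ¬ B.Clear a m} ⊆
      ⋃ k ∈ Finset.range m, {a | a ∈ Icc α β ∧ Direct a (m - 1 - k + 1) (B.vert k)} := by
    rintro a ⟨ha, h⟩
    simp only [Clear, not_forall, not_not] at h
    obtain ⟨k, hk, h⟩ := h
    refine mem_iUnion₂.2 ⟨k, Finset.mem_range.2 hk, ha, ?_⟩
    rwa [show m - 1 - k + 1 = m - k by omega]
  calc _ ≤ ∑ k ∈ Finset.range m, volume {a | a ∈ Icc α β ∧ Direct a (m - 1 - k + 1) (B.vert k)} :=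
        (measure_mono hsub).trans (measure_biUnion_finset_le _ _)
    _ ≤ ∑ k ∈ Finset.range m, ENNReal.ofReal
        (lam * (β - α) * (2 * lam) ^ (m - 1 - k) + 4 * lam * (2 * lam) ^ (m - 1)) := by
        refine Finset.sum_le_sum fun k hk => (volume_direct_vert_le h0 hlam hp hαβ k _).trans
          (ENNReal.ofReal_le_ofReal ?_)
        have hk' := Finset.mem_range.1 hk
        have h1 : B.p k ≤ (2 * lam) ^ k := by
          have := p_add_le h0 hp 0 k
          rw [zero_add, B.p_zero, mul_one] at this
          exact this.trans (pow_le_pow_left₀ h0.le (by linarith) _)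
        have h2 : (2 * lam) ^ (m - 1) = (2 * lam) ^ (m - 1 - k) * (2 * lam) ^ k := by
          rw [← pow_add]; congr 1; omega
        rw [h2]
        have h3 : 0 ≤ (2 * lam) ^ (m - 1 - k) := by positivity
        nlinarith [mul_le_mul_of_nonneg_left h1 h3]
    _ = ENNReal.ofReal (∑ k ∈ Finset.range m,
        (lam * (β - α) * (2 * lam) ^ (m - 1 - k) + 4 * lam * (2 * lam) ^ (m - 1))) :=
        (ENNReal.ofReal_sum_of_nonneg fun k _ => by positivity).symm
    _ ≤ _ := by
        apply ENNReal.ofReal_le_ofReal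
        rw [Finset.sum_add_distrib, Finset.sum_const, Finset.card_range, nsmul_eq_mul,
          ← Finset.mul_sum, Finset.sum_range_reflect (fun i => (2 * lam) ^ i) m]
        have hg : ∑ i ∈ Finset.range m, (2 * lam) ^ i ≤ (1 - 2 * lam)⁻¹ := by
          rw [← tsum_geometric_of_lt_one (by positivity) (by linarith)]
          exact (summable_geometric_of_lt_one (by positivity) (by linarith)).sum_le_tsum _
            fun i _ => by positivity
        have : lam * (β - α) * ∑ i ∈ Finset.range m, (2 * lam) ^ i ≤
            lam * (β - α) * (1 - 2 * lam)⁻¹ := by gcongr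
        have e1 : lam / (1 - 2 * lam) * (β - α) = lam * (β - α) * (1 - 2 * lam)⁻¹ := by
          rw [div_eq_mul_inv]; ring
        rw [e1]
        linarith

/-- A set of reals which fills at most a fixed proportion `κ < 1` of every interval is null. -/
lemma volume_eq_zero_of_proportion {A : Set ℝ} {κ : ℝ} (hκ : κ < 1)
    (h : ∀ x r : ℝ, 0 < r → volume (A ∩ Metric.closedBall x r) ≤ ENNReal.ofReal (κ * (2 * r))) :
    volume A = 0 := by
  by_contra hA
  -- At almost every point of `A` the density of `A` is 1, whereas the hypothesis keeps all the
  -- ratios below `κ`.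
  have hd := Besicovitch.ae_tendsto_measure_inter_div (volume : Measure ℝ) A
  have hne : (volume.restrict A) ≠ 0 := by
    rwa [Ne, Measure.restrict_eq_zero]
  have : NeBot (ae (volume.restrict A)) := ae_neBot.2 hne
  obtain ⟨x, hx⟩ := hd.exists
  have hle : ∀ᶠ r in 𝓝[>] (0 : ℝ), volume (A ∩ Metric.closedBall x r) /
      volume (Metric.closedBall x r) ≤ ENNReal.ofReal κ := by
    filter_upwards [self_mem_nhdsWithin] with r hr
    have hr' : (0 : ℝ) < r := hr
    rw [Real.volume_closedBall]
    refine ENNReal.div_le_of_le_mul ?_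
    rw [← ENNReal.ofReal_mul' (by positivity)]
    exact h x r hr'
  have h1 := le_of_tendsto hx hle
  rw [← ENNReal.ofReal_one, ENNReal.ofReal_le_ofReal_iff'] at h1
  rcases h1 with h1 | h1 <;> linarith

/-- The slopes with no clear aperture from `N` on are bad for every `m ≥ N`; letting `m → ∞` they
fill at most the proportion `lam / (1 - 2 * lam)` of each interval. -/
lemma ae_frequently_clear {lam : ℝ} (h0 : 0 < lam) (hlam : lam < 3 / 10)
    (hp : ∀ n, B.p (n + 1) ≤ lam * B.p n) : ∀ᵐ a : ℝ, ∃ᶠ m in atTop, B.Clear a m := by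
  have hset : {a : ℝ | ¬ ∃ᶠ m in atTop, B.Clear a m} ⊆
      ⋃ N : ℕ, {a | ∀ m ≥ N, ¬ B.Clear a m} := by
    intro a ha
    have ha' := not_frequently.1 ha
    obtain ⟨N, hN⟩ := eventually_atTop.1 ha'
    exact mem_iUnion.2 ⟨N, hN⟩
  refine measure_mono_null hset (measure_iUnion_null fun N => ?_)
  refine volume_eq_zero_of_proportion (κ := lam / (1 - 2 * lam)) ?_ fun x r hr => ?_
  · rw [div_lt_one (by linarith)]; linarith
  · have ht : Tendsto (fun m : ℕ => ENNReal.ofReal (lam / (1 - 2 * lam) * ((x + r) - (x - r)) +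
        4 * lam * (m * (2 * lam) ^ (m - 1)))) atTop
        (𝓝 (ENNReal.ofReal (lam / (1 - 2 * lam) * (2 * r)))) := by
      refine ENNReal.tendsto_ofReal ?_
      have h1 : Tendsto (fun m : ℕ => (m : ℝ) * (2 * lam) ^ (m - 1)) atTop (𝓝 0) := by
        have h2 := (tendsto_self_mul_const_pow_of_lt_one (r := 2 * lam) (by positivity)
          (by linarith)).mul_const ((2 * lam)⁻¹)
        rw [zero_mul] at h2
        refine h2.congr' ?_
        filter_upwards [eventually_ge_atTop 1] with m hm
        obtain ⟨l, rfl⟩ := Nat.exists_eq_add_of_le' hm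
        rw [Nat.add_sub_cancel, pow_succ]
        field_simp
      have h3 := (h1.const_mul (4 * lam)).const_add (lam / (1 - 2 * lam) * ((x + r) - (x - r)))
      rw [mul_zero, add_zero, show x + r - (x - r) = 2 * r by ring] at h3
      simpa only [show x + r - (x - r) = 2 * r by ring] using h3
    refine ge_of_tendsto ht ?_
    filter_upwards [eventually_ge_atTop N] with m hm
    refine (measure_mono ?_).trans (volume_not_clear_le h0 hlam hp (by linarith) m)
    rintro a ⟨ha, hb⟩
    rw [Real.closedBall_eq_Icc] at hb
    exact ⟨hb, ha m hm⟩

/-! ### Vertical translations and discontinuities -/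

/-- Vertical translation of an edge point along the circle carrying it. -/
def Edge.tr (e : B.Edge) (t : ℝ) : B.Edge := B.pt e.k (e.y + t)

@[simp] lemma tr_k (e : B.Edge) (t : ℝ) : (e.tr t).k = e.k := rfl

@[simp] lemma pt_tr (k : ℤ) (y t : ℝ) : (B.pt k y).tr t = B.pt k (y + t) :=
  pt_wrap_add k y t

lemma tr_tr (e : B.Edge) (s t : ℝ) : (e.tr s).tr t = e.tr (s + t) := by
  rw [Edge.tr.eq_1 e s, pt_tr, Edge.tr, add_assoc]

@[simp] lemma tr_zero (e : B.Edge) : e.tr 0 = e := by rw [Edge.tr, add_zero, pt_eta]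

lemma tr_injective {e : B.Edge} {s t : ℝ} (h : e.tr s = e.tr t) (hst : |s - t| < 2 * B.h e.k) :
    s = t := by
  obtain ⟨m, hm⟩ := pt_eq_pt_iff.1 h
  have hm' : s - t = m * (2 * B.h e.k) := by linarith
  rw [hm', abs_mul, abs_of_pos (B.two_h_pos _), mul_lt_iff_lt_one_left (B.two_h_pos _)] at hst
  have : |m| < 1 := by exact_mod_cast hst
  rw [Int.abs_lt_one_iff] at this
  rw [this] at hm'
  push_cast at hm'
  linarith

lemma tr_of_mem {e : B.Edge} {t : ℝ} (h : e.y + t ∈ Ico (-(B.h e.k)) (B.h e.k)) :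
    (e.tr t).y = e.y + t := pt_y_of_mem h

lemma shift_tr (a : ℝ) (e : B.Edge) (t : ℝ) : B.shift a (e.tr t) = (B.shift a e).tr t := by
  conv_rhs => rw [← pt_eta e]
  rw [shift_pt, pt_tr, Edge.tr, shift_pt]
  congr 1; ring

lemma shift_symm_tr (a : ℝ) (e : B.Edge) (t : ℝ) :
    (B.shift a).symm (e.tr t) = ((B.shift a).symm e).tr t := by
  rw [Equiv.symm_apply_eq, shift_tr, Equiv.apply_symm_apply]

open Classical in
variable (B) in
/-- Passing from the `k`-th rectangle to the rectangle `s k` where this is open, and jumping to the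
opposite rectangle elsewhere; this covers `exit` and its inverse. -/
def jump (s : ℤ → ℤ) (e : B.Edge) : B.Edge :=
  if e.y ∈ Ico (-(B.h (s e.k))) (B.h (s e.k)) then B.pt (s e.k) e.y else B.pt (-e.k - 1) e.y

lemma exit_eq_jump (e : B.Edge) : B.exit e = B.jump (· + 1) e := by
  unfold jump
  split_ifs with h
  · exact exit_of_mem h
  · exact exit_of_not_mem h

lemma exit_symm_eq_jump (e : B.Edge) : B.exit.symm e = B.jump (· - 1) e := by
  unfold jump
  split_ifs with h
  · exact exit_symm_of_mem h
  · exact exit_symm_of_not_mem h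

variable (B) in
/-- The edge points at which `jump s` may be discontinuous. -/
def cut (s : ℤ → ℤ) : Set B.Edge :=
  {e | e.y = -B.h e.k ∨ e.y = -B.h (s e.k) ∨ e.y = B.h (s e.k)}

/-- Moving down, the branch of `jump` can change only by passing one of the heights `± h (s k)`, and
the circle can close up only at `-h k`; all three belong to `cut s`. -/
lemma jump_tr_neg {s : ℤ → ℤ} {e : B.Edge} {g : ℝ}
    (hg : ∀ t ∈ Ico 0 g, e.tr (-t) ∉ B.cut s) {t : ℝ} (ht : t ∈ Ico 0 g) :
    B.jump s (e.tr (-t)) = (B.jump s e).tr (-t) := by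
  have hm := e.mem
  have hlin : ∀ r ∈ Icc 0 t, -B.h e.k < e.y - r := by
    intro r hr
    by_contra hcon
    have h0 : (e.tr (-(e.y + B.h e.k))).y = -B.h e.k := by
      rw [tr_of_mem]
      · ring
      · constructor <;> linarith [B.h_pos e.k]
    exact hg (e.y + B.h e.k) ⟨by linarith [hm.1], by linarith [hr.2, ht.2]⟩ (Or.inl h0)
  have hy : ∀ r ∈ Icc 0 t, (e.tr (-r)).y = e.y - r := fun r hr => by
    rw [tr_of_mem, sub_eq_add_neg]
    have := hlin r hr
    exact ⟨by linarith, by linarith [hm.2, hr.1]⟩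
  have hne : ∀ r ∈ Icc 0 t, e.y - r ≠ -B.h (s e.k) ∧ e.y - r ≠ B.h (s e.k) := fun r hr => by
    have h1 := hg r ⟨hr.1, hr.2.trans_lt ht.2⟩
    simp only [cut, mem_ofPred_eq, tr_k, hy r hr, not_or] at h1
    exact h1.2
  have hiff : e.y - t ∈ Ico (-(B.h (s e.k))) (B.h (s e.k)) ↔
      e.y ∈ Ico (-(B.h (s e.k))) (B.h (s e.k)) := by
    constructor
    · intro h
      refine ⟨by linarith [h.1, ht.1], ?_⟩
      by_contra hcon
      exact (hne (e.y - B.h (s e.k)) ⟨by linarith, by linarith [h.2]⟩).2 (by ring)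
    · intro h
      refine ⟨?_, by linarith [h.2, ht.1]⟩
      by_contra hcon
      exact (hne (e.y + B.h (s e.k)) ⟨by linarith [h.1], by linarith⟩).1 (by ring)
  unfold jump
  rw [hy t ⟨ht.1, le_rfl⟩, tr_k]
  by_cases h : e.y ∈ Ico (-(B.h (s e.k))) (B.h (s e.k))
  · rw [if_pos h, if_pos (hiff.2 h), pt_tr, sub_eq_add_neg]
  · rw [if_neg h, if_neg (mt hiff.1 h), pt_tr, sub_eq_add_neg e.y]

/-- All intervals are closed below and open above, so a small upward translation never changes the
branch. No regularity of `e` is required. -/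
lemma exists_jump_tr (s : ℤ → ℤ) (e : B.Edge) :
    ∃ ε > 0, ∀ t ∈ Ico 0 ε, B.jump s (e.tr t) = (B.jump s e).tr t := by
  have hm := e.mem
  set c := B.h (s e.k) with hc
  obtain ⟨ε, hε, hε1, hε2⟩ : ∃ ε > 0, ε ≤ B.h e.k - e.y ∧
      ∀ t ∈ Ico 0 ε, (e.y + t ∈ Ico (-c) c ↔ e.y ∈ Ico (-c) c) := by
    have h1 : 0 < B.h e.k - e.y := by linarith [hm.2]
    rcases lt_or_ge e.y (-c) with h | h
    · refine ⟨min (B.h e.k - e.y) (-c - e.y), lt_min h1 (by linarith), min_le_left _ _, ?_⟩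
      intro t ht
      have := ht.2.trans_le (min_le_right _ _)
      exact iff_of_false (fun h' => by linarith [h'.1]) (fun h' => by linarith [h'.1])
    · rcases lt_or_ge e.y c with h' | h'
      · refine ⟨min (B.h e.k - e.y) (c - e.y), lt_min h1 (by linarith), min_le_left _ _, ?_⟩
        intro t ht
        have := ht.2.trans_le (min_le_right _ _)
        exact iff_of_true ⟨by linarith [ht.1], by linarith⟩ ⟨h, h'⟩
      · refine ⟨B.h e.k - e.y, h1, le_rfl, fun t ht => ?_⟩
        exact iff_of_false (fun h' => by linarith [h'.2, ht.1]) (fun h' => by linarith [h'.2])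
  refine ⟨ε, hε, fun t ht => ?_⟩
  have hy : (e.tr t).y = e.y + t := tr_of_mem ⟨by linarith [hm.1, ht.1], by linarith [ht.2]⟩
  unfold jump
  rw [hy, tr_k]
  by_cases h : e.y ∈ Ico (-c) c
  · rw [if_pos h, if_pos ((hε2 t ht).2 h), pt_tr]
  · rw [if_neg h, if_neg (mt (hε2 t ht).1 h), pt_tr]

lemma finite_cut (s : ℤ → ℤ) (K : ℤ) : {e | e ∈ B.cut s ∧ |e.k| ≤ K}.Finite := by
  have : {e | e ∈ B.cut s ∧ |e.k| ≤ K} ⊆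
      ⋃ k ∈ Icc (-K) K, B.pt k '' {-B.h k, -B.h (s k), B.h (s k)} := by
    rintro e ⟨he, hk⟩
    exact mem_iUnion₂.2 ⟨e.k, abs_le.1 hk, e.y, he, pt_eta e⟩
  exact ((finite_Icc _ _).biUnion fun k _ => (toFinite _).image _).subset this

lemma step_eq_jump (a : ℝ) (e : B.Edge) : B.step a e = B.jump (· + 1) (B.shift a e) :=
  exit_eq_jump _

lemma symm_eq_jump (a : ℝ) (e : B.Edge) :
    (B.step a).symm e = (B.shift a).symm (B.jump (· - 1) e) := by
  rw [← exit_symm_eq_jump]; rfl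

variable (B) in
/-- The edge points at which the step map may be discontinuous. -/
def stepCut (a : ℝ) : Set B.Edge := B.shift a ⁻¹' B.cut (· + 1)

lemma finite_stepCut (a : ℝ) (K : ℤ) : {e | e ∈ B.stepCut a ∧ |e.k| ≤ K}.Finite :=
  (finite_cut (B := B) (· + 1) K).preimage (f := B.shift a) (B.shift a).injective.injOn

lemma step_tr_neg {a : ℝ} {e : B.Edge} {g : ℝ} (hg : ∀ t ∈ Ico 0 g, e.tr (-t) ∉ B.stepCut a)
    {t : ℝ} (ht : t ∈ Ico 0 g) : B.step a (e.tr (-t)) = (B.step a e).tr (-t) := by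
  rw [step_eq_jump, step_eq_jump, shift_tr]
  refine jump_tr_neg (fun r hr => ?_) ht
  rw [← shift_tr]
  exact hg r hr

lemma symm_tr_neg {a : ℝ} {e : B.Edge} {g : ℝ} (hg : ∀ t ∈ Ico 0 g, e.tr (-t) ∉ B.cut (· - 1))
    {t : ℝ} (ht : t ∈ Ico 0 g) : (B.step a).symm (e.tr (-t)) = ((B.step a).symm e).tr (-t) := by
  rw [symm_eq_jump, symm_eq_jump, jump_tr_neg hg ht, shift_symm_tr]

lemma exists_step_tr (a : ℝ) (e : B.Edge) :
    ∃ ε > 0, ∀ t ∈ Ico 0 ε, B.step a (e.tr t) = (B.step a e).tr t := by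
  obtain ⟨ε, hε, h⟩ := exists_jump_tr (· + 1) (B.shift a e)
  exact ⟨ε, hε, fun t ht => by rw [step_eq_jump, step_eq_jump, shift_tr, h t ht]⟩

lemma exists_symm_tr (a : ℝ) (e : B.Edge) :
    ∃ ε > 0, ∀ t ∈ Ico 0 ε, (B.step a).symm (e.tr t) = ((B.step a).symm e).tr t := by
  obtain ⟨ε, hε, h⟩ := exists_jump_tr (· - 1) e
  exact ⟨ε, hε, fun t ht => by rw [symm_eq_jump, symm_eq_jump, h t ht, shift_symm_tr]⟩

lemma zpow_add_one_apply (a : ℝ) (n : ℤ) (e : B.Edge) :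
    (B.step a ^ (n + 1)) e = B.step a ((B.step a ^ n) e) := by
  rw [add_comm, zpow_one_add, Equiv.Perm.mul_apply]

lemma zpow_sub_one_apply (a : ℝ) (n : ℤ) (e : B.Edge) :
    (B.step a ^ (n - 1)) e = (B.step a).symm ((B.step a ^ n) e) := by
  rw [Equiv.eq_symm_apply, ← zpow_add_one_apply, sub_add_cancel]

lemma zpow_zpow_apply (a : ℝ) (m n : ℤ) (e : B.Edge) :
    (B.step a ^ m) ((B.step a ^ n) e) = (B.step a ^ (m + n)) e := by
  rw [zpow_add, Equiv.Perm.mul_apply]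

/-- All iterates of the step map are continuous from the right. -/
lemma exists_zpow_tr (a : ℝ) (n : ℤ) (e : B.Edge) :
    ∃ ε > 0, ∀ t ∈ Ico 0 ε, (B.step a ^ n) (e.tr t) = ((B.step a ^ n) e).tr t := by
  induction n using Int.induction_on with
  | zero => exact ⟨1, one_pos, fun t _ => by simp⟩
  | succ n ih =>
    obtain ⟨ε, hε, h⟩ := ih
    obtain ⟨δ, hδ, h'⟩ := exists_step_tr a ((B.step a ^ (n : ℤ)) e)
    refine ⟨min ε δ, lt_min hε hδ, fun t ht => ?_⟩
    rw [zpow_add_one_apply, h t ⟨ht.1, ht.2.trans_le (min_le_left _ _)⟩,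
      h' t ⟨ht.1, ht.2.trans_le (min_le_right _ _)⟩, zpow_add_one_apply]
  | pred n ih =>
    obtain ⟨ε, hε, h⟩ := ih
    obtain ⟨δ, hδ, h'⟩ := exists_symm_tr a ((B.step a ^ (-(n : ℤ))) e)
    refine ⟨min ε δ, lt_min hε hδ, fun t ht => ?_⟩
    rw [zpow_sub_one_apply, h t ⟨ht.1, ht.2.trans_le (min_le_left _ _)⟩,
      h' t ⟨ht.1, ht.2.trans_le (min_le_right _ _)⟩, zpow_sub_one_apply]

/-! ### Gaps of invariant sets -/

/-- The points just below `x` are not in `F`. -/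
def GapBelow (F : Set B.Edge) (x : B.Edge) (g : ℝ) : Prop :=
  0 < g ∧ ∀ t ∈ Ioo 0 g, x.tr (-t) ∉ F

/-- Gaps below distinct points of `F` are disjoint: otherwise the lower point would lie in the gap
of the higher one. -/
lemma GapBelow.eq_of_tr_eq {F : Set B.Edge} {x x' : B.Edge} {g g' t t' : ℝ} (hx : x ∈ F)
    (hx' : x' ∈ F) (hg : GapBelow F x g) (hg' : GapBelow F x' g') (ht : t ∈ Ioo 0 g)
    (ht' : t' ∈ Ioo 0 g') (h : x.tr (-t) = x'.tr (-t')) : x = x' := by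
  have e1 : x = x'.tr (-(t' - t)) := by
    have := congrArg (fun e : B.Edge => e.tr t) h
    simp only [tr_tr, neg_add_cancel, tr_zero] at this
    rw [this]; congr 1; ring
  have e2 : x' = x.tr (-(t - t')) := by
    have := congrArg (fun e : B.Edge => e.tr t') h
    simp only [tr_tr, neg_add_cancel, tr_zero] at this
    rw [← this]; congr 1; ring
  rcases lt_trichotomy t t' with hlt | heq | hlt
  · exact absurd (e1 ▸ hx) (hg'.2 (t' - t) ⟨by linarith, by linarith [ht.1, ht'.2]⟩)
  · rw [e1, heq, sub_self, neg_zero, tr_zero]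
  · exact absurd (e2 ▸ hx') (hg.2 (t - t') ⟨by linarith, by linarith [ht'.1, ht.2]⟩)

lemma exists_tr_neg_not_mem {D : Set B.Edge} (hD : ∀ K, {e | e ∈ D ∧ |e.k| ≤ K}.Finite)
    {x : B.Edge} (hx : x ∉ D) : ∃ g > 0, ∀ t ∈ Ico 0 g, x.tr (-t) ∉ D := by
  have h1 : ∀ᶠ t in 𝓝[>] (0 : ℝ), ∀ v ∈ {e | e ∈ D ∧ |e.k| ≤ |x.k|}, x.tr (-t) ≠ v := by
    refine (eventually_all_finite (hD _)).2 fun v _ => ?_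
    by_cases hv : ∃ t ∈ Ioo 0 (2 * B.h x.k), x.tr (-t) = v
    · obtain ⟨t₀, ht₀, rfl⟩ := hv
      filter_upwards [Ioo_mem_nhdsGT ht₀.1] with t ht hcon
      have := tr_injective hcon (by rw [abs_lt]; constructor <;> linarith [ht.1, ht.2, ht₀.1, ht₀.2])
      linarith [ht.2]
    · filter_upwards [Ioo_mem_nhdsGT (B.two_h_pos x.k)] with t ht hcon
      exact hv ⟨t, ht, hcon⟩
  obtain ⟨g, hg, h2⟩ := mem_nhdsGT_iff_exists_Ioo_subset.1 h1
  refine ⟨g, hg, fun t ht hmem => ?_⟩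
  rcases ht.1.eq_or_lt with h0 | h0
  · rw [← h0, neg_zero, tr_zero] at hmem
    exact hx hmem
  · exact h2 ⟨h0, ht.2⟩ _ ⟨hmem, le_rfl⟩ rfl

/-- If `x` is a point of a bounded invariant set with a gap below it, then its orbit meets a
discontinuity. -/
lemma GapBelow.exists_mem_discontinuity {S : Equiv.Perm B.Edge} {D F : Set B.Edge} {K : ℤ}
    (hS : ∀ (e : B.Edge) (g : ℝ), (∀ t ∈ Ico 0 g, e.tr (-t) ∉ D) →
      ∀ t ∈ Ico 0 g, S (e.tr (-t)) = (S e).tr (-t))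
    (hD : ∀ K, {e | e ∈ D ∧ |e.k| ≤ K}.Finite) (hF : ∀ e, S e ∈ F ↔ e ∈ F)
    (hFK : ∀ e ∈ F, |e.k| ≤ K) {x : B.Edge} (hx : x ∈ F)
    (hinj : Function.Injective fun i : ℕ => (S ^ i) x) {g : ℝ} (hg : GapBelow F x g) :
    ∃ i : ℕ, (S ^ i) x ∈ D := by
  by_contra! hcon
  have hsucc : ∀ i, (S ^ (i + 1)) x = S ((S ^ i) x) := fun i => by
    rw [pow_succ', Equiv.Perm.mul_apply]
  have hxF : ∀ i, (S ^ i) x ∈ F := by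
    intro i
    induction i with
    | zero => exact hx
    | succ i ih => rw [hsucc, hF]; exact ih
  have hstep : ∀ i r, GapBelow F ((S ^ i) x) r → (∀ t ∈ Ico 0 r, ((S ^ i) x).tr (-t) ∉ D) →
      GapBelow F ((S ^ (i + 1)) x) r := by
    intro i r hr hrD
    refine ⟨hr.1, fun t ht => ?_⟩
    rw [hsucc, ← hS _ r hrD t ⟨ht.1.le, ht.2⟩, hF]
    exact hr.2 t ht
  have hgap : ∀ i, ∃ r, GapBelow F ((S ^ i) x) r := by
    intro i
    induction i with
    | zero => exact ⟨g, hg⟩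
    | succ i ih =>
      obtain ⟨r, hr⟩ := ih
      obtain ⟨r', hr', h'⟩ := exists_tr_neg_not_mem hD (hcon i)
      refine ⟨min r r', hstep i _ ⟨lt_min hr.1 hr', fun t ht => ?_⟩ fun t ht => ?_⟩
      · exact hr.2 t ⟨ht.1, ht.2.trans_le (min_le_left _ _)⟩
      · exact h' t ⟨ht.1, ht.2.trans_le (min_le_right _ _)⟩
  set bad : Set ℕ := {i | ∃ r, GapBelow F ((S ^ i) x) r ∧
      ∃ t ∈ Ioo 0 r, ((S ^ i) x).tr (-t) ∈ D} with hbad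
  -- The gaps are disjoint, so different bad times give different points of `D` over `|k| ≤ K`, and
  -- there are finitely many of these.
  have hfin : bad.Finite := by
    by_contra hinf
    choose! r hr t ht htD using fun i (hi : i ∈ bad) => hi
    have hmaps : MapsTo (fun i => ((S ^ i) x).tr (-t i)) bad {e | e ∈ D ∧ |e.k| ≤ K} :=
      fun i hi => ⟨htD i hi, (hFK _ (hxF i) : |((S ^ i) x).k| ≤ K)⟩
    obtain ⟨i, hi, j, hj, hij, heq⟩ := Set.Infinite.exists_ne_map_eq_of_mapsTo hinf hmaps (hD K)
    exact hij (hinj (GapBelow.eq_of_tr_eq (hxF i) (hxF j) (hr i hi) (hr j hj) (ht i hi) (ht j hj)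
      heq))
  obtain ⟨N, hN⟩ := hfin.bddAbove
  obtain ⟨r, hr⟩ := hgap (N + 1)
  -- After the last bad time the gap is transported without shrinking.
  have hall : ∀ i, GapBelow F ((S ^ (N + 1 + i)) x) r := by
    intro i
    induction i with
    | zero => exact hr
    | succ i ih =>
      refine hstep _ _ ih fun t ht htD => ?_
      rcases ht.1.eq_or_lt with h0 | h0
      · rw [← h0, neg_zero, tr_zero] at htD
        exact hcon _ htD
      · have hmem : N + 1 + i ∈ bad := ⟨r, ih, t, ⟨h0, ht.2⟩, htD⟩
        have := hN hmem
        omega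
  -- Pigeonhole: of infinitely many distinct points on finitely many circles, two are less than `r`
  -- apart, so one lies in the gap below the other.
  have hmaps : MapsTo (fun i : ℕ => (((S ^ (N + 1 + i)) x).k, ⌊((S ^ (N + 1 + i)) x).y / r⌋))
      univ (Icc (-K) K ×ˢ Icc ⌊-1 / r⌋ ⌊1 / r⌋) := by
    intro i _
    have hm := ((S ^ (N + 1 + i)) x).mem
    have h1 := B.h_le_one ((S ^ (N + 1 + i)) x).k
    refine ⟨abs_le.1 (hFK _ (hxF _)), Int.floor_le_floor ?_, Int.floor_le_floor ?_⟩
    · have := hr.1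
      gcongr; linarith [hm.1]
    · have := hr.1
      gcongr; linarith [hm.2]
  obtain ⟨i, -, j, -, hij, heq⟩ := infinite_univ.exists_ne_map_eq_of_mapsTo hmaps
    ((finite_Icc _ _).prod (finite_Icc _ _))
  have hdist : ∀ i j : ℕ, ((S ^ (N + 1 + i)) x).k = ((S ^ (N + 1 + j)) x).k →
      ((S ^ (N + 1 + j)) x).y - ((S ^ (N + 1 + i)) x).y ∈ Ioo 0 r → False := by
    intro i j hk hy
    refine (hall j).2 _ hy ?_
    rw [Edge.tr, ← hk]
    rw [show ((S ^ (N + 1 + j)) x).y + -(((S ^ (N + 1 + j)) x).y - ((S ^ (N + 1 + i)) x).y) =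
      ((S ^ (N + 1 + i)) x).y by ring, pt_eta]
    exact hxF _
  obtain ⟨hk, hfl⟩ := Prod.ext_iff.1 heq
  have habs := Int.abs_sub_lt_one_of_floor_eq_floor hfl
  rw [← sub_div, abs_div, abs_of_pos hr.1, div_lt_one hr.1, abs_lt] at habs
  rcases lt_trichotomy ((S ^ (N + 1 + i)) x).y ((S ^ (N + 1 + j)) x).y with hlt | h0 | hlt
  · exact hdist i j hk ⟨by linarith, by linarith⟩
  · have := hinj (Edge.ext' hk h0)
    omega
  · exact hdist j i hk.symm ⟨by linarith, by linarith⟩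

/-! ### Absence of bounded orbits for generic slopes -/

variable (B) in
/-- The points whose orbits stay over the rectangles of index at most `K` in absolute value. -/
def boundedSet (a : ℝ) (K : ℤ) : Set B.Edge := {e | ∀ j : ℤ, |((B.step a ^ j) e).k| ≤ K}

lemma zpow_mem_boundedSet {a : ℝ} {K : ℤ} {e : B.Edge} (n : ℤ) :
    (B.step a ^ n) e ∈ B.boundedSet a K ↔ e ∈ B.boundedSet a K := by
  constructor
  · intro h j
    have := h (j - n)
    rwa [zpow_zpow_apply, sub_add_cancel] at this
  · intro h j
    rw [zpow_zpow_apply]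
    exact h _

lemma boundedSet_k {a : ℝ} {K : ℤ} {e : B.Edge} (h : e ∈ B.boundedSet a K) : |e.k| ≤ K := by
  simpa using h 0

lemma mem_lattice_of_mem_cut {s : ℤ → ℤ} {e : B.Edge} (h : e ∈ B.cut s) : e.y ∈ B.lattice := by
  rcases h with h | h | h <;> rw [h]
  · exact neg_mem (h_mem_lattice _)
  · exact neg_mem (h_mem_lattice _)
  · exact h_mem_lattice _

lemma step_y_mem_lattice_of_mem_stepCut {a : ℝ} {e : B.Edge} (h : e ∈ B.stepCut a) :
    (B.step a e).y ∈ B.lattice := by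
  have : (B.step a e).y = (B.shift a e).y := exit_y _
  have h' : B.shift a e ∈ B.cut (· + 1) := h
  rw [this]
  exact mem_lattice_of_mem_cut h'

/-- A gap forces a discontinuity of `step a` on the forward orbit and one of its inverse on the
backward orbit. Both have ordinates in `lattice`, so a nonzero multiple of `a` would lie there too.
-/
lemma Generic.not_gapBelow {a : ℝ} (ha : B.Generic a) {K : ℤ} {x : B.Edge}
    (hx : x ∈ B.boundedSet a K) (g : ℝ) : ¬ GapBelow (B.boundedSet a K) x g := by
  intro hg
  have hpow : ∀ i : ℕ, (B.step a ^ i) x = (B.step a ^ (i : ℤ)) x := fun i => by rw [zpow_natCast]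
  have hinv : ∀ i : ℕ, ((B.step a).symm ^ i) x = (B.step a ^ (-(i : ℤ))) x := fun i => by
    rw [zpow_neg, zpow_natCast, ← inv_pow]; rfl
  obtain ⟨i, hi⟩ := hg.exists_mem_discontinuity (S := B.step a) (D := B.stepCut a) (K := K)
    (fun e g h t ht => step_tr_neg h ht) (finite_stepCut a)
    (fun e => by simpa using zpow_mem_boundedSet (a := a) (K := K) (e := e) 1)
    (fun e he => boundedSet_k he) hx
    (fun i j hij => by
      by_contra hne
      simp only [hpow] at hij
      exact ha.ne_of_ne x (by exact_mod_cast hne) hij)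
  obtain ⟨j, hj⟩ := hg.exists_mem_discontinuity (S := (B.step a).symm) (D := B.cut (· - 1)) (K := K)
    (fun e g h t ht => symm_tr_neg h ht) (finite_cut _)
    (fun e => by
      have := zpow_mem_boundedSet (a := a) (K := K) (e := e) (-1)
      rwa [zpow_neg_one] at this)
    (fun e he => boundedSet_k he) hx
    (fun i j hij => by
      by_contra hne
      simp only [hinv] at hij
      exact ha.ne_of_ne x (fun h => hne (by exact_mod_cast neg_injective h)) hij)
  have h1 := step_y_mem_lattice_of_mem_stepCut hi
  have h2 := mem_lattice_of_mem_cut hj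
  rw [hinv] at h2
  have h3 := ha.not_mem _ (n := i + j + 1) (by omega) h2
  rw [zpow_zpow_apply, show (i : ℤ) + j + 1 + -(j : ℤ) = i + 1 by ring, zpow_add_one_apply,
    ← hpow] at h3
  exact h3 h1

lemma mem_boundedSet_of_right {a : ℝ} {K : ℤ} {x : B.Edge}
    (h : ∀ j : ℤ, ∀ ε > 0, ∃ t ∈ Ico 0 ε, |((B.step a ^ j) (x.tr t)).k| ≤ K) :
    x ∈ B.boundedSet a K := by
  intro j
  obtain ⟨ε, hε, hx⟩ := exists_zpow_tr a j x
  obtain ⟨t, ht, hk⟩ := h j ε hε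
  rwa [hx t ht] at hk

/-- Above a missing point `u` there would be a first point of the set, which belongs to it by
closedness from the right and has a gap below. -/
lemma Generic.mem_boundedSet_of_k_eq {a : ℝ} (ha : B.Generic a) {K : ℤ} {x u : B.Edge}
    (hx : x ∈ B.boundedSet a K) (hk : u.k = x.k) : u ∈ B.boundedSet a K := by
  by_contra hu
  set A : Set ℝ := {t | 0 ≤ t ∧ u.tr t ∈ B.boundedSet a K} with hA
  have hne : A.Nonempty := by
    refine ⟨x.y - u.y + 2 * B.h x.k, ?_, ?_⟩
    · have h1 := x.mem
      have h2 := u.mem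
      rw [hk] at h2
      linarith [h1.1, h2.2]
    · have : u.tr (x.y - u.y + 2 * B.h x.k) = x := by
        conv_rhs => rw [← pt_eta x]
        rw [Edge.tr, hk]
        exact pt_eq_pt_iff.2 ⟨1, by push_cast; ring⟩
      rwa [this]
  have hbdd : BddBelow A := ⟨0, fun t ht => ht.1⟩
  set m := sInf A with hm
  have hm0 : 0 ≤ m := le_csInf hne fun t ht => ht.1
  have hmem : u.tr m ∈ B.boundedSet a K := by
    refine mem_boundedSet_of_right fun j ε hε => ?_
    obtain ⟨t, ht, hlt⟩ := exists_lt_of_csInf_lt hne (show sInf A < m + ε by linarith)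
    refine ⟨t - m, ⟨by linarith [csInf_le hbdd ht], by linarith⟩, ?_⟩
    rw [tr_tr, add_sub_cancel]
    exact ht.2 j
  have hmpos : 0 < m := by
    refine hm0.lt_of_ne fun h0 => hu ?_
    rwa [← h0, tr_zero] at hmem
  refine ha.not_gapBelow hmem m ⟨hmpos, fun t ht hcon => ?_⟩
  rw [tr_tr] at hcon
  have := csInf_le hbdd (show m + -t ∈ A from ⟨by linarith [ht.2], hcon⟩)
  linarith [ht.1]

lemma Generic.boundedSet_eq_empty {a : ℝ} (ha : B.Generic a) (K : ℤ) :
    B.boundedSet a K = ∅ := by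
  by_contra hne
  obtain ⟨x, hx⟩ := nonempty_iff_ne_empty.2 hne
  have hall : ∀ n : ℕ, ∃ e ∈ B.boundedSet a K, e.k = x.k + n := by
    intro n
    induction n with
    | zero => exact ⟨x, hx, by simp⟩
    | succ n ih =>
      obtain ⟨e, he, hk⟩ := ih
      -- From height `-a` the next section is met at height 0, which is always open; so the circle
      -- to the right also meets the set.
      have h1 : B.pt e.k (-a) ∈ B.boundedSet a K := ha.mem_boundedSet_of_k_eq he rfl
      refine ⟨_, (zpow_mem_boundedSet 1).2 h1, ?_⟩
      have h0 : ∀ k, (0 : ℝ) ∈ Ico (-(B.h k)) (B.h k) := fun k =>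
        ⟨by linarith [B.h_pos k], B.h_pos k⟩
      have h2 : (B.step a (B.pt e.k (-a))).k = e.k + 1 := by
        refine (step_k_iff a _).2 ?_
        rw [pt_y, pt_k, wrap_wrap_add, neg_add_cancel, B.wrap_eq_self (h0 _)]
        exact h0 _
      rw [zpow_one, h2, hk]; push_cast; ring
  obtain ⟨e, he, hk⟩ := hall (2 * K.toNat + 1)
  have h1 := abs_le.1 (boundedSet_k he)
  have h2 := abs_le.1 (boundedSet_k hx)
  omega

/-! ### The half turn and the unboundedness of semi-orbits -/

/-- Rotation of the table by a half turn, as a map of edge points. -/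
def Edge.mirror (e : B.Edge) : B.Edge := B.exit (B.pt (-e.k - 1) (-e.y))

lemma exit_k_cases (e : B.Edge) : (B.exit e).k = e.k + 1 ∨ (B.exit e).k = -e.k - 1 := by
  by_cases h : e.y ∈ Ico (-(B.h (e.k + 1))) (B.h (e.k + 1))
  · left; rw [exit_of_mem h, pt_k]
  · right; rw [exit_of_not_mem h, pt_k]

lemma abs_mirror_k (e : B.Edge) : |e.mirror.k| = |e.k| := by
  have := exit_k_cases (B.pt (-e.k - 1) (-e.y))
  rw [pt_k] at this
  unfold Edge.mirror
  rcases this with h | h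
  · rw [h, sub_add_cancel, abs_neg]
  · rw [h]; congr 1; ring

/-- Away from the discontinuities, the rotation conjugates the step map to its inverse. -/
lemma symm_mirror {a : ℝ} {e : B.Edge} (he : e ∉ B.stepCut a) :
    (B.step a).symm e.mirror = (B.step a e).mirror := by
  set k := e.k with hk
  set u := B.wrap k (e.y + a) with hu
  have hum : u ∈ Ico (-(B.h k)) (B.h k) := B.wrap_mem _ _
  have hcut : ¬ (u = -B.h k ∨ u = -B.h (k + 1) ∨ u = B.h (k + 1)) := he
  simp only [not_or] at hcut
  have hlhs : (B.step a).symm e.mirror = B.pt (-k - 1) (-u) := by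
    rw [symm_apply, Edge.mirror, Equiv.symm_apply_apply, shift_symm_pt]
    obtain ⟨m, hm⟩ := B.wrap_eq_sub k (e.y + a)
    refine pt_eq_pt_iff.2 ⟨-m, ?_⟩
    rw [hu, hm, h_reflect]; push_cast; ring
  rw [hlhs]
  have hneg : -u ∈ Ico (-(B.h k)) (B.h k) :=
    ⟨by linarith [hum.2], by linarith [lt_of_le_of_ne hum.1 (Ne.symm hcut.1)]⟩
  by_cases h : u ∈ Ico (-(B.h (k + 1))) (B.h (k + 1))
  · have h1 : B.step a e = B.pt (k + 1) u := by
      rw [step_apply, exit_of_mem (e := B.pt e.k (e.y + a)) h]; rfl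
    have hy : (B.pt (k + 1) u).y = u := pt_y_of_mem h
    have hh : B.h (-(k + 1) - 1) = B.h (k + 1) := B.h_reflect _
    have hh' : B.h (-(k + 1) - 1 + 1) = B.h k := by
      rw [sub_add_cancel, neg_add, ← sub_eq_add_neg, B.h_reflect]
    have hneg' : -u ∈ Ico (-(B.h (-(k + 1) - 1))) (B.h (-(k + 1) - 1)) := by
      rw [hh]
      exact ⟨by linarith [h.2], by linarith [lt_of_le_of_ne h.1 (Ne.symm hcut.2.1)]⟩
    rw [h1, Edge.mirror, hy, pt_k, exit_of_mem]
    · rw [pt_y_of_mem hneg', pt_k]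
      congr 1; ring
    · rw [pt_y_of_mem hneg', pt_k, hh']
      exact hneg
  · have h1 : B.step a e = B.pt (-k - 1) u := by
      rw [step_apply, exit_of_not_mem (e := B.pt e.k (e.y + a)) h]; rfl
    have hy : (B.pt (-k - 1) u).y = u := pt_y_of_mem (by rwa [B.h_reflect])
    have hkk : -(-k - 1) - 1 = k := by ring
    rw [h1, Edge.mirror, hy, pt_k, hkk, exit_of_not_mem]
    · rw [pt_y_of_mem hneg, pt_k]
    · rw [pt_y_of_mem hneg, pt_k]
      rintro ⟨h2, h3⟩
      refine h ⟨by linarith, lt_of_le_of_ne (by linarith) hcut.2.2⟩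

lemma Generic.false_of_right_limit {a : ℝ} (ha : B.Generic a) {K : ℤ} {x : B.Edge} {t : ℕ → ℝ}
    (ht0 : ∀ᶠ n in atTop, 0 ≤ t n) (ht : Tendsto t atTop (𝓝 0))
    (h : ∀ j : ℤ, ∀ᶠ n in atTop, |((B.step a ^ j) (x.tr (t n))).k| ≤ K) : False := by
  have : x ∈ B.boundedSet a K := by
    refine mem_boundedSet_of_right fun j ε hε => ?_
    obtain ⟨n, h1, h2, h3⟩ := ((h j).and (ht0.and (ht.eventually_lt_const hε))).exists
    exact ⟨t n, ⟨h2, h3⟩, h1⟩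
  rw [ha.boundedSet_eq_empty] at this
  exact this

lemma zpow_mirror {a : ℝ} {e : B.Edge} (n : ℤ)
    (h : ∀ j : ℤ, |j| ≤ |n| → (B.step a ^ j) e ∉ B.stepCut a) :
    (B.step a ^ n) e.mirror = ((B.step a ^ (-n)) e).mirror := by
  induction n using Int.induction_on with
  | zero => simp
  | succ n ih =>
    have hle : |(n : ℤ)| ≤ |(n : ℤ) + 1| := by
      rw [abs_of_nonneg (by positivity), abs_of_nonneg (by positivity)]; omega
    rw [zpow_add_one_apply, ih fun j hj => h j (hj.trans hle)]
    have h1 := symm_mirror (h (-(n + 1)) (by rw [abs_neg]))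
    rw [← zpow_add_one_apply, show -((n : ℤ) + 1) + 1 = -n by ring] at h1
    rw [← h1, Equiv.apply_symm_apply]
  | pred n ih =>
    have hle : |(n : ℤ)| ≤ |-(n : ℤ) - 1| := by
      rw [abs_of_nonneg (by positivity), abs_of_nonpos (by omega)]; omega
    rw [zpow_sub_one_apply, ih fun j hj => h j (hj.trans (by rwa [abs_neg]))]
    rw [neg_neg, symm_mirror (h n hle), ← zpow_add_one_apply]
    congr 2; ring_nf

/-- A subsequence on one circle with monotone ordinates has a one-sided limit, and the limit would
have a bounded full orbit. -/
lemma Generic.false_of_bounded {a : ℝ} (ha : B.Generic a) {K : ℤ} {s : ℕ → B.Edge}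
    (h : ∀ j : ℤ, ∀ᶠ n in atTop, |((B.step a ^ j) (s n)).k| ≤ K ∧
      (B.step a ^ j) (s n) ∉ B.stepCut a) : False := by
  obtain ⟨k, hk⟩ : ∃ k, ∃ᶠ n in atTop, (s n).k = k := by
    by_contra! hcon
    have h1 : ∀ᶠ n in atTop, ∀ k ∈ Icc (-K) K, (s n).k ≠ k :=
      (eventually_all_finite (finite_Icc _ _)).2 fun k _ => hcon k
    obtain ⟨n, h2, h3⟩ := (h1.and (h 0)).exists
    exact h2 _ (abs_le.1 (by simpa using h3.1)) rfl
  obtain ⟨φ, hφ, hφk⟩ := extraction_of_frequently_atTop hk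
  obtain ⟨g, hg⟩ := exists_increasing_or_nonincreasing_subseq (· < ·) fun n => (s (φ n)).y
  set σ : ℕ → ℕ := fun n => φ (g n) with hσ
  have hσm : StrictMono σ := hφ.comp g.strictMono
  have hσk : ∀ n, (s (σ n)).k = k := fun n => hφk _
  have hσt : Tendsto σ atTop atTop := hσm.tendsto_atTop
  have hbd : ∀ n, (s (σ n)).y ∈ Ico (-(B.h k)) (B.h k) := fun n => by
    have := (s (σ n)).mem
    rwa [hσk] at this
  rcases hg with hg | hg
  -- Convergence from the left is useless for right-continuous iterates. The half turn makes it
  -- convergence from the right and reverses time, provided the iterates involved avoid the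
  -- discontinuities.
  · have hmono : Monotone fun n => (s (σ n)).y :=
      monotone_nat_of_le_succ fun n => (hg n (n + 1) (Nat.lt_succ_self n)).le
    have hba : BddAbove (range fun n => (s (σ n)).y) :=
      ⟨B.h k, by rintro _ ⟨n, rfl⟩; exact (hbd n).2.le⟩
    have hlim := tendsto_atTop_ciSup hmono hba
    set y := ⨆ n, (s (σ n)).y with hy
    have ht : Tendsto (fun n => y - (s (σ n)).y) atTop (𝓝 0) := by
      simpa using hlim.const_sub y
    obtain ⟨ε, hε, hexit⟩ := exists_jump_tr (· + 1) (B.pt (-k - 1) (-y))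
    have hmir : ∀ᶠ n in atTop, (s (σ n)).mirror =
        (B.exit (B.pt (-k - 1) (-y))).tr (y - (s (σ n)).y) := by
      filter_upwards [ht.eventually_lt_const hε] with n hn
      rw [exit_eq_jump, ← hexit _ ⟨sub_nonneg.2 (le_ciSup hba n), hn⟩, ← exit_eq_jump, pt_tr,
        Edge.mirror, hσk]
      congr 2; ring
    refine ha.false_of_right_limit (K := K) (x := B.exit (B.pt (-k - 1) (-y)))
      (Eventually.of_forall fun n => sub_nonneg.2 (le_ciSup hba n)) ht fun j => ?_
    have hgood : ∀ᶠ n in atTop, ∀ i ∈ {i : ℤ | |i| ≤ |j|},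
        (B.step a ^ i) (s (σ n)) ∉ B.stepCut a := by
      refine (eventually_all_finite ?_).2 fun i _ =>
        hσt.eventually ((h i).mono fun n hn => hn.2)
      refine (finite_Icc (-|j|) |j|).subset fun i hi => abs_le.1 hi
    filter_upwards [hmir, hgood, hσt.eventually (h (-j))] with n h1 h2 h3
    rw [← h1, zpow_mirror j h2, abs_mirror_k]
    exact h3.1
  · have hanti : Antitone fun n => (s (σ n)).y :=
      antitone_nat_of_succ_le fun n => not_lt.1 (hg n (n + 1) (Nat.lt_succ_self n))
    have hbb : BddBelow (range fun n => (s (σ n)).y) :=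
      ⟨-B.h k, by rintro _ ⟨n, rfl⟩; exact (hbd n).1⟩
    have hlim := tendsto_atTop_ciInf hanti hbb
    set y := ⨅ n, (s (σ n)).y with hy
    have ht : Tendsto (fun n => (s (σ n)).y - y) atTop (𝓝 0) := by
      simpa using hlim.sub_const y
    refine ha.false_of_right_limit (K := K) (x := B.pt k y)
      (Eventually.of_forall fun n => sub_nonneg.2 (ciInf_le hbb n)) ht fun j => ?_
    filter_upwards [hσt.eventually (h j)] with n h1
    rw [pt_tr, add_sub_cancel, ← hσk n, pt_eta]
    exact h1.1

lemma Generic.eventually_not_mem_stepCut {a : ℝ} {K : ℤ} {s : ℕ → B.Edge}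
    (hs : Function.Injective s) (h : ∀ᶠ n in atTop, |(s n).k| ≤ K) :
    ∀ᶠ n in atTop, s n ∉ B.stepCut a := by
  have hfin : {n | s n ∈ B.stepCut a ∧ |(s n).k| ≤ K}.Finite :=
    (finite_stepCut (B := B) a K).preimage (f := s) hs.injOn
  have h1 : ∀ᶠ n in atTop, n ∉ {n | s n ∈ B.stepCut a ∧ |(s n).k| ≤ K} := by
    have := hfin.compl_mem_cofinite
    rw [Nat.cofinite_eq_atTop] at this
    exact this
  filter_upwards [h, h1] with n h2 h3 h4
  exact h3 ⟨h4, h2⟩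

/-- For generic slopes all forward and backward orbits of the step map are unbounded. -/
lemma Generic.exists_lt_abs_k {a : ℝ} (ha : B.Generic a) (σ : ℤ) (hσ : σ = 1 ∨ σ = -1) (K : ℤ)
    (e : B.Edge) : ∃ i : ℕ, K < |((B.step a ^ (σ * i)) e).k| := by
  by_contra! hcon
  have hσ0 : σ ≠ 0 := by omega
  have hinj : ∀ j : ℤ, Function.Injective fun n : ℕ => (B.step a ^ j) ((B.step a ^ (σ * n)) e) := by
    intro j m n hmn
    by_contra hne
    have h1 := (B.step a ^ j).injective hmn
    refine ha.ne_of_ne e (fun h => hne ?_) h1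
    exact_mod_cast mul_left_cancel₀ hσ0 h
  have hbd : ∀ j : ℤ, ∀ᶠ n : ℕ in atTop, |((B.step a ^ j) ((B.step a ^ (σ * n)) e)).k| ≤ K := by
    intro j
    filter_upwards [eventually_ge_atTop j.natAbs] with n hn
    obtain ⟨i, hi⟩ : ∃ i : ℕ, j + σ * n = σ * i := by
      rcases hσ with rfl | rfl
      · exact ⟨(j + n).toNat, by omega⟩
      · exact ⟨(n - j).toNat, by omega⟩
    rw [zpow_zpow_apply, hi]
    exact hcon i
  -- Genericity makes the orbit points distinct, so the finitely many discontinuities in the region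
  -- are eventually avoided.
  refine ha.false_of_bounded (K := K) (s := fun n => (B.step a ^ (σ * n)) e) fun j => (hbd j).and ?_
  exact Generic.eventually_not_mem_stepCut (hinj j) (hbd j)

/-! ### Almost every direction is typical -/

lemma symm_zpow_k (a : ℝ) {e : B.Edge} {i : ℕ} (hi : (i : ℤ) ≤ e.k) :
    ((B.step a ^ (-(i : ℤ))) e).k = e.k - i := by
  induction i with
  | zero => simp
  | succ i ih =>
    push_cast at hi
    have h1 := ih (by omega)
    have h2 : -((i + 1 : ℕ) : ℤ) = -(i : ℤ) - 1 := by push_cast; ring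
    rw [h2, zpow_sub_one_apply, symm_k_of_nonneg a (by omega), h1]
    push_cast; ring

lemma direct_symm_zpow (a : ℝ) {e : B.Edge} {i : ℕ} (hi : (i : ℤ) ≤ e.k) :
    Direct a i ((B.step a ^ (-(i : ℤ))) e) := by
  intro l hl
  rw [zpow_zpow_apply, symm_zpow_k a hi, show (l : ℤ) + -(i : ℤ) = -((i - l : ℕ) : ℤ) by omega,
    symm_zpow_k a (by omega)]
  omega

/-- Pulled back one rectangle, the interval is cut only if it contains the vertex of that circle;
this vertex would then reach aperture `m` directly. -/
lemma Clear.exists_translation {a : ℝ} {m : ℕ} (h : B.Clear a m) (i : ℕ) (hi : i ≤ m) :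
    ∃ c : ℝ, ∀ u ∈ Ico (-B.p m) (B.p m), c + u ∈ Ico (-B.p (m - i)) (B.p (m - i)) ∧
      (B.step a ^ (-(i : ℤ))) (B.pt m u) = B.pt ((m - i : ℕ) : ℤ) (c + u) := by
  induction i with
  | zero => exact ⟨0, fun u hu => ⟨by simpa using hu, by simp⟩⟩
  | succ i ih =>
    obtain ⟨c, hc⟩ := ih (by omega)
    obtain ⟨j, hj⟩ : ∃ j, m - i = j + 1 := ⟨m - i - 1, by omega⟩
    have hj' : m - (i + 1) = j := by omega
    rw [hj] at hc
    rw [hj']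
    set v := B.wrap j (c - B.p m - a) with hv
    have hvm : v ∈ Ico (-B.p j) (B.p j) := by
      have := B.wrap_mem j (c - B.p m - a)
      rwa [h_natCast] at this
    have hback : ∀ u ∈ Ico (-B.p m) (B.p m),
        (B.step a ^ (-((i + 1 : ℕ) : ℤ))) (B.pt m u) = B.pt j (v + B.p m + u) := by
      intro u hu
      obtain ⟨h1, h2⟩ := hc u hu
      rw [show -((i + 1 : ℕ) : ℤ) = -(i : ℤ) - 1 by push_cast; ring, zpow_sub_one_apply, h2,
        symm_apply_of_pos a (by rw [pt_k]; positivity), pt_k, pt_y_of_mem h1, add_assoc v,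
        pt_wrap_add, Nat.cast_succ, add_sub_cancel_right]
      congr 1; ring
    refine ⟨v + B.p m, fun u hu => ⟨⟨by linarith [hvm.1, hu.1], ?_⟩, hback u hu⟩⟩
    by_contra hcon
    -- The parameter at which the pulled-back interval would pass the top of the `j`-th circle, that
    -- is, the point `vert j`.
    set u₀ := B.p j - v - B.p m with hu₀
    have hu₀m : u₀ ∈ Ico (-B.p m) (B.p m) :=
      ⟨by linarith [hvm.2], by linarith [hu.2]⟩
    have hvert : (B.step a ^ (-((i + 1 : ℕ) : ℤ))) (B.pt m u₀) = B.vert j := by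
      rw [hback u₀ hu₀m]
      refine pt_eq_pt_iff.2 ⟨1, ?_⟩
      rw [h_natCast, hu₀]; push_cast; ring
    have hd := direct_symm_zpow a (e := B.pt m u₀) (i := i + 1) (by rw [pt_k]; exact_mod_cast hi)
    rw [hvert] at hd
    exact h j (by omega) (by rwa [show m - j = i + 1 by omega])

lemma Clear.exists_interval {a : ℝ} {m : ℕ} (h : B.Clear a m) :
    ∃ c : ℝ, (∀ u ∈ Ico (-B.p m) (B.p m), c + u ∈ Ico (-(B.h 0)) (B.h 0) ∧
      (B.step a ^ (m : ℤ)) (B.pt 0 (c + u)) = B.pt m u) ∧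
      ∀ e : B.Edge, e.k = 0 ∧ Direct a m e ↔ ∃ u ∈ Ico (-B.p m) (B.p m), e = B.pt 0 (c + u) := by
  obtain ⟨c, hc⟩ := h.exists_translation m le_rfl
  rw [Nat.sub_self] at hc
  refine ⟨c, fun u hu => ⟨(hc u hu).1, ?_⟩, fun e => ⟨?_, ?_⟩⟩
  · have := (hc u hu).2
    rw [Nat.cast_zero] at this
    rw [← this, zpow_zpow_apply, add_neg_cancel, zpow_zero]; rfl
  · rintro ⟨hk, hd⟩
    have h1 : ((B.step a ^ (m : ℤ)) e).k = m := by rw [hd m le_rfl, hk, zero_add]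
    have h2 := ((B.step a ^ (m : ℤ)) e).mem
    rw [h1, h_natCast] at h2
    refine ⟨_, h2, ?_⟩
    have h3 := (hc _ h2).2
    have h4 : B.pt m ((B.step a ^ (m : ℤ)) e).y = (B.step a ^ (m : ℤ)) e := by
      conv_rhs => rw [← pt_eta ((B.step a ^ (m : ℤ)) e), h1]
    rw [h4, zpow_zpow_apply, neg_add_cancel, zpow_zero] at h3
    exact h3
  · rintro ⟨u, hu, rfl⟩
    refine ⟨rfl, ?_⟩
    have := direct_symm_zpow a (e := B.pt m u) (i := m) (by rw [pt_k])
    rwa [(hc u hu).2, Nat.cast_zero] at this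

lemma Clear.isSingleInterval {θ : ℝ} (hc : 0 < Real.cos θ) {m : ℕ}
    (h : B.Clear (Real.tan θ) m) : B.IsSingleInterval (B.reach θ m) := by
  obtain ⟨c, hc1, hc2⟩ := h.exists_interval
  refine ⟨c - B.p m, c + B.p m, by linarith [B.p_pos m], ?_⟩
  ext z
  constructor
  · intro hz
    have hz1 := hz.1
    have hz0 := mem_section0_iff.1 hz1
    rw [hz0, mem_reach_iff hc, hc2] at hz
    obtain ⟨u, hu, he⟩ := hz
    rw [he] at hz0
    refine ⟨hz1, 0, ?_⟩
    rw [hz0, toPhase_Y, pt_y_of_mem (hc1 u hu).1]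
    push_cast
    constructor <;> linarith [hu.1, hu.2]
  · rintro ⟨hz, i, hi⟩
    have hz0 := mem_section0_iff.1 hz
    rw [hz0, mem_reach_iff hc, hc2]
    refine ⟨z.Y + 2 * i - c, ⟨by linarith [hi.1], by linarith [hi.2]⟩, ?_⟩
    refine pt_eq_pt_iff.2 ⟨-i, ?_⟩
    rw [h_zero]; push_cast; ring

/-- The pull-backs of clear apertures are nested half-open intervals; the supremum of their left
ends lies in all of them unless it is a right end. -/
lemma Generic.exists_direct {a : ℝ} (ha : B.Generic a) (hcl : ∃ᶠ m in atTop, B.Clear a m) :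
    ∃ e : B.Edge, e.k = 0 ∧ ∀ n, Direct a n e := by
  choose! c hc1 hc2 using fun m (hm : B.Clear a m) => hm.exists_interval
  have hp := B.p_pos
  have hinc : ∀ m m', B.Clear a m → B.Clear a m' → m ≤ m' → ∀ x ∈ Ico (c m' - B.p m') (c m' + B.p m'),
      x ∈ Ico (c m - B.p m) (c m + B.p m) := by
    intro m m' hm hm' hmm x hx
    have hu : x - c m' ∈ Ico (-B.p m') (B.p m') := ⟨by linarith [hx.1], by linarith [hx.2]⟩
    have h1 := (hc2 m' hm' (B.pt 0 (c m' + (x - c m')))).2 ⟨_, hu, rfl⟩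
    obtain ⟨u, hu', he⟩ := (hc2 m hm _).1 ⟨h1.1, h1.2.mono hmm⟩
    have h2 := congrArg Edge.y he
    rw [pt_y_of_mem (hc1 m' hm' _ hu).1, pt_y_of_mem (hc1 m hm _ hu').1] at h2
    constructor <;> linarith [hu'.1, hu'.2]
  have hleft : ∀ m m', B.Clear a m → B.Clear a m' → m ≤ m' → c m - B.p m ≤ c m' - B.p m' :=
    fun m m' hm hm' hmm => (hinc m m' hm hm' hmm _ ⟨le_rfl, by linarith [hp m']⟩).1
  have hright : ∀ m m', B.Clear a m → B.Clear a m' → m ≤ m' → c m' + B.p m' ≤ c m + B.p m := by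
    intro m m' hm hm' hmm
    by_contra hlt
    push Not at hlt
    have h1 := hinc m m' hm hm' hmm (max (c m + B.p m) (c m' - B.p m'))
      ⟨le_max_right _ _, max_lt hlt (by linarith [hp m'])⟩
    exact absurd h1.2 (not_lt.2 (le_max_left _ _))
  have hlr : ∀ m m', B.Clear a m → B.Clear a m' → c m' - B.p m' ≤ c m + B.p m := by
    intro m m' hm hm'
    rcases le_total m m' with h | h
    · linarith [hright m m' hm hm' h, hp m']
    · linarith [hleft m' m hm' hm h, hp m]
  set L : Set ℝ := (fun m => c m - B.p m) '' {m | B.Clear a m} with hL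
  obtain ⟨m₀, hm₀⟩ := hcl.exists
  have hLne : L.Nonempty := ⟨_, m₀, hm₀, rfl⟩
  have hLb : BddAbove L := ⟨c m₀ + B.p m₀, by rintro _ ⟨m, hm, rfl⟩; exact hlr m₀ m hm₀ hm⟩
  set x := sSup L with hx
  have hx1 : ∀ m, B.Clear a m → c m - B.p m ≤ x := fun m hm => le_csSup hLb ⟨m, hm, rfl⟩
  have hx2 : ∀ m, B.Clear a m → x ≤ c m + B.p m := fun m hm =>
    csSup_le hLne (by rintro _ ⟨m', hm', rfl⟩; exact hlr m m' hm hm')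
  have hlat : ∀ m, B.Clear a m → c m + m * a ∈ B.lattice := by
    intro m hm
    have h0 : (0 : ℝ) ∈ Ico (-B.p m) (B.p m) := ⟨by linarith [hp m], hp m⟩
    obtain ⟨h1, h2⟩ := hc1 m hm 0 h0
    have h3 := zpow_y_sub_mem a (B.pt 0 (c m + 0)) m
    rw [h2, pt_y_of_mem h1, pt_y_of_mem (by rwa [h_natCast])] at h3
    have := neg_mem h3
    convert this using 1; push_cast; ring
  have hx3 : ∀ m, B.Clear a m → x < c m + B.p m := by
    intro m hm
    -- Otherwise a later interval has the same right end, and as `c m + m a ∈ lattice` for clear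
    -- `m`, subtracting gives a nonzero multiple of `a` in `lattice`.
    refine (hx2 m hm).lt_of_ne fun hxm => ?_
    obtain ⟨m', hmm', hm'⟩ := frequently_atTop'.1 hcl m
    have h1 : c m' + B.p m' = c m + B.p m :=
      le_antisymm (hright m m' hm hm' hmm'.le) (hxm ▸ hx2 m' hm')
    refine ha ((m' : ℤ) - m) (by omega) ?_
    have h2 := sub_mem (hlat m' hm') (hlat m hm)
    have h3 := sub_mem (h_mem_lattice (B := B) m') (h_mem_lattice (B := B) m)
    have h4 := add_mem h2 h3
    rw [h_natCast, h_natCast] at h4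
    convert h4 using 1
    push_cast; linarith
  refine ⟨B.pt 0 x, rfl, fun n => ?_⟩
  obtain ⟨m, hnm, hm⟩ := frequently_atTop.1 hcl n
  refine Direct.mono hnm ((hc2 m hm _).2 ⟨x - c m, ⟨?_, ?_⟩, ?_⟩).2
  · linarith [hx1 m hm]
  · linarith [hx3 m hm]
  · rw [add_sub_cancel]

lemma eq_of_direct {a : ℝ} (hcl : ∃ᶠ m in atTop, B.Clear a m) {e f : B.Edge} (he0 : e.k = 0)
    (he : ∀ n, Direct a n e) (hf0 : f.k = 0) (hf : ∀ n, Direct a n f) : e = f := by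
  refine Edge.ext' (he0.trans hf0.symm) ?_
  by_contra hne
  have hpos : 0 < |e.y - f.y| := abs_pos.2 (sub_ne_zero.2 hne)
  have hsmall : ∀ᶠ m in atTop, 2 * B.p m < |e.y - f.y| := by
    have := B.p_lim.const_mul 2
    rw [mul_zero] at this
    exact this.eventually_lt_const hpos
  obtain ⟨m, hm, hlt⟩ := (hcl.and_eventually hsmall).exists
  obtain ⟨c, hc1, hc2⟩ := hm.exists_interval
  obtain ⟨u, hu, h1⟩ := (hc2 e).1 ⟨he0, he m⟩
  obtain ⟨v, hv, h2⟩ := (hc2 f).1 ⟨hf0, hf m⟩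
  rw [h1, h2, pt_y_of_mem (hc1 u hu).1, pt_y_of_mem (hc1 v hv).1] at hlt
  have : |c + u - (c + v)| < 2 * B.p m := by
    rw [abs_lt]; constructor <;> linarith [hu.1, hu.2, hv.1, hv.2]
  linarith

lemma base_flow_int {θ : ℝ} (hc : Real.cos θ ≠ 0) (n : ℤ) (z : B.Phase) :
    B.base (Real.tan θ) (B.flow θ (n / Real.cos θ) z) =
      (B.step (Real.tan θ) ^ n) (B.base (Real.tan θ) z) := by
  rw [base_flow, div_mul_cancel₀ _ hc, Int.floor_add_intCast, Int.floor_fract, zero_add]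

lemma Generic.exists_lt_abs_X {θ : ℝ} (hc : 0 < Real.cos θ) (ha : B.Generic (Real.tan θ)) (σ : ℤ)
    (hσ : σ = 1 ∨ σ = -1) (z : B.Phase) (M : ℝ) :
    ∃ t : ℝ, 0 ≤ σ * t ∧ M < |(B.flow θ t z).X| := by
  obtain ⟨i, hi⟩ := ha.exists_lt_abs_k σ hσ (⌈M⌉ + 1) (B.base (Real.tan θ) z)
  refine ⟨((σ * i : ℤ) : ℝ) / Real.cos θ, ?_, ?_⟩
  · rcases hσ with rfl | rfl
    · push_cast; rw [one_mul, one_mul]; positivity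
    · push_cast
      rw [← mul_div_assoc, ← mul_assoc]
      norm_num
      positivity
  · have h1 := abs_X_sub_le (Real.tan θ) (B.flow θ (((σ * i : ℤ) : ℝ) / Real.cos θ) z)
    rw [base_flow_int hc.ne'] at h1
    set k := ((B.step (Real.tan θ) ^ (σ * (i : ℤ))) (B.base (Real.tan θ) z)).k
    have h2 : ((⌈M⌉ + 1 : ℤ) : ℝ) < |(k : ℝ)| := by exact_mod_cast hi
    have h3 := Int.le_ceil M
    push_cast at h2
    have h4 := abs_sub_abs_le_abs_sub (k : ℝ) (B.flow θ (((σ * i : ℤ) : ℝ) / Real.cos θ) z).X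
    rw [abs_sub_comm] at h4
    linarith

variable (B) in
/-- The edge points at the height of a vertex of the table. -/
def vertexEdges : Set B.Edge := {e | |e.y| ∈ insert 0 (range B.p)}

lemma countable_vertexEdges : B.vertexEdges.Countable := by
  have hsub : B.vertexEdges ⊆ ⋃ k : ℤ, ⋃ s ∈ ({1, -1} : Set ℝ),
      (fun x => B.pt k (s * x)) '' insert 0 (range B.p) := by
    intro e he
    refine mem_iUnion.2 ⟨e.k, ?_⟩
    rcases abs_cases e.y with ⟨h, -⟩ | ⟨h, -⟩
    · refine mem_iUnion₂.2 ⟨1, by simp, |e.y|, he, ?_⟩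
      simp only [h, one_mul, pt_eta]
    · refine mem_iUnion₂.2 ⟨-1, by simp, |e.y|, he, ?_⟩
      simp only [h, neg_mul_neg, one_mul, pt_eta]
  refine (countable_iUnion fun k => ?_).mono hsub
  exact ((toFinite _).countable).biUnion fun s _ => ((countable_range _).insert _).image _

/-- Points over a vertex of the table lie on a vertical cross-section. -/
lemma IsVertex.exists_edge {z : B.Phase} (h : B.IsVertex z) (a : ℝ) :
    Int.fract z.X = 0 ∧ (B.base a z).toPhase = z ∧ B.base a z ∈ B.vertexEdges := by
  have hX : ∃ n : ℕ, |z.X| = n := by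
    rcases h with (h | ⟨n, h⟩) | ⟨n, h⟩
    · exact ⟨0, by have := congrArg Prod.fst h; simpa using this⟩
    · exact ⟨n, by have := congrArg Prod.fst h; simpa using this.symm⟩
    · exact ⟨n + 1, by have := congrArg Prod.fst h; simpa using this.symm⟩
  have hY : |z.Y| ∈ (insert 0 (range B.p) : Set ℝ) := by
    rcases h with (h | ⟨n, h⟩) | ⟨n, h⟩
    · left; have := congrArg Prod.snd h; simpa using this
    · right; exact ⟨n, congrArg Prod.snd h⟩
    · right; exact ⟨n, congrArg Prod.snd h⟩
  obtain ⟨n, hn⟩ := hX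
  have hfr : Int.fract z.X = 0 := by
    rcases abs_choice z.X with h' | h' <;> rw [h'] at hn
    · rw [hn, Int.fract_natCast]
    · rw [show z.X = ((-n : ℤ) : ℝ) by push_cast; linarith, Int.fract_intCast]
  have hy : (B.base a z).y = z.Y := by
    rw [base_eq_pt, hfr, mul_zero, sub_zero]
    exact pt_y_of_mem z.2
  refine ⟨hfr, Phase.ext' ?_ hy, ?_⟩
  · rw [toPhase_X, ← floor_X]
    have := Int.floor_add_fract z.X
    rwa [hfr, add_zero] at this
  · change |(B.base a z).y| ∈ (insert 0 (range B.p) : Set ℝ)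
    rwa [hy]

lemma isTypical_of_generic {θ : ℝ} (hc : 0 < Real.cos θ) (ha : B.Generic (Real.tan θ))
    (hcl : ∃ᶠ m in atTop, B.Clear (Real.tan θ) m)
    (hv : ∀ e ∈ B.vertexEdges, ∀ m : ℕ, 1 ≤ m → ¬ (0 ≤ ((B.step (Real.tan θ) ^ (m : ℤ)) e).k ∧
      ∀ i, Direct (Real.tan θ) i ((B.step (Real.tan θ) ^ (m : ℤ)) e))) : B.IsTypical θ := by
  have hesc : ∀ e : B.Edge, e.toPhase ∈ B.escapePoints θ ↔
      e.k = 0 ∧ ∀ n, Direct (Real.tan θ) n e := by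
    intro e
    simp only [escapePoints, mem_iInter, mem_reach_iff hc]
    exact ⟨fun h => ⟨(h 0).1, fun n => (h n).2⟩, fun h n => ⟨h.1, h.2 n⟩⟩
  have hpt : ∀ z ∈ B.escapePoints θ, ∃ e : B.Edge, z = e.toPhase := fun z hz =>
    ⟨_, mem_section0_iff.1 (mem_iInter.1 hz 0).1⟩
  refine ⟨fun z M => ?_, fun z M => ?_, hcl.mono fun m hm => hm.isSingleInterval hc, ?_, ?_⟩
  · obtain ⟨t, ht, h⟩ := ha.exists_lt_abs_X hc 1 (Or.inl rfl) z M
    exact ⟨t, by simpa using ht, h⟩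
  · obtain ⟨t, ht, h⟩ := ha.exists_lt_abs_X hc (-1) (Or.inr rfl) z M
    exact ⟨t, by push_cast at ht; linarith, h⟩
  · obtain ⟨e, he0, he⟩ := ha.exists_direct hcl
    refine ⟨B.orbit θ e.toPhase, ⟨_, (hesc e).2 ⟨he0, he⟩, rfl⟩, ?_⟩
    rintro O ⟨z, hz, rfl⟩
    obtain ⟨f, rfl⟩ := hpt z hz
    obtain ⟨hf0, hf⟩ := (hesc f).1 hz
    rw [eq_of_direct hcl hf0 hf he0 he]
  · rintro O ⟨z, hz, rfl⟩ w ⟨t, rfl⟩ hw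
    obtain ⟨e, rfl⟩ := hpt z hz
    obtain ⟨he0, he⟩ := (hesc e).1 hz
    obtain ⟨-, -, hV⟩ := hw.exists_edge (Real.tan θ)
    simp only [base_flow, base_toPhase] at hV
    set n := ⌊Int.fract e.toPhase.X + t * Real.cos θ⌋ with hn
    have hfar : ∀ l i : ℕ, Direct (Real.tan θ) i ((B.step (Real.tan θ) ^ (l : ℤ)) e) := by
      intro l i j hj
      rw [zpow_zpow_apply, he l l le_rfl, show (j : ℤ) + l = ((j + l : ℕ) : ℤ) by push_cast; rfl,
        he (j + l) (j + l) le_rfl]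
      push_cast; ring
    -- A vertex met at any time `n`, possibly negative, is at least one step before some later point
    -- of the direct escape.
    obtain ⟨m, l, hm, hml⟩ : ∃ m l : ℕ, 1 ≤ m ∧ (m : ℤ) + n = l :=
      ⟨(n.natAbs + 1), (n.natAbs + 1 + n).toNat, by omega, by omega⟩
    refine hv _ hV m hm ?_
    rw [zpow_zpow_apply, hml]
    refine ⟨?_, hfar l⟩
    rw [he l l le_rfl, he0]
    positivity

lemma ae_isTypical {lam : ℝ} (h0 : 0 < lam) (hlam : lam < 3 / 10)
    (hp : ∀ n, B.p (n + 1) ≤ lam * B.p n) :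
    ∀ᵐ θ ∂(volume.restrict (Ioo 0 (Real.pi / 2))), B.IsTypical θ := by
  have h1 : ∀ᵐ a : ℝ, B.Generic a := (countable_not_generic (B := B)).measure_zero _
  have h2 := ae_frequently_clear h0 hlam hp
  have h3 : ∀ᵐ a : ℝ, ∀ e ∈ B.vertexEdges, ∀ m : ℕ, 1 ≤ m →
      ¬ (0 ≤ ((B.step a ^ (m : ℤ)) e).k ∧ ∀ i, Direct a i ((B.step a ^ (m : ℤ)) e)) := by
    refine (ae_ball_iff countable_vertexEdges).2 fun e _ => ae_all_iff.2 fun m => ?_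
    by_cases hm : 1 ≤ m
    · have := volume_forall_direct_eq_zero h0 hlam hp e hm
      rw [← compl_compl {a | _}, ← mem_ae_iff] at this
      filter_upwards [this] with a ha _ using ha
    · exact Eventually.of_forall fun a h => absurd h hm
  have hgood := (h1.and (h2.and h3))
  rw [ae_restrict_iff' measurableSet_Ioo]
  -- The estimates concern slopes; `arctan` is differentiable and so maps null sets of slopes to
  -- null sets of angles.
  have hnull := addHaar_image_eq_zero_of_differentiableOn_of_addHaar_eq_zero volume
    (f := Real.arctan) (Real.differentiable_arctan.differentiableOn) hgood
  refine measure_mono_null ?_ hnull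
  intro θ hθ
  simp only [mem_compl_iff, mem_ofPred_eq, Classical.not_imp] at hθ
  obtain ⟨hI, hT⟩ := hθ
  refine ⟨Real.tan θ, fun h => hT ?_, Real.arctan_tan (by linarith [hI.1, Real.pi_pos]) hI.2⟩
  have hcos : 0 < Real.cos θ := Real.cos_pos_of_mem_Ioo ⟨by linarith [hI.1, Real.pi_pos], hI.2⟩
  exact isTypical_of_generic hcos h.1 h.2.1 h.2.2

/-! ### Topology of the surface -/

lemma wrap_add_of_mem {k : ℤ} {y t : ℝ} (h : B.wrap k y + t ∈ Ico (-(B.h k)) (B.h k)) :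
    B.wrap k (y + t) = B.wrap k y + t := by
  rw [← wrap_wrap_add, B.wrap_eq_self h]

variable (B) in
/-- Parametrization of the `k`-th rectangle of the unfolded table. -/
def rect (k : ℤ) (q : ℝ × ℝ) : B.unfolded :=
  ⟨((k : ℝ) + max 0 (min 1 q.1), max (-(B.h k)) (min (B.h k) q.2)), k,
    ⟨by simp, by simp⟩, ⟨by simp, by simp [(B.h_pos k).le]⟩⟩

lemma continuous_rect (k : ℤ) : Continuous (B.rect k) := by
  unfold rect
  fun_prop

lemma rect_val {k : ℤ} {x y : ℝ} (hx : x ∈ Icc (0 : ℝ) 1) (hy : y ∈ Icc (-(B.h k)) (B.h k)) :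
    (B.rect k (x, y)).1 = ((k : ℝ) + x, y) := by
  simp [rect, hx.1, hx.2, hy.1, hy.2]

variable (B) in
/-- The `k`-th rectangle with its horizontal sides glued, as a part of the surface. -/
def cyl (k : ℤ) (q : ℝ × ℝ) : B.Surface := Quot.mk _ (B.rect k (q.1, B.wrap k q.2))

lemma mk_rect_neg (k : ℤ) (x : ℝ) :
    (Quot.mk _ (B.rect k (x, -(B.h k))) : B.Surface) = Quot.mk _ (B.rect k (x, B.h k)) := by
  have h := B.h_pos k
  refine Quot.sound (Glue.horizontal k _ _ ⟨?_, ?_⟩ ?_ ?_ ?_)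
  · simp [rect]
  · simp [rect]
  · simp [rect]
  · simp [rect, h.le]
  · simp [rect, h.le]

/-- Away from the bottom of the circle this is a translated `rect`. At the bottom the two sides are
treated separately, the lower one by `rect` near the top, and they match by the horizontal gluing.
-/
lemma continuous_cyl (k : ℤ) : Continuous (B.cyl k) := by
  rw [continuous_iff_continuousAt]
  rintro ⟨x, y⟩
  have hpos := B.h_pos k
  set w := B.wrap k y with hw
  have hwm : w ∈ Ico (-(B.h k)) (B.h k) := B.wrap_mem k y
  have hcont : ∀ c : ℝ, Continuous fun q : ℝ × ℝ =>
      (Quot.mk _ (B.rect k (q.1, c + (q.2 - y))) : B.Surface) := fun c =>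
    continuous_quot_mk.comp ((continuous_rect k).comp (by fun_prop))
  have hwrap : ∀ y' : ℝ, w + (y' - y) ∈ Ico (-(B.h k)) (B.h k) →
      B.wrap k y' = w + (y' - y) := fun y' h => by
    have := wrap_add_of_mem (k := k) (y := y) (t := y' - y) h
    rwa [add_sub_cancel] at this
  have hnear : ∀ δ > 0, ∀ᶠ q : ℝ × ℝ in 𝓝 (x, y), |q.2 - y| < δ := fun δ hδ => by
    have : Tendsto (fun q : ℝ × ℝ => |q.2 - y|) (𝓝 (x, y)) (𝓝 |y - y|) :=
      Continuous.tendsto (by fun_prop) _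
    rw [sub_self, abs_zero] at this
    exact this.eventually_lt_const hδ
  rcases hwm.1.eq_or_lt with heq | hlt
  · have hunion : {q : ℝ × ℝ | y ≤ q.2} ∪ {q | q.2 ≤ y} = univ :=
      eq_univ_of_forall fun q => le_total y q.2
    rw [← continuousWithinAt_univ, ← hunion]
    refine ContinuousWithinAt.union ?_ ?_
    · refine ((hcont w).continuousWithinAt).congr_of_eventuallyEq ?_ ?_
      · filter_upwards [self_mem_nhdsWithin, nhdsWithin_le_nhds (hnear _ hpos)] with q h1 h2
        have h1' : y ≤ q.2 := h1
        rw [abs_lt] at h2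
        rw [cyl, hwrap q.2 ⟨by linarith, by linarith⟩]
      · rw [cyl, sub_self, add_zero]
    · refine ((hcont (B.h k)).continuousWithinAt).congr_of_eventuallyEq ?_ ?_
      · filter_upwards [self_mem_nhdsWithin, nhdsWithin_le_nhds (hnear _ hpos)] with q h1 h2
        have h1' : q.2 ≤ y := h1
        rw [abs_lt] at h2
        rcases h1'.eq_or_lt with h3 | h3
        · rw [cyl, h3, ← hw, ← heq, sub_self, add_zero, mk_rect_neg]
        · have h4 : B.wrap k q.2 = B.h k + (q.2 - y) := by
            have h5 := B.wrap_sub_zsmul k q.2 (-1)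
            push_cast at h5
            rw [← h5]
            have := wrap_add_of_mem (k := k) (y := y) (t := q.2 - y + 2 * B.h k)
              (by rw [← hw, ← heq]; constructor <;> linarith)
            rw [← hw, ← heq] at this
            rw [show q.2 - -1 * (2 * B.h k) = y + (q.2 - y + 2 * B.h k) by ring, this]; ring
          rw [cyl, h4]
      · rw [cyl, ← hw, ← heq, sub_self, add_zero, mk_rect_neg]
  · refine ((hcont w).continuousAt).congr_of_eventuallyEq ?_
    filter_upwards [hnear (min (w + B.h k) (B.h k - w)) (lt_min (by linarith) (by linarith [hwm.2]))]
      with q h2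
    rw [abs_lt] at h2
    have h3 := min_le_left (w + B.h k) (B.h k - w)
    have h4 := min_le_right (w + B.h k) (B.h k - w)
    rw [cyl, hwrap q.2 ⟨by linarith, by linarith⟩]

lemma proj_eq_cyl (z : B.Phase) : B.proj z = B.cyl ⌊z.X⌋ (Int.fract z.X, z.Y) := by
  have hy : z.Y ∈ Ico (-(B.h ⌊z.X⌋)) (B.h ⌊z.X⌋) := z.2
  unfold proj cyl
  congr 1
  apply Subtype.ext
  rw [rect_val ⟨Int.fract_nonneg _, (Int.fract_lt_one _).le⟩]
  · rw [Int.floor_add_fract]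
    exact Prod.ext rfl (B.wrap_eq_self hy).symm
  · exact Ico_subset_Icc_self (B.wrap_mem _ _)

lemma proj_along (a : ℝ) (e : B.Edge) (s : ℝ) (hs : s ∈ Ico (0 : ℝ) 1) :
    B.proj (B.along a e s hs) = B.cyl e.k (s, e.y + a * s) := by
  rw [proj_eq_cyl, floor_along, fract_along, along_Y]
  unfold cyl
  rw [B.wrap_eq_self (B.wrap_mem _ _)]

lemma proj_toPhase (e : B.Edge) : B.proj e.toPhase = B.cyl e.k (0, e.y) := by
  rw [proj_eq_cyl, toPhase_X, toPhase_Y, Int.floor_intCast, Int.fract_intCast]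

/-- The right side of a rectangle in the surface. -/
lemma cyl_one (f : B.Edge) : B.cyl f.k (1, f.y) = B.proj (B.exit f).toPhase := by
  have hf := Ico_subset_Icc_self f.mem
  have hL : B.cyl f.k (1, f.y) = Quot.mk _ (B.rect f.k (1, f.y)) := by
    rw [cyl, B.wrap_eq_self f.mem]
  have hval := rect_val (B := B) (k := f.k) (x := 1) (by simp) hf
  rw [hL]
  by_cases h : f.y ∈ Ico (-(B.h (f.k + 1))) (B.h (f.k + 1))
  · unfold proj
    congr 1
    apply Subtype.ext
    rw [hval]
    refine Prod.ext ?_ (exit_y f).symm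
    change (f.k : ℝ) + 1 = ((B.exit f).k : ℝ)
    rw [exit_of_mem h, pt_k]; push_cast; ring
  · have hk : 0 ≤ f.k := by
      by_contra hk
      have h1 := h_le_succ (B := B) (not_le.1 hk)
      exact h ⟨by linarith [f.mem.1], by linarith [f.mem.2]⟩
    obtain ⟨n, hn⟩ := Int.eq_ofNat_of_zero_le hk
    unfold proj
    refine (Quot.sound (Glue.vertical n _ _ ?_ ?_ ?_ ?_)).symm
    · change ((B.exit f).k : ℝ) = _
      rw [exit_of_not_mem h, pt_k, hn]; push_cast; ring
    · rw [hval, hn]; push_cast; rfl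
    · rw [hval]; exact (exit_y f).symm
    · change |(B.exit f).y| ∈ _
      rw [exit_y]
      rw [hn] at hf h
      refine ⟨?_, abs_le.2 hf⟩
      by_contra hcon
      have := abs_lt.1 (not_le.1 hcon)
      exact h ⟨this.1.le, this.2⟩

lemma cyl_add_wrap (k : ℤ) (x y c : ℝ) : B.cyl k (x, B.wrap k y + c) = B.cyl k (x, y + c) := by
  unfold cyl
  rw [wrap_wrap_add]

/-- The flow over one rectangle, including its right side. -/
lemma proj_flow_toPhase {θ t : ℝ} {e : B.Edge} {n : ℤ}
    (h : t * Real.cos θ ∈ Icc (n : ℝ) (n + 1)) :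
    B.proj (B.flow θ t e.toPhase) = B.cyl ((B.step (Real.tan θ) ^ n) e).k
      (t * Real.cos θ - n, ((B.step (Real.tan θ) ^ n) e).y + Real.tan θ * (t * Real.cos θ - n)) := by
  rw [flow_toPhase, proj_along]
  rcases h.2.eq_or_lt with heq | hlt
  · have hfl : ⌊t * Real.cos θ⌋ = n + 1 := by
      rw [heq, ← Int.cast_one, ← Int.cast_add, Int.floor_intCast]
    have hfr : Int.fract (t * Real.cos θ) = 0 := by
      rw [heq, ← Int.cast_one, ← Int.cast_add, Int.fract_intCast]
    rw [hfl, hfr, heq, mul_zero, add_zero, add_sub_cancel_left, mul_one, ← proj_toPhase,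
      zpow_add_one_apply, step_apply, ← cyl_one, pt_k, pt_y]
    have := cyl_add_wrap (B := B) ((B.step (Real.tan θ) ^ n) e).k 1
      (((B.step (Real.tan θ) ^ n) e).y + Real.tan θ) 0
    rwa [add_zero, add_zero] at this
  · have hfl : ⌊t * Real.cos θ⌋ = n := Int.floor_eq_iff.2 ⟨h.1, hlt⟩
    have hfr : Int.fract (t * Real.cos θ) = t * Real.cos θ - n := by
      rw [← hfl, Int.self_sub_floor]
    rw [hfl, hfr]

/-- The flow, seen in the surface, is jointly continuous at a point of a vertical cross-section all
whose images under iterates of the step map are points of continuity. -/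
lemma continuousAt_flow {θ : ℝ} {y₀ : ℝ} {k₀ : ℤ}
    (h : ∀ n : ℤ, ∀ᶠ y in 𝓝 y₀, (B.step (Real.tan θ) ^ n) (B.pt k₀ y) =
      ((B.step (Real.tan θ) ^ n) (B.pt k₀ y₀)).tr (y - y₀)) (s₀ : ℝ) :
    ContinuousAt (fun q : ℝ × ℝ => B.proj (B.flow θ q.2 (B.pt k₀ q.1).toPhase)) (y₀, s₀) := by
  set c := Real.cos θ with hc
  have key : ∀ (n : ℤ) (s : Set (ℝ × ℝ)), (y₀, s₀) ∈ s →
      (∀ᶠ q : ℝ × ℝ in 𝓝[s] (y₀, s₀), q.2 * c ∈ Icc (n : ℝ) (n + 1)) →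
      ContinuousWithinAt (fun q : ℝ × ℝ => B.proj (B.flow θ q.2 (B.pt k₀ q.1).toPhase)) s
        (y₀, s₀) := by
    intro n s hs hn
    set f := (B.step (Real.tan θ) ^ n) (B.pt k₀ y₀) with hf
    have hcont : Continuous fun q : ℝ × ℝ => B.cyl f.k
        (q.2 * c - n, f.y + (q.1 - y₀) + Real.tan θ * (q.2 * c - n)) :=
      (continuous_cyl f.k).comp (by fun_prop)
    have hev : ∀ᶠ q : ℝ × ℝ in 𝓝[s] (y₀, s₀), B.proj (B.flow θ q.2 (B.pt k₀ q.1).toPhase) =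
        B.cyl f.k (q.2 * c - n, f.y + (q.1 - y₀) + Real.tan θ * (q.2 * c - n)) := by
      have h1 : ∀ᶠ q : ℝ × ℝ in 𝓝[s] (y₀, s₀), (B.step (Real.tan θ) ^ n) (B.pt k₀ q.1) =
          f.tr (q.1 - y₀) := nhdsWithin_le_nhds
        ((continuous_fst.tendsto (y₀, s₀)).eventually (h n))
      filter_upwards [hn, h1] with q hq1 hq2
      rw [proj_flow_toPhase hq1, hq2, tr_k]
      exact cyl_add_wrap f.k _ _ _
    exact hcont.continuousWithinAt.congr_of_eventuallyEq hev (hev.self_of_nhdsWithin hs)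
  have hunion : {q : ℝ × ℝ | s₀ * c ≤ q.2 * c} ∪ {q | q.2 * c ≤ s₀ * c} = univ :=
    eq_univ_of_forall fun q => le_total (s₀ * c) (q.2 * c)
  have ht : Tendsto (fun q : ℝ × ℝ => q.2 * c) (𝓝 (y₀, s₀)) (𝓝 (s₀ * c)) :=
    Continuous.tendsto (by fun_prop) (y₀, s₀)
  rw [← continuousWithinAt_univ, ← hunion]
  -- At an integer displacement two different rectangles are involved before and after;
  -- `proj_flow_toPhase` includes the right side of a rectangle, so both formulas are valid at the
  -- point itself.
  refine ContinuousWithinAt.union (key ⌊s₀ * c⌋ _ (le_refl (s₀ * c)) ?_)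
    (key (⌈s₀ * c⌉ - 1) _ (le_refl (s₀ * c)) ?_)
  · filter_upwards [self_mem_nhdsWithin,
      nhdsWithin_le_nhds (ht.eventually_lt_const (Int.lt_floor_add_one (s₀ * c)))] with q h1 h2
    exact ⟨(Int.floor_le _).trans h1, h2.le⟩
  · have h3 : ((⌈s₀ * c⌉ - 1 : ℤ) : ℝ) < s₀ * c := by
      have := Int.ceil_lt_add_one (s₀ * c)
      push_cast; linarith
    filter_upwards [self_mem_nhdsWithin,
      nhdsWithin_le_nhds (ht.eventually_const_lt h3)] with q h1 h2
    refine ⟨h2.le, ?_⟩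
    push_cast
    rw [sub_add_cancel]
    exact le_trans h1 (Int.le_ceil _)

lemma mk_eq_cyl (q : B.unfolded) {k : ℤ} {x : ℝ} (hx : x ∈ Icc (0 : ℝ) 1) (hX : q.1.1 = k + x)
    (hY : q.1.2 ∈ Icc (-(B.h k)) (B.h k)) : (Quot.mk _ q : B.Surface) = B.cyl k (x, q.1.2) := by
  have hq : q = B.rect k (x, q.1.2) :=
    Subtype.ext ((Prod.ext hX rfl : q.1 = ((k : ℝ) + x, q.1.2)).trans (rect_val hx hY).symm)
  have hq' : (Quot.mk _ q : B.Surface) = Quot.mk _ (B.rect k (x, q.1.2)) := congrArg _ hq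
  rw [hq']
  rcases hY.2.eq_or_lt with h | h
  · have h1 : B.wrap k (B.h k) = -B.h k := by
      have h2 := B.wrap_sub_zsmul k (B.h k) 1
      rw [← h2, B.wrap_eq_self] <;> [(push_cast; ring); skip]
      constructor <;> push_cast <;> linarith [B.h_pos k]
    rw [cyl, h, h1, mk_rect_neg]
  · rw [cyl, B.wrap_eq_self ⟨hY.1, h⟩]

lemma proj_surjective : Function.Surjective B.proj := by
  intro x
  induction x using Quot.ind with
  | mk q =>
    obtain ⟨k, hX, hY⟩ := q.2
    set X := q.1.1 with hXdef
    set Y := q.1.2 with hYdef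
    have hred : ∀ x ∈ Icc (0 : ℝ) 1, X = k + x → (Quot.mk _ q : B.Surface) = B.cyl k (x, Y) :=
      fun x hx hXx => mk_eq_cyl q hx hXx hY
    rcases hX.2.eq_or_lt with h | h
    · have h1 : B.cyl k (1, Y) = B.cyl (B.pt k Y).k (1, (B.pt k Y).y) := by
        rw [pt_k, pt_y]
        unfold cyl
        rw [B.wrap_eq_self (B.wrap_mem _ _)]
      exact ⟨_, by rw [hred 1 (by simp) h, h1, cyl_one]⟩
    · have hx : X - k ∈ Ico (0 : ℝ) 1 := ⟨by linarith [hX.1], by linarith⟩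
      refine ⟨B.along 0 (B.pt k Y) (X - k) hx, ?_⟩
      rw [proj_along, zero_mul, hred (X - k) ⟨hx.1, hx.2.le⟩ (by ring), pt_k, pt_y, cyl_add_wrap,
        add_zero]

/-! ### The closed curve `L` in the surface -/

variable (B) in
/-- The covering of the closed curve `L` by the real line. -/
def curve (y : ℝ) : B.Surface := B.proj (B.pt 0 y).toPhase

lemma curve_eq_cyl (y : ℝ) : B.curve y = B.cyl 0 (0, y) := by
  rw [curve, proj_toPhase, pt_k, pt_y]
  unfold cyl
  rw [B.wrap_eq_self (B.wrap_mem _ _)]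

lemma continuous_curve : Continuous B.curve := by
  have : B.curve = fun y => B.cyl 0 (0, y) := funext curve_eq_cyl
  rw [this]
  exact (continuous_cyl 0).comp (by fun_prop)

lemma curve_add_int (y : ℝ) (m : ℤ) : B.curve (y + 2 * m) = B.curve y := by
  unfold curve
  congr 2
  refine pt_eq_pt_iff.2 ⟨m, ?_⟩
  rw [h_zero]; ring

lemma image_section0 : B.proj '' B.section0 = range B.curve := by
  ext x
  constructor
  · rintro ⟨z, hz, rfl⟩
    exact ⟨z.Y, by rw [curve, ← mem_section0_iff.1 hz]⟩
  · rintro ⟨y, rfl⟩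
    exact ⟨_, by simp [section0], rfl⟩

/-- The right-hand condition is invariant under gluing. It makes preimages in the unfolded table
explicit, whence closedness in the quotient topology. -/
lemma mk_mem_image_curve_iff (S : Set ℝ) (q : B.unfolded) :
    (Quot.mk _ q : B.Surface) ∈ B.curve '' S ↔ q.1.1 = 0 ∧ ∃ m : ℤ, q.1.2 + 2 * m ∈ S := by
  have hresp : ∀ a b : B.unfolded, B.Glue a b → ((a.1.1 = 0 ∧ ∃ m : ℤ, a.1.2 + 2 * m ∈ S) ↔
      (b.1.1 = 0 ∧ ∃ m : ℤ, b.1.2 + 2 * m ∈ S)) := by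
    intro a b hab
    cases hab with
    | horizontal k _ _ hx hab ha hb =>
      rw [hab]
      refine and_congr_right fun h0 => ?_
      rw [h0] at hx
      have hk : k = 0 ∨ k = -1 := by
        have h1 : k ≤ 0 := by exact_mod_cast hx.1
        have h2 : 0 ≤ k + 1 := by exact_mod_cast hx.2
        omega
      have h1 : B.h k = 1 := by rcases hk with rfl | rfl <;> [exact h_zero; exact h_neg_one]
      rw [ha, hb, h1]
      constructor
      · rintro ⟨m, hm⟩
        refine ⟨m - 1, ?_⟩
        push_cast; convert hm using 1; ring
      · rintro ⟨m, hm⟩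
        refine ⟨m + 1, ?_⟩
        push_cast; convert hm using 1; ring
    | vertical n _ _ ha hb _ _ =>
      have h1 : (0 : ℝ) < (n : ℝ) + 1 := by positivity
      rw [ha, hb]
      exact iff_of_false (fun h => by linarith [h.1]) (fun h => by linarith [h.1])
  constructor
  · rintro ⟨y, hy, hq⟩
    have h1 := congrArg (Quot.lift (fun a : B.unfolded => a.1.1 = 0 ∧ ∃ m : ℤ, a.1.2 + 2 * m ∈ S)
      fun a b hab => propext (hresp a b hab)) hq
    have h2 : (((B.pt 0 y).k : ℤ) : ℝ) = 0 ∧ ∃ m : ℤ, (B.pt 0 y).y + 2 * m ∈ S := by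
      refine ⟨by simp, ?_⟩
      obtain ⟨m, hm⟩ := B.wrap_eq_sub 0 y
      refine ⟨m, ?_⟩
      rw [pt_y, hm, h_zero]
      convert hy using 1; ring
    exact h1.mp h2
  · rintro ⟨h0, m, hm⟩
    refine ⟨_, hm, ?_⟩
    have hY : q.1.2 ∈ Icc (-(B.h 0)) (B.h 0) := by
      obtain ⟨k, -, h2⟩ := q.2
      rw [h_zero]
      exact ⟨by linarith [h2.1, B.h_le_one k], by linarith [h2.2, B.h_le_one k]⟩
    rw [curve_add_int, curve_eq_cyl, mk_eq_cyl q (k := 0) (x := 0) (by simp) (by simpa using h0) hY]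

lemma curve_eq_curve_iff {y z : ℝ} : B.curve y = B.curve z ↔ ∃ m : ℤ, y + 2 * m = z := by
  constructor
  · intro h
    have h1 : B.curve y ∈ B.curve '' {z} := ⟨z, rfl, h.symm⟩
    obtain ⟨-, m, hm⟩ := (mk_mem_image_curve_iff _ _).1 h1
    obtain ⟨n, hn⟩ := B.wrap_eq_sub 0 y
    have h2 : B.wrap 0 y + 2 * m = z := hm
    refine ⟨m - n, ?_⟩
    rw [hn, h_zero] at h2
    push_cast; linarith
  · rintro ⟨m, rfl⟩
    exact (curve_add_int y m).symm

lemma isClosed_image_curve {S : Set ℝ} (h : IsClosed {y | ∃ m : ℤ, y + 2 * (m : ℝ) ∈ S}) :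
    IsClosed (B.curve '' S) := by
  rw [← isQuotientMap_quot_mk.isClosed_preimage]
  have : Quot.mk B.Glue ⁻¹' (B.curve '' S) =
      {q | q.1.1 = 0} ∩ (fun q : B.unfolded => q.1.2) ⁻¹' {y | ∃ m : ℤ, y + 2 * (m : ℝ) ∈ S} := by
    ext q
    exact mk_mem_image_curve_iff S q
  rw [this]
  refine IsClosed.inter (isClosed_eq (by fun_prop) continuous_const) (h.preimage (by fun_prop))

lemma isClosed_range_curve : IsClosed (range B.curve) := by
  rw [← image_univ]
  refine isClosed_image_curve ?_
  simp

lemma isCompact_range_curve : IsCompact (range B.curve) := by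
  have : range B.curve = B.curve '' Icc (-1) 1 := by
    apply Subset.antisymm
    · rintro _ ⟨y, rfl⟩
      refine ⟨(B.pt 0 y).y, ?_, ?_⟩
      · have := (B.pt 0 y).mem
        rw [pt_k, h_zero] at this
        exact Ico_subset_Icc_self this
      · unfold curve
        exact congrArg (fun e : B.Edge => B.proj e.toPhase) (pt_eta (B.pt 0 y))
    · exact image_subset_range _ _
  rw [this]
  exact isCompact_Icc.image continuous_curve

/-- Closures on `L` can be computed on the line: the closure of the lift is periodic, hence its
image is closed in the surface. -/
lemma curve_mem_closure_iff {A : Set B.Surface} (hA : A ⊆ range B.curve) {y : ℝ} :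
    B.curve y ∈ closure A ↔ y ∈ closure (B.curve ⁻¹' A) := by
  have hper : ∀ (z : ℝ) (m : ℤ), z ∈ closure (B.curve ⁻¹' A) →
      z + 2 * m ∈ closure (B.curve ⁻¹' A) := fun z m hz =>
    map_mem_closure (f := fun z => z + 2 * (m : ℝ)) (by fun_prop) hz fun w hw => by
      rw [mem_preimage, curve_add_int]; exact hw
  constructor
  · intro h
    have hcl : IsClosed (B.curve '' closure (B.curve ⁻¹' A)) := by
      refine isClosed_image_curve ?_
      convert isClosed_closure (s := B.curve ⁻¹' A) using 1
      ext z
      constructor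
      · rintro ⟨m, hm⟩
        have := hper _ (-m) hm
        push_cast at this
        convert this using 1; ring
      · exact fun hz => ⟨0, by simpa using hz⟩
    have hsub : A ⊆ B.curve '' closure (B.curve ⁻¹' A) := by
      intro x hx
      obtain ⟨z, rfl⟩ := hA hx
      exact ⟨z, subset_closure hx, rfl⟩
    obtain ⟨z, hz, hzy⟩ := closure_minimal hsub hcl h
    obtain ⟨m, rfl⟩ := curve_eq_curve_iff.1 hzy
    exact hper z m hz
  · exact fun h => map_mem_closure continuous_curve h fun z hz => hz

lemma isClosed_image_curve_Icc (u v : ℝ) : IsClosed (B.curve '' Icc u v) := by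
  refine isClosed_image_curve ?_
  have : Fact ((0 : ℝ) < 2) := ⟨two_pos⟩
  have h1 : IsClosed ((fun x : ℝ => (x : AddCircle (2 : ℝ))) '' Icc u v) :=
    (isCompact_Icc.image (AddCircle.continuous_mk' 2)).isClosed
  convert h1.preimage (AddCircle.continuous_mk' (2 : ℝ)) using 1
  ext y
  have hiff : ∀ x : ℝ, ((x : AddCircle (2 : ℝ)) = (y : AddCircle (2 : ℝ)) ↔
      ∃ m : ℤ, y + 2 * m = x) := by
    intro x
    rw [← sub_eq_zero, ← AddCircle.coe_sub, AddCircle.coe_eq_zero_iff]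
    refine exists_congr fun m => ?_
    rw [zsmul_eq_mul]
    constructor <;> intro h <;> linarith
  constructor
  · rintro ⟨m, hm⟩
    exact ⟨_, hm, (hiff _).2 ⟨m, rfl⟩⟩
  · rintro ⟨x, hx, hxy⟩
    obtain ⟨m, rfl⟩ := (hiff x).1 hxy
    exact ⟨m, hx⟩

/-! ### Regular points -/

lemma vertex_mem (j : ℤ) : ((|(j : ℝ)|, B.h j) : ℝ × ℝ) ∈ B.tableVertices ∧
    ((|(j : ℝ)|, B.h (j - 1)) : ℝ × ℝ) ∈ B.tableVertices := by
  rcases lt_or_ge j 0 with hj | hj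
  · obtain ⟨n, rfl⟩ : ∃ n : ℕ, j = -n - 1 := ⟨(-j - 1).toNat, by omega⟩
    have h1 : |((-n - 1 : ℤ) : ℝ)| = n + 1 := by
      push_cast
      rw [abs_of_nonpos (by linarith [(Nat.cast_nonneg n : (0 : ℝ) ≤ n)])]; ring
    rw [h1]
    refine ⟨Or.inr ⟨n, by rw [h_neg_natCast]⟩, Or.inl (Or.inr ⟨n + 1, ?_⟩)⟩
    rw [show (-(n : ℤ) - 1 - 1) = -((n + 1 : ℕ) : ℤ) - 1 by push_cast; ring, h_neg_natCast]
    push_cast; rfl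
  · obtain ⟨n, rfl⟩ := Int.eq_ofNat_of_zero_le hj
    have h1 : |((n : ℤ) : ℝ)| = n := by rw [Int.cast_natCast, Nat.abs_cast]
    rw [h1]
    refine ⟨Or.inl (Or.inr ⟨n, rfl⟩), ?_⟩
    rcases n with _ | n
    · exact Or.inl (Or.inr ⟨0, by simp [h_neg_one, B.p_zero]⟩)
    · refine Or.inr ⟨n, ?_⟩
      rw [show ((n + 1 : ℕ) : ℤ) - 1 = n by push_cast; ring, h_natCast]
      push_cast; rfl

lemma isVertex_toPhase {e : B.Edge} {j : ℤ} (hk : |(e.k : ℝ)| = |(j : ℝ)|)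
    (hy : |e.y| = B.h j ∨ |e.y| = B.h (j - 1)) : B.IsVertex e.toPhase := by
  change (|(e.k : ℝ)|, |e.y|) ∈ B.tableVertices
  rw [hk]
  rcases hy with hy | hy <;> rw [hy]
  · exact (vertex_mem j).1
  · exact (vertex_mem j).2

variable (B) in
/-- Edge points whose orbits under the step map meet no vertex. -/
def Regular (a : ℝ) (e : B.Edge) : Prop := ∀ n : ℤ, ¬ B.IsVertex ((B.step a ^ n) e).toPhase

lemma Regular.zpow {a : ℝ} {e : B.Edge} (h : B.Regular a e) (n : ℤ) :
    B.Regular a ((B.step a ^ n) e) := fun m => by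
  rw [zpow_zpow_apply]; exact h _

lemma isVertex_of_mem_cut {e : B.Edge} (h : e ∈ B.cut (· - 1)) : B.IsVertex e.toPhase := by
  refine isVertex_toPhase (j := e.k) rfl ?_
  rcases h with h | h | h <;> rw [h]
  · left; rw [abs_neg, abs_of_pos (B.h_pos _)]
  · right; rw [abs_neg, abs_of_pos (B.h_pos _)]
  · right; rw [abs_of_pos (B.h_pos _)]

lemma isVertex_step_of_mem_stepCut {a : ℝ} {e : B.Edge} (h : e ∈ B.stepCut a) :
    B.IsVertex (B.step a e).toPhase := by
  refine isVertex_toPhase (j := e.k + 1) ?_ ?_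
  · rcases step_k_cases a e with h | ⟨-, h⟩
    · rw [h]
    · rw [h, ← abs_neg]; push_cast; congr 1; ring
  · have hy : (B.step a e).y = (B.shift a e).y := exit_y _
    rw [hy, add_sub_cancel_right]
    have h' : (B.shift a e).y = -B.h e.k ∨ (B.shift a e).y = -B.h (e.k + 1) ∨
      (B.shift a e).y = B.h (e.k + 1) := h
    rcases h' with h | h | h <;> rw [h]
    · right; rw [abs_neg, abs_of_pos (B.h_pos _)]
    · left; rw [abs_neg, abs_of_pos (B.h_pos _)]
    · left; rw [abs_of_pos (B.h_pos _)]

lemma Regular.not_mem_stepCut {a : ℝ} {e : B.Edge} (h : B.Regular a e) (n : ℤ) :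
    (B.step a ^ n) e ∉ B.stepCut a := fun hn => by
  refine h (n + 1) ?_
  rw [zpow_add_one_apply]
  exact isVertex_step_of_mem_stepCut hn

lemma Regular.not_mem_cut {a : ℝ} {e : B.Edge} (h : B.Regular a e) (n : ℤ) :
    (B.step a ^ n) e ∉ B.cut (· - 1) := fun hn => h n (isVertex_of_mem_cut hn)

lemma Regular.mem_Ioo {a : ℝ} {e : B.Edge} (h : B.Regular a e) :
    e.y ∈ Ioo (-(B.h e.k)) (B.h e.k) :=
  ⟨lt_of_le_of_ne e.mem.1 fun hy => h.not_mem_cut 0 (Or.inl hy.symm), e.mem.2⟩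

lemma eventually_nhds_zero_of_two_sided {P : ℝ → Prop} {ε δ : ℝ} (hε : 0 < ε) (hδ : 0 < δ)
    (h1 : ∀ t ∈ Ico 0 ε, P t) (h2 : ∀ t ∈ Ico 0 δ, P (-t)) : ∀ᶠ t in 𝓝 0, P t := by
  filter_upwards [Ioo_mem_nhds (neg_lt_zero.2 hδ) hε] with t ht
  rcases le_total 0 t with h | h
  · exact h1 t ⟨h, ht.2⟩
  · have := h2 (-t) ⟨by linarith, by linarith [ht.1]⟩
    rwa [neg_neg] at this

/-- Iterates of the step map are local translations at regular points. -/
lemma Regular.eventually_zpow_tr {a : ℝ} {e : B.Edge} (h : B.Regular a e) (n : ℤ) :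
    ∀ᶠ t in 𝓝 (0 : ℝ), (B.step a ^ n) (e.tr t) = ((B.step a ^ n) e).tr t := by
  induction n using Int.induction_on with
  | zero => simp
  | succ n ih =>
    obtain ⟨ε, hε, h1⟩ := exists_step_tr a ((B.step a ^ (n : ℤ)) e)
    obtain ⟨δ, hδ, h2⟩ := exists_tr_neg_not_mem (finite_stepCut a) (h.not_mem_stepCut n)
    filter_upwards [ih, eventually_nhds_zero_of_two_sided hε hδ h1
      fun t ht => step_tr_neg h2 ht] with t h3 h4
    rw [zpow_add_one_apply, h3, h4, zpow_add_one_apply]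
  | pred n ih =>
    obtain ⟨ε, hε, h1⟩ := exists_symm_tr a ((B.step a ^ (-(n : ℤ))) e)
    obtain ⟨δ, hδ, h2⟩ := exists_tr_neg_not_mem (finite_cut _) (h.not_mem_cut (-n))
    filter_upwards [ih, eventually_nhds_zero_of_two_sided hε hδ h1
      fun t ht => symm_tr_neg h2 ht] with t h3 h4
    rw [zpow_sub_one_apply, h3, h4, zpow_sub_one_apply]

lemma Regular.zpow_mirror {a : ℝ} {e : B.Edge} (h : B.Regular a e) (n : ℤ) :
    (B.step a ^ n) e.mirror = ((B.step a ^ (-n)) e).mirror :=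
  StepBilliard.zpow_mirror n fun j _ => h.not_mem_stepCut j

/-- No regular orbit is symmetric under the rotation by a half turn. -/
lemma Regular.zpow_ne_mirror {a : ℝ} {e : B.Edge} (h : B.Regular a e) (n : ℤ) :
    (B.step a ^ n) e ≠ e.mirror := by
  intro hn
  -- The symmetry would reverse an orbit segment of length `n`. For even `n` the middle point is
  -- fixed by the half turn, so it is the origin, a vertex; for odd `n` the middle step would
  -- require `k = -k - 1`.
  have key : ∀ r : ℤ, (B.step a ^ (n - r)) e = ((B.step a ^ r) e).mirror := fun r => by
    have h1 := h.zpow_mirror (-r)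
    rw [← hn, zpow_zpow_apply, neg_neg] at h1
    rw [← h1]; congr 2; ring
  rcases Int.even_or_odd n with ⟨r, hr⟩ | ⟨r, hr⟩
  · have h1 := key r
    rw [hr, add_sub_cancel_right] at h1
    have hf := h.zpow r
    set f := (B.step a ^ r) e with hfdef
    have hm := hf.mem_Ioo
    have hneg : -f.y ∈ Ico (-(B.h (-f.k - 1))) (B.h (-f.k - 1)) := by
      rw [B.h_reflect]; exact ⟨by linarith [hm.2], by linarith [hm.1]⟩
    have hy : f.y = -f.y := by
      conv_lhs => rw [h1]
      rw [Edge.mirror, exit_y, pt_y_of_mem hneg]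
    have hy0 : f.y = 0 := by linarith
    have hk : f.k = 0 := by
      have h2 := congrArg Edge.k h1
      rw [Edge.mirror, exit_of_mem] at h2
      · rw [pt_k, pt_k] at h2; omega
      · rw [pt_y_of_mem hneg, hy0, neg_zero]
        exact ⟨by linarith [B.h_pos ((B.pt (-f.k - 1) 0).k + 1)], B.h_pos _⟩
    refine hf 0 ?_
    change (|(f.k : ℝ)|, |f.y|) ∈ B.tableVertices
    rw [hk, hy0]
    left; left; simp
  · have h1 := key r
    rw [show n - r = r + 1 by omega, zpow_add_one_apply, step_apply, Edge.mirror] at h1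
    have h2 := congrArg Edge.k (B.exit.injective h1)
    rw [pt_k, pt_k] at h2
    omega

/-! ### Horizontal excursions -/

lemma zpow_k_of_neg (a : ℝ) {e : B.Edge} {l : ℕ} (hl : e.k + l ≤ 0) :
    ((B.step a ^ (l : ℤ)) e).k = e.k + l := by
  induction l with
  | zero => simp
  | succ l ih =>
    push_cast at hl
    have h1 := ih (by omega)
    rw [zpow_succ_apply, step_k_of_neg a (by omega), h1]
    push_cast; ring

/-- Going backwards from far away, one first meets `L` in a point which moves directly to the
right. -/
lemma exists_direct_of_far {a : ℝ} {e : B.Edge} {n j : ℕ} (hfar : (n : ℤ) + 1 ≤ |e.k|)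
    (hj : ((B.step a ^ (-(j : ℤ))) e).k = 0) :
    ∃ i ≤ j, ((B.step a ^ (-(i : ℤ))) e).k = 0 ∧ Direct a n ((B.step a ^ (-(i : ℤ))) e) := by
  classical
  -- Invariant of the backward motion until `L` is met. On the far left one goes further left or
  -- jumps to `-k - 1 ≥ n`; on the right one recedes by one rectangle, and the way forward to `n`
  -- stays direct.
  let P : B.Edge → Prop := fun f => f.k ≤ -((n : ℤ) + 1) ∨
    (0 ≤ f.k ∧ ∀ i : ℕ, f.k + i ≤ n → ((B.step a ^ (i : ℤ)) f).k = f.k + i)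
  have hstep : ∀ f : B.Edge, P f → f.k ≠ 0 → P ((B.step a).symm f) := by
    rintro f (hf | ⟨hf0, hf⟩) hne
    · rcases symm_k_cases a f with h | ⟨-, h⟩
      · left; omega
      · right
        refine ⟨by omega, fun i hi => ?_⟩
        obtain rfl : i = 0 := by omega
        simp
    · right
      have h := symm_k_of_nonneg a hf0
      refine ⟨by omega, fun i hi => ?_⟩
      rcases i with _ | i
      · simp
      · rw [zpow_succ_apply', Equiv.apply_symm_apply, hf i (by push_cast at hi; omega), h]
        push_cast; ring
  have hex : ∃ i : ℕ, ((B.step a ^ (-(i : ℤ))) e).k = 0 := ⟨j, hj⟩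
  set i := Nat.find hex with hi
  have hi0 : ((B.step a ^ (-(i : ℤ))) e).k = 0 := Nat.find_spec hex
  have hP : ∀ l ≤ i, P ((B.step a ^ (-(l : ℤ))) e) := by
    intro l
    induction l with
    | zero =>
      intro _
      rw [Nat.cast_zero, neg_zero, zpow_zero, Equiv.Perm.one_apply]
      rcases abs_cases e.k with ⟨h, h'⟩ | ⟨h, -⟩
      · right
        refine ⟨h', fun i hi => ?_⟩
        omega
      · left; omega
    | succ l ih =>
      intro hl
      rw [show -((l + 1 : ℕ) : ℤ) = -(l : ℤ) - 1 by push_cast; ring, zpow_sub_one_apply]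
      exact hstep _ (ih (by omega)) (Nat.find_min hex (by omega))
  refine ⟨i, Nat.find_min' hex hj, hi0, ?_⟩
  rcases hP i le_rfl with h | ⟨-, h⟩
  · omega
  · intro l hl
    exact h l (by omega)

/-- Either an orbit visits `L` again and again in the future, or it escapes directly. -/
lemma frequently_zero_or_escape (a : ℝ) (e : B.Edge) :
    (∀ I : ℕ, ∃ i ≥ I, ((B.step a ^ (i : ℤ)) e).k = 0) ∨
      ∃ m : ℤ, ((B.step a ^ m) e).k = 0 ∧ ∀ i : ℕ, ((B.step a ^ (i : ℤ)) ((B.step a ^ m) e)).k = i := by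
  by_contra! hcon
  obtain ⟨⟨I, hI⟩, h2⟩ := hcon
  have hne : ∀ i : ℕ, ((B.step a ^ ((I : ℤ) + i)) e).k ≠ 0 := fun i => by
    have := hI (I + i) (by omega)
    rwa [Nat.cast_add] at this
  -- From a nonpositive index the orbit would run straight to `L`. Staying positive excludes every
  -- jump, so the index grows by one at each step.
  have hpos : ∀ i : ℕ, 0 < ((B.step a ^ ((I : ℤ) + i)) e).k := by
    intro i
    by_contra hneg
    set k := ((B.step a ^ ((I : ℤ) + i)) e).k with hk
    have hl := zpow_k_of_neg a (e := (B.step a ^ ((I : ℤ) + i)) e) (l := (-k).toNat) (by omega)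
    rw [zpow_zpow_apply] at hl
    refine hne (i + (-k).toNat) ?_
    rw [show (I : ℤ) + ((i + (-k).toNat : ℕ) : ℤ) = ((-k).toNat : ℤ) + (I + i) by push_cast; ring, hl]
    omega
  set k := ((B.step a ^ (I : ℤ)) e).k with hk
  have hlin : ∀ i : ℕ, ((B.step a ^ ((I : ℤ) + i)) e).k = k + i := by
    intro i
    induction i with
    | zero => simp [hk]
    | succ i ih =>
      have h3 := hpos (i + 1)
      have h4 := hpos i
      rw [Nat.cast_succ, ← add_assoc, zpow_add_one_apply] at h3 ⊢
      rcases step_k_cases a ((B.step a ^ ((I : ℤ) + i)) e) with h5 | ⟨-, h5⟩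
      · rw [h5, ih]; ring
      · omega
  have hk0 : 0 < k := by simpa [hk] using hpos 0
  have hback := symm_zpow_k a (e := (B.step a ^ (I : ℤ)) e) (i := k.toNat) (by omega)
  have hdir := direct_symm_zpow a (e := (B.step a ^ (I : ℤ)) e) (i := k.toNat) (by omega)
  rw [zpow_zpow_apply] at hback hdir
  obtain ⟨i, hi⟩ := h2 (-(k.toNat : ℤ) + I) (by omega)
  apply hi
  rcases le_total i k.toNat with h | h
  · rw [hdir i h, hback]; omega
  · rw [zpow_zpow_apply, show (i : ℤ) + (-(k.toNat : ℤ) + I) = I + ((i - k.toNat : ℕ) : ℤ) by omega,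
      hlin]
    omega

/-- Either an orbit visits `L` again and again in the past, or it escapes directly. -/
lemma frequently_zero_or_past_escape (a : ℝ) (e : B.Edge) :
    (∀ I : ℕ, ∃ i ≥ I, ((B.step a ^ (-(i : ℤ))) e).k = 0) ∨
      ∃ m : ℤ, ∀ i : ℕ, ((B.step a ^ (-(i : ℤ))) ((B.step a ^ m) e)).k = -i := by
  by_contra! hcon
  obtain ⟨⟨I, hI⟩, h2⟩ := hcon
  have hne : ∀ i : ℕ, ((B.step a ^ (-(I : ℤ) - i)) e).k ≠ 0 := fun i => by
    have := hI (I + i) (by omega)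
    rwa [Nat.cast_add, neg_add, ← sub_eq_add_neg] at this
  -- From a nonnegative index the backward orbit would run straight to `L`. Staying negative
  -- excludes jumps, so the index drops by one at each backward step.
  have hneg : ∀ i : ℕ, ((B.step a ^ (-(I : ℤ) - i)) e).k < 0 := by
    intro i
    by_contra hpos
    set k := ((B.step a ^ (-(I : ℤ) - i)) e).k with hk
    have hl := symm_zpow_k a (e := (B.step a ^ (-(I : ℤ) - i)) e) (i := k.toNat) (by omega)
    rw [zpow_zpow_apply] at hl
    refine hne (i + k.toNat) ?_
    rw [show -(I : ℤ) - ((i + k.toNat : ℕ) : ℤ) = -(k.toNat : ℤ) + (-(I : ℤ) - i) by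
      push_cast; ring, hl]
    omega
  set k := ((B.step a ^ (-(I : ℤ))) e).k with hk
  have hlin : ∀ i : ℕ, ((B.step a ^ (-(I : ℤ) - i)) e).k = k - i := by
    intro i
    induction i with
    | zero => simp [hk]
    | succ i ih =>
      have h3 := hneg (i + 1)
      have h4 := hneg i
      rw [Nat.cast_succ, ← sub_sub, zpow_sub_one_apply] at h3 ⊢
      rcases symm_k_cases a ((B.step a ^ (-(I : ℤ) - i)) e) with h5 | ⟨-, h5⟩
      · rw [h5, ih]; ring
      · omega
  have hk0 : k < 0 := by simpa [hk] using hneg 0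
  obtain ⟨i, hi⟩ := h2 (((-k).toNat : ℤ) + -I)
  apply hi
  rw [zpow_zpow_apply]
  rcases le_total i (-k).toNat with h | h
  · rw [show -(i : ℤ) + (((-k).toNat : ℤ) + -I) = (((-k).toNat - i : ℕ) : ℤ) + -I by omega,
      ← zpow_zpow_apply, zpow_k_of_neg a (by omega), ← hk]
    omega
  · rw [show -(i : ℤ) + (((-k).toNat : ℤ) + -I) = -(I : ℤ) - ((i - (-k).toNat : ℕ) : ℤ) by omega,
      hlin]
    omega

/-- Points which escape directly in the past are rotated limits of points which move directly to
the right. -/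
lemma eventually_direct_of_past_escape {a : ℝ} {g : B.Edge}
    (hg : ∀ i : ℕ, ((B.step a ^ (-(i : ℤ))) g).k = -i) (n : ℕ) :
    ∀ᶠ ε in 𝓝[>] (0 : ℝ), (B.pt 0 (-g.y - ε)).y = -g.y - ε ∧ Direct a n (B.pt 0 (-g.y - ε)) := by
  set ζ : ℕ → ℝ := fun i => ((B.step a ^ (-(i : ℤ))) g).y with hζ
  have hrec : ∀ i : ℕ, ζ i = B.wrap (-((i + 1 : ℕ) : ℤ)) (ζ (i + 1) + a) := by
    intro i
    have h1 := step_y a ((B.step a ^ (-((i + 1 : ℕ) : ℤ))) g)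
    rw [← zpow_add_one_apply, hg] at h1
    rw [← h1]
    simp only [hζ]
    congr 3; push_cast; ring
  have hh : ∀ i : ℕ, B.h (-((i + 1 : ℕ) : ℤ)) = B.p i := fun i => by
    rw [Nat.cast_succ, neg_add, ← sub_eq_add_neg, h_neg_natCast]
  have hmem : ∀ i : ℕ, ζ i ∈ Ico (-B.p i) (B.p i) := fun i => by
    rw [hrec, ← hh]; exact B.wrap_mem _ _
  -- Rotation may turn the allowed value `-p i` into the excluded `p i`. Lowering by a small `ε > 0`
  -- puts the first `n + 1` rotated points inside their half-open intervals.
  have hsmall : ∀ᶠ ε in 𝓝[>] (0 : ℝ), ∀ i ∈ {i : ℕ | i ≤ n}, ε < B.p i - ζ i := by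
    refine (eventually_all_finite (finite_le_nat n)).2 fun i _ => ?_
    filter_upwards [Ioo_mem_nhdsGT (sub_pos.2 (hmem i).2)] with ε hε using hε.2
  filter_upwards [hsmall, self_mem_nhdsWithin] with ε hε hε0
  have hε0' : 0 < ε := hε0
  have hin : ∀ i ≤ n, -ζ i - ε ∈ Ico (-(B.h (i : ℤ))) (B.h (i : ℤ)) := fun i hi => by
    have h1 := hε i hi
    rw [h_natCast]
    exact ⟨by linarith, by linarith [(hmem i).1]⟩
  have hz0 : ζ 0 = g.y := by simp only [hζ, Nat.cast_zero, neg_zero, zpow_zero]; rfl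
  have horb : ∀ i ≤ n, (B.step a ^ (i : ℤ)) (B.pt 0 (-g.y - ε)) = B.pt i (-ζ i - ε) := by
    intro i
    induction i with
    | zero => intro _; simp [hz0]
    | succ i ih =>
      intro hi
      have h1 := hin i (by omega)
      have h2 := hin (i + 1) hi
      obtain ⟨m, hm⟩ := B.wrap_eq_sub (-((i + 1 : ℕ) : ℤ)) (ζ (i + 1) + a)
      rw [← hrec, hh] at hm
      have h3 : B.pt (i : ℤ) (-ζ i - ε + a) = B.pt i (-ζ (i + 1) - ε) := by
        refine pt_eq_pt_iff.2 ⟨m, ?_⟩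
        rw [h_natCast, hm]; ring
      have hle : B.h (((i + 1 : ℕ) : ℤ)) ≤ B.h (i : ℤ) := B.p_anti (Nat.le_succ i)
      have h4 : (B.pt (i : ℤ) (-ζ (i + 1) - ε)).y = -ζ (i + 1) - ε :=
        pt_y_of_mem ⟨by linarith [h2.1], by linarith [h2.2]⟩
      rw [zpow_succ_apply, ih (by omega), step_apply, pt_k, pt_y_of_mem h1, h3, exit_of_mem]
      · rw [h4, pt_k]; congr 1
      · rw [h4, pt_k, ← Nat.cast_succ]; exact h2
  refine ⟨?_, fun i hi => by rw [horb i hi, pt_k, pt_k, zero_add]⟩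
  have := hin 0 (Nat.zero_le n)
  rw [hz0] at this
  exact pt_y_of_mem this

/-! ### The escape orbit of a typical direction -/

variable (B) in
/-- The unique point of `L` from which the future orbit escapes, in a typical direction. -/
structure IsSoleEscape (θ : ℝ) (e₀ : B.Edge) : Prop where
  k_zero : e₀.k = 0
  escape : ∀ i : ℕ, ((B.step (Real.tan θ) ^ (i : ℤ)) e₀).k = i
  unique : ∀ f : B.Edge, f.k = 0 → (∀ i : ℕ, ((B.step (Real.tan θ) ^ (i : ℤ)) f).k = i) → f = e₀
  regular : B.Regular (Real.tan θ) e₀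

/-- Uniqueness of the escape orbit gives uniqueness of the point on `L`, because a directly escaping
orbit never returns to `L` in the future. -/
lemma IsTypical.exists_isSoleEscape {θ : ℝ} (hc : 0 < Real.cos θ) (h : B.IsTypical θ) :
    ∃ e₀, B.IsSoleEscape θ e₀ ∧ ∀ η, B.IsEscapeOrbit θ η → η = B.orbit θ e₀.toPhase := by
  obtain ⟨O, ⟨z, hz, rfl⟩, huniq⟩ := h.existsUnique
  have hz0 : z = (B.pt 0 z.Y).toPhase := mem_section0_iff.1 (mem_iInter.1 hz 0).1
  set e₀ := B.pt 0 z.Y with he₀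
  rw [hz0] at hz huniq
  obtain ⟨h0, hesc⟩ := (mem_escapePoints_iff hc e₀).1 hz
  refine ⟨e₀, ⟨h0, hesc, fun f hf0 hf => ?_, fun n => ?_⟩, fun η hη => huniq η hη⟩
  · have h1 := huniq _ ⟨_, (mem_escapePoints_iff hc f).2 ⟨hf0, hf⟩, rfl⟩
    have h2 : f.toPhase ∈ B.orbit θ e₀.toPhase := h1 ▸ mem_orbit_self θ f.toPhase
    obtain ⟨t, ht⟩ := h2
    have h3 := congrArg (B.base (Real.tan θ)) ht
    simp only [base_flow, base_toPhase] at h3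
    set m := ⌊Int.fract e₀.toPhase.X + t * Real.cos θ⌋
    rcases le_total 0 m with hm | hm
    · obtain ⟨i, hi⟩ := Int.eq_ofNat_of_zero_le hm
      have h4 := hesc i
      rw [← hi, h3, hf0] at h4
      rw [← h3, ← h4, zpow_zero]; rfl
    · obtain ⟨i, hi⟩ := Int.eq_ofNat_of_zero_le (neg_nonneg.2 hm)
      have h4 := hf i
      rw [← hi, ← h3, zpow_zpow_apply, neg_add_cancel, zpow_zero, Equiv.Perm.one_apply, h0] at h4
      have hm0 : m = 0 := by omega
      rw [← h3, hm0, zpow_zero]; rfl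
  · refine h.noVertex _ ⟨_, hz, rfl⟩ _ ?_
    have := toPhase_mem_orbit hc.ne' n e₀.toPhase
    rwa [base_toPhase] at this

lemma IsSoleEscape.mem_Ioo {θ : ℝ} {e₀ : B.Edge} (h : B.IsSoleEscape θ e₀) :
    e₀.y ∈ Ioo (-1 : ℝ) 1 := by
  have := h.regular.mem_Ioo
  rwa [h.k_zero, h_zero] at this

lemma IsSoleEscape.eta {θ : ℝ} {e₀ : B.Edge} (h : B.IsSoleEscape θ e₀) : B.pt 0 e₀.y = e₀ := by
  rw [← h.k_zero, pt_eta]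

/-- The points which move directly to a far aperture are close to the escape point. -/
lemma IsTypical.exists_direct_close {θ : ℝ} (hc : 0 < Real.cos θ) (hT : B.IsTypical θ) {e₀ : B.Edge}
    (h : B.IsSoleEscape θ e₀) {ε : ℝ} (hε : 0 < ε) :
    ∃ N, ∀ f : B.Edge, f.k = 0 → Direct (Real.tan θ) N f → |f.y - e₀.y| < ε := by
  have hy := h.mem_Ioo
  obtain ⟨r, hr0, hrε, hr1, hr2⟩ : ∃ r > 0, r ≤ ε ∧ r ≤ 1 - e₀.y ∧ r ≤ 1 + e₀.y :=
    ⟨min ε (min (1 - e₀.y) (1 + e₀.y)),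
      lt_min hε (lt_min (by linarith [hy.2]) (by linarith [hy.1])), min_le_left _ _,
      (min_le_right _ _).trans (min_le_left _ _), (min_le_right _ _).trans (min_le_right _ _)⟩
  -- Neither neighbour at distance `r` is an escape point, so a far enough single interval, which
  -- contains `e₀`, misses both and is confined between them.
  have hnot : ∀ s : ℝ, |s| = r → ∃ n, ¬ Direct (Real.tan θ) n (B.pt 0 (e₀.y + s)) := by
    intro s hs
    by_contra! hcon
    have h1 := h.unique (B.pt 0 (e₀.y + s)) rfl fun i => by
      rw [hcon i i le_rfl, pt_k, zero_add]
    rw [← h.eta, pt_y_of_mem (k := 0) (by rw [h_zero]; exact ⟨hy.1.le, hy.2⟩)] at h1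
    obtain ⟨m, hm⟩ := pt_eq_pt_iff.1 h1
    rw [h_zero] at hm
    have hsm : s = 2 * m := by linarith
    have hs2 : |s| < 2 := by linarith [hy.1, hy.2]
    rw [hsm, abs_mul, abs_two] at hs hs2
    have : |m| < 1 := by
      have : |(m : ℝ)| < 1 := by linarith
      exact_mod_cast this
    rw [Int.abs_lt_one_iff] at this
    rw [this] at hs
    norm_num at hs
    linarith
  obtain ⟨n₁, hn₁⟩ := hnot r (abs_of_pos hr0)
  obtain ⟨n₂, hn₂⟩ := hnot (-r) (by rw [abs_neg, abs_of_pos hr0])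
  obtain ⟨N, hN, α, β, -, hS⟩ := frequently_atTop.1 hT.singleInterval (max n₁ n₂)
  have hmem : ∀ f : B.Edge, f.k = 0 → (Direct (Real.tan θ) N f ↔ ∃ m : ℤ, f.y + 2 * m ∈ Ico α β) := by
    intro f hf
    have h1 : f.toPhase ∈ B.reach θ N ↔ f.toPhase ∈ B.section0 ∧
      ∃ m : ℤ, f.toPhase.Y + 2 * m ∈ Ico α β := by rw [hS]; rfl
    rw [mem_reach_iff hc, toPhase_Y] at h1
    have h2 : f.toPhase ∈ B.section0 := by simp [section0, hf]
    tauto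
  have hpt : ∀ s : ℝ, (∃ m : ℤ, e₀.y + s + 2 * m ∈ Ico α β) →
      Direct (Real.tan θ) N (B.pt 0 (e₀.y + s)) := by
    rintro s ⟨m, hm⟩
    refine (hmem _ rfl).2 ?_
    obtain ⟨l, hl⟩ := B.wrap_eq_sub 0 (e₀.y + s)
    refine ⟨m + l, ?_⟩
    rw [pt_y, hl, h_zero]
    push_cast
    convert hm using 1; ring
  refine ⟨N, fun f hf hd => ?_⟩
  obtain ⟨m, hm⟩ := (hmem f hf).1 hd
  obtain ⟨m₀, hm₀⟩ := (hmem e₀ h.k_zero).1 fun i _ => by rw [h.escape, h.k_zero, zero_add]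
  have hup : f.y + 2 * m - (e₀.y + 2 * m₀) < r := by
    by_contra hcon
    refine hn₁ ((hpt r ⟨m₀, ?_, ?_⟩).mono (le_of_max_le_left hN))
    · linarith [hm₀.1]
    · linarith [hm.2]
  have hlo : -r < f.y + 2 * m - (e₀.y + 2 * m₀) := by
    by_contra hcon
    refine hn₂ ((hpt (-r) ⟨m₀, ?_, ?_⟩).mono (le_of_max_le_right hN))
    · linarith [hm.1]
    · linarith [hm₀.2]
  have hfm := f.mem
  rw [hf, h_zero] at hfm
  -- By the choice of `r` the window around `e₀.y` stays in `[-1, 1]`, so closeness on the circle is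
  -- closeness of the ordinates.
  have hmm : m = m₀ := by
    rcases lt_trichotomy m m₀ with hlt | heq | hlt
    · have : (m : ℝ) + 1 ≤ m₀ := by exact_mod_cast hlt
      linarith [hfm.2]
    · exact heq
    · have : (m₀ : ℝ) + 1 ≤ m := by exact_mod_cast hlt
      linarith [hfm.1]
  rw [hmm] at hup hlo
  rw [abs_lt]
  constructor <;> linarith

lemma IsSoleEscape.mirror_eq {θ : ℝ} {e₀ : B.Edge} (h : B.IsSoleEscape θ e₀) :
    e₀.mirror = B.pt 0 (-e₀.y) := by
  have hy := h.mem_Ioo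
  have h1 : (B.pt (-1) (-e₀.y)).y = -e₀.y := pt_y_of_mem (by
    rw [h_neg_one]; exact ⟨by linarith [hy.2], by linarith [hy.1]⟩)
  rw [Edge.mirror, h.k_zero, show -(0 : ℤ) - 1 = -1 by norm_num, exit_of_mem]
  · rw [h1, pt_k]; rfl
  · rw [h1, pt_k, show (-1 : ℤ) + 1 = 0 by norm_num, h_zero]
    exact ⟨by linarith [hy.2], by linarith [hy.1]⟩

lemma IsSoleEscape.mirror_k {θ : ℝ} {e₀ : B.Edge} (h : B.IsSoleEscape θ e₀) (i : ℕ) :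
    ((B.step (Real.tan θ) ^ (-(i : ℤ))) e₀.mirror).k = -i := by
  have h1 : ((B.step (Real.tan θ) ^ (i : ℤ)) e₀).k = i := h.escape i
  rw [h.regular.zpow_mirror, neg_neg]
  set f := (B.step (Real.tan θ) ^ (i : ℤ)) e₀
  have h2 : 0 < B.h f.k - f.y := sub_pos.2 f.mem.2
  rw [Edge.mirror]
  set q := B.pt (-f.k - 1) (-f.y) with hq
  have hqk : q.k = -i - 1 := by rw [hq, pt_k, h1]
  have h3 := h_le_succ (B := B) (k := q.k) (by omega)
  have h4 := q.mem
  rw [exit_of_mem ⟨by linarith [h4.1], by linarith [h4.2]⟩, pt_k, hqk]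
  ring

/-- The rotated point, lowered slightly, moves directly as far as desired, hence is close to `e₀`;
let the shift tend to zero. -/
lemma IsTypical.eq_mirror_of_past_escape {θ : ℝ} (hc : 0 < Real.cos θ) (hT : B.IsTypical θ)
    {e₀ g : B.Edge} (h : B.IsSoleEscape θ e₀)
    (hg : ∀ i : ℕ, ((B.step (Real.tan θ) ^ (-(i : ℤ))) g).k = -i) : g = e₀.mirror := by
  have hg0 : g.k = 0 := by simpa using hg 0
  have hy : g.y = -e₀.y := by
    by_contra hne
    have hpos : 0 < |g.y + e₀.y| := abs_pos.2 fun h0 => hne (by linarith)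
    obtain ⟨N, hN⟩ := hT.exists_direct_close hc h (half_pos hpos)
    obtain ⟨ε, ⟨h1, h2⟩, h3⟩ := ((eventually_direct_of_past_escape hg N).and
      (Ioo_mem_nhdsGT (half_pos hpos))).exists
    have h4 := hN _ rfl h2
    rw [h1] at h4
    have h5 : |g.y + e₀.y| ≤ |-g.y - ε - e₀.y| + |ε| := by
      rw [← abs_neg (g.y + e₀.y)]
      calc |-(g.y + e₀.y)| = |(-g.y - ε - e₀.y) + ε| := by congr 1; ring
        _ ≤ _ := abs_add_le _ _
    rw [abs_of_pos h3.1] at h5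
    linarith [h3.2]
  rw [h.mirror_eq, ← hy, ← hg0, pt_eta]

/-! ### Orbits in terms of the step map -/

lemma mem_orbit_toPhase_iff {θ : ℝ} (hc : Real.cos θ ≠ 0) {z : B.Phase} {e : B.Edge} :
    z ∈ B.orbit θ e.toPhase ↔ ∃ n : ℤ, (B.step (Real.tan θ) ^ n) (B.base (Real.tan θ) z) = e := by
  constructor
  · rintro ⟨t, rfl⟩
    refine ⟨-⌊Int.fract e.toPhase.X + t * Real.cos θ⌋, ?_⟩
    change (B.step (Real.tan θ) ^ _) (B.base (Real.tan θ) (B.flow θ t e.toPhase)) = e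
    rw [base_flow, base_toPhase, zpow_zpow_apply, neg_add_cancel, zpow_zero]
    rfl
  · rintro ⟨n, rfl⟩
    rw [orbit_eq_of_mem (toPhase_mem_orbit hc n z)]
    exact mem_orbit_self θ z

lemma toPhase_mem_orbit_iff {θ : ℝ} (hc : Real.cos θ ≠ 0) {f e : B.Edge} :
    f.toPhase ∈ B.orbit θ e.toPhase ↔ ∃ n : ℤ, (B.step (Real.tan θ) ^ n) e = f := by
  rw [mem_orbit_toPhase_iff hc, base_toPhase]
  constructor
  · rintro ⟨n, rfl⟩
    refine ⟨-n, ?_⟩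
    rw [zpow_zpow_apply, neg_add_cancel, zpow_zero]; rfl
  · rintro ⟨n, rfl⟩
    refine ⟨-n, ?_⟩
    rw [zpow_zpow_apply, neg_add_cancel, zpow_zero]; rfl

lemma flow_eq_toPhase {θ : ℝ} (hc : Real.cos θ ≠ 0) (n : ℤ) (z : B.Phase) :
    B.flow θ ((n - Int.fract z.X) / Real.cos θ) z =
      ((B.step (Real.tan θ) ^ n) (B.base (Real.tan θ) z)).toPhase := by
  conv_lhs => rw [← flow_base hc z]
  rw [flow_flow, flow_base hc z, ← flow_int_toPhase hc]
  congr 1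
  ring

lemma lt_abs_k_add_one {a M : ℝ} {z : B.Phase} (h : M < |z.X|) :
    M < |((B.base a z).k : ℝ)| + 1 := by
  have h1 := abs_X_sub_le a z
  have h2 := abs_sub_abs_le_abs_sub z.X (B.base a z).k
  linarith

lemma IsTypical.exists_far_future {θ : ℝ} (hc : 0 < Real.cos θ) (hT : B.IsTypical θ) (e : B.Edge)
    (n : ℕ) : ∃ i : ℕ, (n : ℤ) + 1 ≤ |((B.step (Real.tan θ) ^ (i : ℤ)) e).k| := by
  obtain ⟨t, ht, h⟩ := hT.unboundedInFuture e.toPhase (n + 1)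
  have h1 := lt_abs_k_add_one (a := Real.tan θ) h
  rw [base_flow, base_toPhase, toPhase_X, Int.fract_intCast, zero_add] at h1
  have h2 : 0 ≤ ⌊t * Real.cos θ⌋ := Int.floor_nonneg.2 (by positivity)
  obtain ⟨i, hi⟩ := Int.eq_ofNat_of_zero_le h2
  rw [hi] at h1
  refine ⟨i, ?_⟩
  have h3 : ((n : ℤ) : ℝ) < ((|((B.step (Real.tan θ) ^ (i : ℤ)) e).k| : ℤ) : ℝ) := by
    push_cast; linarith
  exact_mod_cast h3

lemma IsTypical.exists_far_past {θ : ℝ} (hc : 0 < Real.cos θ) (hT : B.IsTypical θ) (e : B.Edge)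
    (n : ℕ) : ∃ i : ℕ, (n : ℤ) + 1 ≤ |((B.step (Real.tan θ) ^ (-(i : ℤ))) e).k| := by
  obtain ⟨t, ht, h⟩ := hT.unboundedInPast e.toPhase (n + 1)
  have h1 := lt_abs_k_add_one (a := Real.tan θ) h
  rw [base_flow, base_toPhase, toPhase_X, Int.fract_intCast, zero_add] at h1
  have h2 : ⌊t * Real.cos θ⌋ ≤ 0 := by
    rw [← Int.cast_le (R := ℝ), Int.cast_zero]
    exact (Int.floor_le _).trans (mul_nonpos_of_nonpos_of_nonneg ht hc.le)
  obtain ⟨i, hi⟩ := Int.eq_ofNat_of_zero_le (neg_nonneg.2 h2)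
  rw [neg_eq_iff_eq_neg] at hi
  rw [hi] at h1
  refine ⟨i, ?_⟩
  have h3 : ((n : ℤ) : ℝ) < ((|((B.step (Real.tan θ) ^ (-(i : ℤ))) e).k| : ℤ) : ℝ) := by
    push_cast; linarith
  exact_mod_cast h3

/-- Escape excludes infinitely many past visits to `L`, so the orbit passes through a point escaping
directly in the past, and that point is unique. Conversely, the index along the past of `e₀.mirror`
is exactly `-i`. -/
lemma IsTypical.escapesInPast_iff {θ : ℝ} (hc : 0 < Real.cos θ) (hT : B.IsTypical θ) {e₀ : B.Edge}
    (h : B.IsSoleEscape θ e₀) {z : B.Phase} : B.EscapesInPast θ z ↔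
      ∃ n : ℤ, (B.step (Real.tan θ) ^ n) (B.base (Real.tan θ) z) = e₀.mirror := by
  constructor
  · intro hz
    rcases frequently_zero_or_past_escape (Real.tan θ) (B.base (Real.tan θ) z) with h1 | ⟨m, hm⟩
    · exfalso
      obtain ⟨t, ht⟩ := eventually_atBot.1 (hz.eventually (eventually_ge_atTop 2))
      obtain ⟨I, hI⟩ := exists_nat_ge (-t * Real.cos θ)
      obtain ⟨i, hi, hi0⟩ := h1 I
      have h2 : ((-(i : ℤ) : ℤ) : ℝ) / Real.cos θ ≤ t := by
        rw [div_le_iff₀ hc]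
        have : (I : ℝ) ≤ i := by exact_mod_cast hi
        push_cast; linarith
      have h3 := abs_X_sub_le (Real.tan θ) (B.flow θ (((-(i : ℤ) : ℤ) : ℝ) / Real.cos θ) z)
      rw [base_flow_int hc.ne', hi0, Int.cast_zero, sub_zero] at h3
      linarith [ht _ h2]
    · exact ⟨m, hT.eq_mirror_of_past_escape hc h hm⟩
  · rintro ⟨n, hn⟩
    refine tendsto_atTop.2 fun M => ?_
    filter_upwards [eventually_le_atBot ((n - 1) / Real.cos θ),
      eventually_le_atBot ((n - 2 - M) / Real.cos θ)] with t h1 h2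
    rw [le_div_iff₀ hc] at h1 h2
    have h3 := abs_X_sub_le (Real.tan θ) (B.flow θ t z)
    rw [base_flow] at h3
    have hf := Int.floor_le (Int.fract z.X + t * Real.cos θ)
    have hlt := Int.fract_lt_one z.X
    set j := ⌊Int.fract z.X + t * Real.cos θ⌋ with hj
    have hjn : j ≤ n := by
      rw [← Int.cast_le (R := ℝ)]; linarith
    obtain ⟨i, hi⟩ := Int.eq_ofNat_of_zero_le (sub_nonneg.2 hjn)
    have h4 : (B.step (Real.tan θ) ^ j) (B.base (Real.tan θ) z) =
        (B.step (Real.tan θ) ^ (-(i : ℤ))) e₀.mirror := by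
      rw [← hn, zpow_zpow_apply]; congr 2; omega
    rw [h4, h.mirror_k] at h3
    have h5 : (i : ℝ) = n - j := by
      have : ((i : ℤ) : ℝ) = ((n - j : ℤ) : ℝ) := by rw [hi]
      push_cast at this; exact this
    have h6 := abs_le.1 h3
    push_cast at h6
    have h7 := neg_abs_le (B.flow θ t z).X
    linarith [h6.2]

/-! ### Approaching the escape orbit -/

/-- After a visit to `L` the orbit goes far out; the last visit before that moves directly far, so
it is close to `e₀`, and it is not earlier than the visit chosen. -/
lemma IsTypical.exists_return_future {θ : ℝ} (hc : 0 < Real.cos θ) (hT : B.IsTypical θ)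
    {e₀ : B.Edge} (h : B.IsSoleEscape θ e₀) {e : B.Edge}
    (he : ∀ n : ℤ, (B.step (Real.tan θ) ^ n) e ≠ e₀) {ε : ℝ} (hε : 0 < ε) (I : ℕ) :
    ∃ i : ℕ, I ≤ i ∧ ((B.step (Real.tan θ) ^ (i : ℤ)) e).k = 0 ∧
      |((B.step (Real.tan θ) ^ (i : ℤ)) e).y - e₀.y| < ε := by
  obtain ⟨N, hN⟩ := hT.exists_direct_close hc h hε
  rcases frequently_zero_or_escape (Real.tan θ) e with h1 | ⟨m, hm0, hm⟩
  · obtain ⟨i₁, hi₁, h0⟩ := h1 I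
    obtain ⟨i₂, hi₂⟩ := hT.exists_far_future hc ((B.step (Real.tan θ) ^ (i₁ : ℤ)) e) N
    obtain ⟨i, hi, hk, hd⟩ := exists_direct_of_far (j := i₂) hi₂ (by
      rwa [zpow_zpow_apply, neg_add_cancel, zpow_zero])
    have h2 : (B.step (Real.tan θ) ^ (-(i : ℤ))) ((B.step (Real.tan θ) ^ (i₂ : ℤ))
        ((B.step (Real.tan θ) ^ (i₁ : ℤ)) e)) =
        (B.step (Real.tan θ) ^ ((i₁ + (i₂ - i) : ℕ) : ℤ)) e := by
      rw [zpow_zpow_apply, zpow_zpow_apply]; congr 2; omega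
    rw [h2] at hk hd
    exact ⟨_, by omega, hk, hN _ hk hd⟩
  · exact absurd (h.unique _ hm0 hm) (he m)

/-- Start from a far point in the past and go back to the next meeting with `L`, which exists unless
the orbit escapes in the past. -/
lemma IsTypical.exists_return_past {θ : ℝ} (hc : 0 < Real.cos θ) (hT : B.IsTypical θ)
    {e₀ : B.Edge} (h : B.IsSoleEscape θ e₀) {e : B.Edge}
    (he : ∀ n : ℤ, (B.step (Real.tan θ) ^ n) e ≠ e₀.mirror) {ε : ℝ} (hε : 0 < ε) (I : ℕ) :
    ∃ i : ℕ, I ≤ i ∧ ((B.step (Real.tan θ) ^ (-(i : ℤ))) e).k = 0 ∧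
      |((B.step (Real.tan θ) ^ (-(i : ℤ))) e).y - e₀.y| < ε := by
  obtain ⟨N, hN⟩ := hT.exists_direct_close hc h hε
  rcases frequently_zero_or_past_escape (Real.tan θ) e with h1 | ⟨m, hm⟩
  · obtain ⟨i₂, hi₂⟩ := hT.exists_far_past hc ((B.step (Real.tan θ) ^ (-(I : ℤ))) e) N
    obtain ⟨j, hj, h0⟩ := h1 (I + i₂)
    obtain ⟨i, hi, hk, hd⟩ := exists_direct_of_far (j := j - I - i₂) hi₂ (by
      rw [zpow_zpow_apply, zpow_zpow_apply, ← h0]; congr 3; omega)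
    have h2 : (B.step (Real.tan θ) ^ (-(i : ℤ))) ((B.step (Real.tan θ) ^ (-(i₂ : ℤ)))
        ((B.step (Real.tan θ) ^ (-(I : ℤ))) e)) =
        (B.step (Real.tan θ) ^ (-((I + i₂ + i : ℕ) : ℤ))) e := by
      rw [zpow_zpow_apply, zpow_zpow_apply]; congr 2; omega
    rw [h2] at hk hd
    exact ⟨_, by omega, hk, hN _ hk hd⟩
  · exact absurd (hT.eq_mirror_of_past_escape hc h hm) (he m)

variable (B) in
/-- The orbit of `z` passes close to the point of `L` at height `y₀`, frequently along `l`. -/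
def Approaches (θ : ℝ) (l : Filter ℝ) (y₀ : ℝ) (z : B.Phase) : Prop :=
  ∀ ε > 0, ∃ᶠ t in l, ∃ y : ℝ, |y - y₀| < ε ∧ B.flow θ t z = (B.pt 0 y).toPhase

lemma IsTypical.approaches_future {θ : ℝ} (hc : 0 < Real.cos θ) (hT : B.IsTypical θ)
    {e₀ : B.Edge} (h : B.IsSoleEscape θ e₀) {z : B.Phase} (hz : z ∉ B.orbit θ e₀.toPhase) :
    B.Approaches θ atTop e₀.y z := by
  intro ε hε
  rw [mem_orbit_toPhase_iff hc.ne', not_exists] at hz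
  refine frequently_atTop.2 fun R => ?_
  obtain ⟨I, hI⟩ := exists_nat_ge (R * Real.cos θ + 1)
  obtain ⟨i, hi, hk, hy⟩ := hT.exists_return_future hc h hz hε I
  refine ⟨((i : ℤ) - Int.fract z.X) / Real.cos θ, ?_, _, hy, ?_⟩
  · rw [le_div_iff₀ hc]
    have : (I : ℝ) ≤ i := by exact_mod_cast hi
    push_cast
    linarith [Int.fract_lt_one z.X]
  · rw [flow_eq_toPhase hc.ne']
    congr 1
    rw [← hk, pt_eta]

lemma IsTypical.approaches_past {θ : ℝ} (hc : 0 < Real.cos θ) (hT : B.IsTypical θ)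
    {e₀ : B.Edge} (h : B.IsSoleEscape θ e₀) {z : B.Phase} (hz : ¬ B.EscapesInPast θ z) :
    B.Approaches θ atBot e₀.y z := by
  intro ε hε
  rw [hT.escapesInPast_iff hc h, not_exists] at hz
  refine frequently_atBot.2 fun R => ?_
  obtain ⟨I, hI⟩ := exists_nat_ge (-R * Real.cos θ)
  obtain ⟨i, hi, hk, hy⟩ := hT.exists_return_past hc h hz hε I
  refine ⟨((-(i : ℤ) : ℤ) - Int.fract z.X) / Real.cos θ, ?_, _, hy, ?_⟩
  · rw [div_le_iff₀ hc]
    have : (I : ℝ) ≤ i := by exact_mod_cast hi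
    push_cast
    linarith [Int.fract_nonneg z.X]
  · rw [flow_eq_toPhase hc.ne']
    congr 1
    rw [← hk, pt_eta]

lemma IsSoleEscape.continuousAt_flow {θ : ℝ} {e₀ : B.Edge} (h : B.IsSoleEscape θ e₀) (s : ℝ) :
    ContinuousAt (fun q : ℝ × ℝ => B.proj (B.flow θ q.2 (B.pt 0 q.1).toPhase)) (e₀.y, s) := by
  refine StepBilliard.continuousAt_flow (fun n => ?_) s
  rw [h.eta]
  have h1 : Tendsto (fun y : ℝ => y - e₀.y) (𝓝 e₀.y) (𝓝 0) := by
    have : Continuous fun y : ℝ => y - e₀.y := by fun_prop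
    simpa using this.tendsto e₀.y
  filter_upwards [h1.eventually (h.regular.eventually_zpow_tr n)] with y hy
  rw [← hy, ← h.eta, pt_tr, h.eta, add_sub_cancel]

/-- Orbits which pass close to the escape point shadow the escape orbit. -/
lemma IsSoleEscape.shadow {θ : ℝ} {e₀ : B.Edge} (h : B.IsSoleEscape θ e₀)
    {W : Set (B.Surface × B.Surface)} (hW : IsOpen W) (hd : ∀ x, (x, x) ∈ W) {K : Set ℝ}
    (hK : IsCompact K) : ∃ ε > 0, ∀ y, |y - e₀.y| < ε → ∀ s ∈ K,
      (B.proj (B.flow θ s (B.pt 0 y).toPhase), B.proj (B.flow θ s e₀.toPhase)) ∈ W := by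
  have h1 : ∀ᶠ y in 𝓝 e₀.y, ∀ s ∈ K,
      (B.proj (B.flow θ s (B.pt 0 y).toPhase), B.proj (B.flow θ s e₀.toPhase)) ∈ W := by
    -- Tube argument: joint continuity at each `(e₀.y, s)` and compactness of `K` give one
    -- neighbourhood valid for all `s ∈ K`.
    refine hK.eventually_forall_of_forall_eventually fun s _ => ?_
    have h2 := h.continuousAt_flow s
    have h3 : ContinuousAt (fun q : ℝ × ℝ => B.proj (B.flow θ q.2 e₀.toPhase)) (e₀.y, s) := by
      have h4 : ContinuousAt (fun q : ℝ × ℝ => (e₀.y, q.2)) (e₀.y, s) :=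
        (continuous_const.prodMk continuous_snd).continuousAt
      have h5 := ContinuousAt.comp_of_eq h2 h4 rfl
      simpa only [Function.comp_def, h.eta] using h5
    refine (h2.prodMk h3).eventually (hW.mem_nhds ?_)
    simp only [h.eta]
    exact hd _
  obtain ⟨ε, hε, h2⟩ := Metric.eventually_nhds_iff.1 h1
  exact ⟨ε, hε, fun y hy => h2 hy⟩

/-- If `w` is `e₀` flowed for time `u`, an approach to `e₀` at time `t` serves for `w` at time `t +
u`; hence the invariance of `l` under translations. -/
lemma Approaches.shadow {θ : ℝ} {l : Filter ℝ} {e₀ : B.Edge} (h : B.IsSoleEscape θ e₀)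
    {z w : B.Phase} (hz : B.Approaches θ l e₀.y z) (hw : w ∈ B.orbit θ e₀.toPhase)
    {W : Set (B.Surface × B.Surface)} (hW : IsOpen W) (hd : ∀ x, (x, x) ∈ W)
    (hl : ∀ u : ℝ, Tendsto (· + u) l l) (T : ℝ) :
    ∃ᶠ t in l, ∀ s ∈ Icc (-T) T,
      (B.proj (B.flow θ (t + s) z), B.proj (B.flow θ s w)) ∈ W := by
  obtain ⟨u, rfl⟩ := hw
  obtain ⟨ε, hε, h1⟩ := h.shadow hW hd (isCompact_Icc (a := u - T) (b := u + T))
  refine (hl u).frequently ((hz ε hε).mono ?_)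
  rintro t ⟨y, hy, ht⟩ s hs
  have h2 := h1 y hy (u + s) ⟨by linarith [hs.1], by linarith [hs.2]⟩
  rwa [← ht, flow_flow, ← add_assoc, ← flow_flow θ s u e₀.toPhase] at h2

lemma Approaches.subset_omegaLimit {θ : ℝ} {l : Filter ℝ} {e₀ : B.Edge} (h : B.IsSoleEscape θ e₀)
    {z : B.Phase} (hz : B.Approaches θ l e₀.y z) (hl : ∀ u : ℝ, Tendsto (· + u) l l) :
    B.proj '' B.orbit θ e₀.toPhase ⊆
      omegaLimit l (fun t w => B.proj (B.flow θ t w)) {z} := by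
  rintro _ ⟨_, ⟨u, rfl⟩, rfl⟩
  rw [mem_omegaLimit_singleton_iff_mapClusterPt, mapClusterPt_iff_frequently]
  intro U hU
  have h1 : ContinuousAt (fun y : ℝ => B.proj (B.flow θ u (B.pt 0 y).toPhase)) e₀.y :=
    ContinuousAt.comp (g := fun q : ℝ × ℝ => B.proj (B.flow θ q.2 (B.pt 0 q.1).toPhase))
      (f := fun y => (y, u)) (h.continuousAt_flow u) (by fun_prop)
  have hU' : U ∈ 𝓝 (B.proj (B.flow θ u (B.pt 0 e₀.y).toPhase)) := by rwa [h.eta]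
  obtain ⟨ε, hε, h2⟩ := Metric.eventually_nhds_iff.1 (h1.eventually hU')
  refine (hl u).frequently ((hz ε hε).mono ?_)
  rintro t ⟨y, hy, ht⟩
  have h3 := h2 (y := y) hy
  rwa [← ht, flow_flow] at h3

lemma tendsto_add_atTop (u : ℝ) : Tendsto (· + u) atTop (atTop : Filter ℝ) :=
  tendsto_atTop_add_const_right _ _ tendsto_id

lemma tendsto_add_atBot (u : ℝ) : Tendsto (· + u) atBot (atBot : Filter ℝ) :=
  tendsto_atBot_add_const_right _ _ tendsto_id

/-! ### Oscillation, orbit closures, invariant functions and minimality -/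

lemma omegaLim_subset_closure (θ : ℝ) (z : B.Phase) :
    B.omegaLim θ z ⊆ closure (B.proj '' B.orbit θ z) := by
  refine (omegaLimit_subset_closure_image2 _ _ _ univ_mem).trans (closure_mono ?_)
  rintro _ ⟨t, -, w, rfl, rfl⟩
  exact ⟨_, ⟨t, rfl⟩, rfl⟩

lemma IsTypical.subset_omegaLim {θ : ℝ} (hc : 0 < Real.cos θ) (hT : B.IsTypical θ)
    {e₀ : B.Edge} (h : B.IsSoleEscape θ e₀) {z : B.Phase} (hz : z ∉ B.orbit θ e₀.toPhase) :
    B.proj '' B.orbit θ e₀.toPhase ⊆ B.omegaLim θ z :=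
  (hT.approaches_future hc h hz).subset_omegaLimit h tendsto_add_atTop

lemma IsTypical.subset_closure_orbit {θ : ℝ} (hc : 0 < Real.cos θ) (hT : B.IsTypical θ)
    {e₀ : B.Edge} (h : B.IsSoleEscape θ e₀) (z : B.Phase) :
    B.proj '' B.orbit θ e₀.toPhase ⊆ closure (B.proj '' B.orbit θ z) := by
  by_cases hz : z ∈ B.orbit θ e₀.toPhase
  · rw [orbit_eq_of_mem hz]; exact subset_closure
  · exact (hT.subset_omegaLim hc h hz).trans (omegaLim_subset_closure θ z)

/-- Escape in the past would put `e₀` and `e₀.mirror` on one orbit, against the asymmetry of regular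
orbits. -/
lemma IsTypical.oscillatesInPast {θ : ℝ} (hc : 0 < Real.cos θ) (hT : B.IsTypical θ)
    {e₀ : B.Edge} (h : B.IsSoleEscape θ e₀) {z : B.Phase} (hz : z ∈ B.orbit θ e₀.toPhase) :
    B.OscillatesInPast θ z := by
  refine ⟨hT.unboundedInPast z, fun hesc => ?_⟩
  obtain ⟨n, hn⟩ := (hT.escapesInPast_iff hc h).1 hesc
  obtain ⟨m, hm⟩ := (mem_orbit_toPhase_iff hc.ne').1 hz
  refine h.regular.zpow_ne_mirror (n - m) ?_
  rw [← hn, ← hm, zpow_zpow_apply, sub_add_cancel]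

lemma IsTypical.setOf_escapesInPast {θ : ℝ} (hc : 0 < Real.cos θ) (hT : B.IsTypical θ)
    {e₀ : B.Edge} (h : B.IsSoleEscape θ e₀) :
    {z | B.EscapesInPast θ z} = B.orbit θ e₀.mirror.toPhase := by
  ext z
  rw [mem_orbit_toPhase_iff hc.ne', ← hT.escapesInPast_iff hc h]
  exact Iff.rfl

/-- An invariant continuous function is constant on orbit closures, and all of these contain `e₀`.
-/
lemma IsTypical.eq_const_of_invariant {θ : ℝ} (hc : 0 < Real.cos θ) (hT : B.IsTypical θ)
    {e₀ : B.Edge} (h : B.IsSoleEscape θ e₀) {f : B.Surface → ℝ} (hf : Continuous f)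
    (hinv : ∀ t z, f (B.proj (B.flow θ t z)) = f (B.proj z)) : ∃ c, ∀ x, f x = c := by
  refine ⟨f (B.proj e₀.toPhase), fun x => ?_⟩
  obtain ⟨z, rfl⟩ := proj_surjective x
  have h1 : closure (B.proj '' B.orbit θ z) ⊆ {x | f x = f (B.proj z)} := by
    refine closure_minimal ?_ (isClosed_eq hf continuous_const)
    rintro _ ⟨_, ⟨t, rfl⟩, rfl⟩
    exact hinv t z
  exact (h1 (hT.subset_closure_orbit hc h z ⟨_, mem_orbit_self θ _, rfl⟩)).symm

lemma IsTypical.isMinimalFlow_iff {θ : ℝ} (hc : 0 < Real.cos θ) (hT : B.IsTypical θ)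
    {e₀ : B.Edge} (h : B.IsSoleEscape θ e₀) :
    B.IsMinimalFlow θ ↔ Dense (B.proj '' B.orbit θ e₀.toPhase) := by
  refine ⟨fun hm => hm _, fun hd z => ?_⟩
  rw [← dense_closure]
  exact hd.mono (hT.subset_closure_orbit hc h z)

/-! ### The trace of the escape orbit on `L` -/

variable (B) in
/-- The trace on `L` of the orbit of `e`. -/
def trace (θ : ℝ) (e : B.Edge) : Set B.Surface := B.proj '' (B.orbit θ e.toPhase ∩ B.section0)

lemma trace_subset_range_curve (θ : ℝ) (e : B.Edge) : B.trace θ e ⊆ range B.curve := by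
  rw [← image_section0]
  exact image_mono inter_subset_right

lemma curve_mem_trace_iff {θ : ℝ} (hc : Real.cos θ ≠ 0) {e : B.Edge} {y : ℝ} :
    B.curve y ∈ B.trace θ e ↔ ∃ n : ℤ, (B.step (Real.tan θ) ^ n) e = B.pt 0 y := by
  rw [← toPhase_mem_orbit_iff hc]
  constructor
  · rintro ⟨z, ⟨hz, hz0⟩, h⟩
    have h1 := mem_section0_iff.1 hz0
    have h2 : B.curve z.Y = B.curve y := by
      rw [← h, curve, ← h1]
    obtain ⟨m, hm⟩ := curve_eq_curve_iff.1 h2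
    have h3 : B.pt 0 y = B.pt 0 z.Y := pt_eq_pt_iff.2 ⟨m, by rw [h_zero, ← hm]; ring⟩
    rwa [h3, ← h1]
  · intro h
    exact ⟨_, ⟨h, by simp [section0]⟩, rfl⟩

/-- The returns are taken in the past, where the escape orbit oscillates. A return exactly to `e₀`
would make the orbit periodic, contradicting its escape. -/
lemma IsTypical.frequently_return {θ : ℝ} (hc : 0 < Real.cos θ) (hT : B.IsTypical θ)
    {e₀ : B.Edge} (h : B.IsSoleEscape θ e₀) :
    ∃ᶠ t in 𝓝 (0 : ℝ), t ≠ 0 ∧ ∃ n : ℤ, (B.step (Real.tan θ) ^ n) e₀ = e₀.tr t := by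
  rw [Metric.nhds_basis_ball.frequently_iff]
  intro ε hε
  obtain ⟨i, hi, hk, hy⟩ := hT.exists_return_past hc h h.regular.zpow_ne_mirror hε 1
  set f := (B.step (Real.tan θ) ^ (-(i : ℤ))) e₀ with hf
  refine ⟨f.y - e₀.y, by simpa using hy, fun h0 => ?_, -i, ?_⟩
  · have h1 : f = e₀ := Edge.ext' (by rw [hk, h.k_zero]) (by linarith)
    have h2 : (B.step (Real.tan θ) ^ (i : ℤ)) f = e₀ := by
      rw [hf, zpow_zpow_apply, add_neg_cancel, zpow_zero]; rfl
    rw [h1] at h2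
    have h3 := h.escape i
    rw [h2, h.k_zero] at h3
    omega
  · rw [← hf, Edge.tr, add_sub_cancel, h.k_zero, ← hk, pt_eta]

/-- The orbit accumulates on `e₀`, and the iterate leading from `e₀` to another trace point is a
local translation, which carries this accumulation there. -/
lemma IsTypical.preperfect_trace {θ : ℝ} (hc : 0 < Real.cos θ) (hT : B.IsTypical θ)
    {e₀ : B.Edge} (h : B.IsSoleEscape θ e₀) : Preperfect (B.trace θ e₀) := by
  intro x hx
  obtain ⟨y, rfl⟩ := trace_subset_range_curve θ e₀ hx
  obtain ⟨n, hn⟩ := (curve_mem_trace_iff hc.ne').1 hx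
  rw [accPt_iff_frequently]
  have hcont : Tendsto (fun t : ℝ => B.curve (y + t)) (𝓝 0) (𝓝 (B.curve y)) := by
    have : Continuous fun t : ℝ => B.curve (y + t) := continuous_curve.comp (by fun_prop)
    simpa using this.tendsto 0
  refine hcont.frequently (((hT.frequently_return hc h).and_eventually
    ((h.regular.eventually_zpow_tr n).and (Ioo_mem_nhds neg_one_lt_zero one_pos))).mono ?_)
  rintro t ⟨⟨ht0, m, hm⟩, ht, ht1⟩
  constructor
  · intro heq
    obtain ⟨l, hl⟩ := curve_eq_curve_iff.1 heq
    have h1 : t = -(2 * l) := by linarith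
    have h2 : (-1 : ℝ) < 2 * l := by linarith [ht1.2]
    have h3 : (2 * l : ℝ) < 1 := by linarith [ht1.1]
    have h4 : -1 < 2 * l := by exact_mod_cast h2
    have h5 : 2 * l < 1 := by exact_mod_cast h3
    have h6 : l = 0 := by omega
    rw [h6] at h1
    apply ht0
    rw [h1]; simp
  · refine (curve_mem_trace_iff hc.ne').2 ⟨n + m, ?_⟩
    rw [← zpow_zpow_apply, hm, ht, hn, pt_tr]

/-- If the closure of the trace contains an arc, then it contains a neighbourhood of the escape
point. -/
lemma IsSoleEscape.eventually_mem_closure {θ : ℝ} (hc : 0 < Real.cos θ)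
    {e₀ : B.Edge} (h : B.IsSoleEscape θ e₀) {u v : ℝ} (huv : u < v)
    (hsub : Ioo u v ⊆ closure (B.curve ⁻¹' B.trace θ e₀)) :
    ∀ᶠ t in 𝓝 (0 : ℝ), e₀.y + t ∈ closure (B.curve ⁻¹' B.trace θ e₀) := by
  set D := B.curve ⁻¹' B.trace θ e₀ with hD
  obtain ⟨w, hw⟩ := exists_between huv
  obtain ⟨y, hy, hyD⟩ := mem_closure_iff.1 (hsub hw) _ isOpen_Ioo hw
  -- The arc contains a trace point `y`; the local translation taking `e₀` to it, read backwards,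
  -- moves closure points near `y` to closure points near `e₀`.
  obtain ⟨n, hn⟩ := (curve_mem_trace_iff hc.ne').1 hyD
  have hcont : Tendsto (fun t : ℝ => y + t) (𝓝 0) (𝓝 y) := by
    have : Continuous fun t : ℝ => y + t := by fun_prop
    simpa using this.tendsto 0
  have h1 := (h.regular.eventually_zpow_tr n).eventually_nhds
  filter_upwards [h1, hcont.eventually (Ioo_mem_nhds hy.1 hy.2)] with t h2 h3
  have h4 : ∃ᶠ s in 𝓝 t, y + s ∈ D := by
    have h5 := mem_closure_iff_frequently.1 (hsub h3)
    have h6 : Tendsto (fun x : ℝ => x - y) (𝓝 (y + t)) (𝓝 t) := by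
      have : Continuous fun x : ℝ => x - y := by fun_prop
      simpa using this.tendsto (y + t)
    exact h6.frequently (h5.mono fun x hx => by rwa [add_sub_cancel])
  have h7 : Tendsto (fun s : ℝ => e₀.y + s) (𝓝 t) (𝓝 (e₀.y + t)) :=
    (Continuous.tendsto (by fun_prop) t)
  refine mem_closure_iff_frequently.2 (h7.frequently ((h4.and_eventually h2).mono ?_))
  rintro s ⟨hs, hs'⟩
  obtain ⟨m, hm⟩ := (curve_mem_trace_iff hc.ne').1 hs
  refine (curve_mem_trace_iff hc.ne').2 ⟨-n + m, ?_⟩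
  rw [← zpow_zpow_apply, hm, ← pt_tr, ← hn, ← hs', zpow_zpow_apply, neg_add_cancel, zpow_zero,
    ← pt_tr, h.eta]
  rfl

/-- Any point of `L` off the escape orbit returns to the neighbourhood of `e₀` filled by the
closure. Its return has trace points just above it, and right continuity of the inverse iterate
brings them back just above the original point. -/
lemma IsTypical.closure_eq_univ {θ : ℝ} (hc : 0 < Real.cos θ) (hT : B.IsTypical θ)
    {e₀ : B.Edge} (h : B.IsSoleEscape θ e₀) {u v : ℝ} (huv : u < v)
    (hsub : Ioo u v ⊆ closure (B.curve ⁻¹' B.trace θ e₀)) (w : ℝ) :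
    w ∈ closure (B.curve ⁻¹' B.trace θ e₀) := by
  have h1 := h.eventually_mem_closure hc huv hsub
  set D := B.curve ⁻¹' B.trace θ e₀ with hD
  obtain ⟨δ, hδ, h1⟩ := Metric.eventually_nhds_iff.1 h1
  by_cases hw : ∃ n : ℤ, (B.step (Real.tan θ) ^ n) (B.pt 0 w) = e₀
  · obtain ⟨n, hn⟩ := hw
    refine subset_closure ((curve_mem_trace_iff hc.ne').2 ⟨-n, ?_⟩)
    rw [← hn, zpow_zpow_apply, neg_add_cancel, zpow_zero]; rfl
  rw [not_exists] at hw
  obtain ⟨i, -, hk, hy⟩ := hT.exists_return_future hc h hw hδ 0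
  set f := (B.step (Real.tan θ) ^ (i : ℤ)) (B.pt 0 w) with hf
  obtain ⟨ε, hε, h2⟩ := exists_zpow_tr (Real.tan θ) (-(i : ℤ)) f
  have hback : (B.step (Real.tan θ) ^ (-(i : ℤ))) f = B.pt 0 w := by
    rw [hf, zpow_zpow_apply, neg_add_cancel, zpow_zero]; rfl
  refine Metric.mem_closure_iff.2 fun ρ hρ => ?_
  have hmin : 0 < min (min ε ρ) (δ - |f.y - e₀.y|) :=
    lt_min (lt_min hε hρ) (sub_pos.2 hy)
  -- Small enough for right continuity at `f`, for the required accuracy `ρ`, and for remaining in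
  -- the `δ`-neighbourhood of `e₀`.
  set μ := min (min ε ρ) (δ - |f.y - e₀.y|) with hμ
  have hmid : f.y + μ / 2 ∈ Ioo f.y (f.y + μ) := ⟨by linarith, by linarith⟩
  have hcl : f.y + μ / 2 ∈ closure D := by
    have := h1 (y := f.y - e₀.y + μ / 2) ?_
    · convert this using 1; ring
    · rw [dist_zero_right, Real.norm_eq_abs]
      have h3 := abs_add_le (f.y - e₀.y) (μ / 2)
      rw [abs_of_pos (half_pos hmin)] at h3
      linarith [min_le_right (min ε ρ) (δ - |f.y - e₀.y|)]
  obtain ⟨x, hx, hxD⟩ := mem_closure_iff.1 hcl _ isOpen_Ioo hmid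
  obtain ⟨m, hm⟩ := (curve_mem_trace_iff hc.ne').1 hxD
  have hμε : μ ≤ ε := (min_le_left _ _).trans (min_le_left _ _)
  have hμρ : μ ≤ ρ := (min_le_left _ _).trans (min_le_right _ _)
  have h4 := h2 (x - f.y) ⟨by linarith [hx.1], by linarith [hx.2]⟩
  have h5 : f.tr (x - f.y) = B.pt 0 x := by
    rw [Edge.tr, hk, add_sub_cancel]
  refine ⟨w + (x - f.y), (curve_mem_trace_iff hc.ne').2 ⟨-i + m, ?_⟩, ?_⟩
  · rw [← zpow_zpow_apply, hm, ← h5, h4, hback, pt_tr]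
  · rw [Real.dist_eq, sub_add_cancel_left, abs_neg, abs_of_pos (by linarith [hx.1])]
    linarith [hx.2]

/-- A subset of `L` whose lift contains no interval is totally disconnected. -/
lemma isTotallyDisconnected_of_forall_exists_notMem {C : Set B.Surface} (hC : C ⊆ range B.curve)
    (h : ∀ u v : ℝ, u < v → ∃ x ∈ Ioo u v, B.curve x ∉ C) : IsTotallyDisconnected C := by
  intro S hS hpre x₁ hx₁ x₂ hx₂
  by_contra hne
  obtain ⟨y₁, rfl⟩ := hC (hS hx₁)
  obtain ⟨y, rfl⟩ := hC (hS hx₂)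
  have hrep : ∀ x c : ℝ, ∃ x' ∈ Ico c (c + 2), B.curve x' = B.curve x := fun x c => by
    obtain ⟨m, hm, -⟩ := existsUnique_add_zsmul_mem_Ico (two_pos (α := ℝ)) x c
    refine ⟨_, hm, ?_⟩
    rw [zsmul_eq_mul, mul_comm, curve_add_int]
  obtain ⟨y₂, hy₂, heq⟩ := hrep y y₁
  rw [← heq] at hx₂ hne
  have hlt : y₁ < y₂ := lt_of_le_of_ne hy₂.1 fun he => hne (by rw [he])
  -- One missing point in each of the two arcs between `y₁` and `y₂`: they cut the circle into two
  -- closed arcs which meet only at these points, so a connected set cannot contain both ends.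
  obtain ⟨u, hu, huC⟩ := h y₁ y₂ hlt
  obtain ⟨v, hv, hvC⟩ := h y₂ (y₁ + 2) hy₂.2
  have hcov : S ⊆ B.curve '' Icc u v ∪ B.curve '' Icc v (u + 2) := by
    intro x hx
    obtain ⟨w, rfl⟩ := hC (hS hx)
    obtain ⟨w', hw', hww⟩ := hrep w u
    rcases le_total w' v with hle | hle
    · exact Or.inl ⟨w', ⟨hw'.1, hle⟩, hww⟩
    · exact Or.inr ⟨w', ⟨hle, hw'.2.le⟩, hww⟩
  obtain ⟨x, hxS, ⟨a, ha, rfl⟩, b, hb, hab⟩ := isPreconnected_closed_iff.1 hpre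
    (B.curve '' Icc u v) (B.curve '' Icc v (u + 2)) (isClosed_image_curve_Icc u v)
    (isClosed_image_curve_Icc v (u + 2)) hcov
    ⟨_, hx₂, y₂, ⟨hu.2.le, hv.1.le⟩, rfl⟩
    ⟨_, hx₁, y₁ + 2, ⟨hv.2.le, by linarith [hu.1]⟩, by simpa using curve_add_int (B := B) y₁ 1⟩
  obtain ⟨m, hm⟩ := curve_eq_curve_iff.1 hab
  have h1 : (-2 : ℝ) < 2 * m + 2 := by linarith [ha.1, ha.2, hb.1, hb.2, hu.1, hu.2, hv.1, hv.2]
  have h2 : (2 * m : ℝ) ≤ 0 := by linarith [ha.1, ha.2, hb.1, hb.2, hu.1, hu.2, hv.1, hv.2]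
  have h3 : -2 < 2 * m + 2 := by exact_mod_cast h1
  have h4 : 2 * m ≤ 0 := by exact_mod_cast h2
  rcases (by omega : m = 0 ∨ m = -1) with rfl | rfl
  · have : a = v := by push_cast at hm; linarith [ha.2, hb.1]
    rw [this] at hxS
    exact hvC (hS hxS)
  · have : a = u := by push_cast at hm; linarith [ha.1, hb.2]
    rw [this] at hxS
    exact huC (hS hxS)

/-- Either the closure contains an arc, which then spreads over all of `L`, or its lift contains no
interval; compactness and perfectness hold in any case. -/
lemma IsTypical.closure_trace {θ : ℝ} (hc : 0 < Real.cos θ) (hT : B.IsTypical θ)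
    {e₀ : B.Edge} (h : B.IsSoleEscape θ e₀) :
    closure (B.trace θ e₀) = B.proj '' B.section0 ∨ IsCantorSet (closure (B.trace θ e₀)) := by
  have hsub := trace_subset_range_curve θ e₀
  have hcl : closure (B.trace θ e₀) ⊆ range B.curve := closure_minimal hsub isClosed_range_curve
  by_cases hI : ∃ u v : ℝ, u < v ∧ Ioo u v ⊆ closure (B.curve ⁻¹' B.trace θ e₀)
  · left
    obtain ⟨u, v, huv, hI⟩ := hI
    rw [image_section0]
    refine hcl.antisymm ?_
    rintro _ ⟨w, rfl⟩
    exact (curve_mem_closure_iff hsub).2 (hT.closure_eq_univ hc h huv hI w)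
  · right
    refine ⟨⟨B.curve e₀.y, subset_closure ((curve_mem_trace_iff hc.ne').2 ⟨0, ?_⟩)⟩,
      isCompact_range_curve.of_isClosed_subset isClosed_closure hcl,
      (hT.preperfect_trace hc h).perfect_closure,
      isTotallyDisconnected_of_forall_exists_notMem hcl fun u v huv => ?_⟩
    · rw [h.eta, zpow_zero]; rfl
    · by_contra! hcon
      exact hI ⟨u, v, huv, fun x hx => (curve_mem_closure_iff hsub).1 (hcon x hx)⟩

end StepBilliard

end

/-! ### Assembly of the theorem -/

theorem mainTheorem4 (B : StepBilliard) (lam : ℝ) (hlam₀ : 0 < lam)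
    (hlam₁ : lam < (Real.sqrt 6 - 1) / 5) (hp : ∀ n, B.p (n + 1) ≤ lam * B.p n) :
    -- almost every direction is typical
    (∀ᵐ θ ∂(volume.restrict (Ioo 0 (Real.pi / 2))), B.IsTypical θ) ∧
    -- for every typical direction, with `η` the unique escape orbit:
    ∀ θ ∈ Ioo 0 (Real.pi / 2), B.IsTypical θ → ∀ η : Set B.Phase, B.IsEscapeOrbit θ η →
      -- (i)
      (∀ z ∈ η, B.OscillatesInPast θ z) ∧
      -- (ii)
      (∀ z, z ∉ η → B.proj '' η ⊆ B.omegaLim θ z) ∧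
      -- (iii)
      ((∃ z₀, {z | B.EscapesInPast θ z} = B.orbit θ z₀) ∧
        ∀ z, ¬ B.EscapesInPast θ z → B.proj '' η ⊆ B.alphaLim θ z) ∧
      -- (iv), forward and backward semi-orbits
      (∀ W : Set (B.Surface × B.Surface), IsOpen W → (∀ x, (x, x) ∈ W) → ∀ w ∈ η, ∀ T > 0,
        (∀ z, z ∉ η → ∃ t₀ ≥ T, ∀ s ∈ Icc (-T) T,
          (B.proj (B.flow θ (t₀ + s) z), B.proj (B.flow θ s w)) ∈ W) ∧
        (∀ z, ¬ B.EscapesInPast θ z → ∃ t₀ ≤ -T, ∀ s ∈ Icc (-T) T,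
          (B.proj (B.flow θ (t₀ + s) z), B.proj (B.flow θ s w)) ∈ W)) ∧
      -- (v)
      (∀ f : B.Surface → ℝ, Continuous f →
        (∀ t z, f (B.proj (B.flow θ t z)) = f (B.proj z)) → ∃ c, ∀ x, f x = c) ∧
      -- (vi)
      (B.IsMinimalFlow θ ↔ Dense (B.proj '' η)) ∧
      -- (vii)
      (closure (B.proj '' (η ∩ B.section0)) = B.proj '' B.section0 ∨
        IsCantorSet (closure (B.proj '' (η ∩ B.section0)))) := by
  -- A convenient rational bound; it implies the two inequalities of the measure estimates, `2 * lam
  -- < 1` and `lam / (1 - 2 * lam) < 1`.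
  have hlam : lam < 3 / 10 := by
    have h6 : Real.sqrt 6 < 5 / 2 := by
      rw [Real.sqrt_lt' (by norm_num)]; norm_num
    linarith
  refine ⟨StepBilliard.ae_isTypical hlam₀ hlam hp, fun θ hθ hT η hη => ?_⟩
  have hc : 0 < Real.cos θ := Real.cos_pos_of_mem_Ioo ⟨by linarith [hθ.1, Real.pi_pos], hθ.2⟩
  obtain ⟨e₀, h, hsole⟩ := hT.exists_isSoleEscape hc
  obtain rfl := hsole η hη
  refine ⟨fun z hz => hT.oscillatesInPast hc h hz, fun z hz => hT.subset_omegaLim hc h hz,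
    ⟨⟨_, hT.setOf_escapesInPast hc h⟩, fun z hz => (hT.approaches_past hc h hz).subset_omegaLimit h
      StepBilliard.tendsto_add_atBot⟩, fun W hW hd w hw T _ => ⟨fun z hz => ?_, fun z hz => ?_⟩,
    fun f hf hinv => hT.eq_const_of_invariant hc h hf hinv, hT.isMinimalFlow_iff hc h,
    hT.closure_trace hc h⟩
  · exact frequently_atTop.1 ((hT.approaches_future hc h hz).shadow h hw hW hd
      StepBilliard.tendsto_add_atTop T) T
  · exact frequently_atBot.1 ((hT.approaches_past hc h hz).shadow h hw hW hd
      StepBilliard.tendsto_add_atBot T) (-T)
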